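/- **Turing machines.** $M$ is a deterministic off-line Turing machine: finite state set $Q\subset\mathbb Z$, initial state $q_0$, accepting state $h_a$, a read-only input tape holding a nonempty word $w$ over $\Sigma=\{0,1\}$ and nothing else, a one-way infinite working tape over $\Gamma=\{0,1,2\}$ with blank $2$ (initially all blank), both heads initially on the first square, and a partial transition function $\delta\colon Q\times\Sigma\times\Gamma\rightharpoonup Q\times\Gamma\times\{L,R,S\}\times\{L,R,S\}$, undefined at $h_a$ (new state, symbol written, move of the input head, move of the working head). There is no transition from a configuration if $\delta$ is undefined there or a head would leave its tape. $M$ has time complexity $t$ if for every $n\ge 1$ it halts on all inputs of length $n$ and $t(n)$ is the maximal number of transitions on them. **Graph programs.** Host graphs are finite directed multigraphs with some nodes distinguished as roots; nodes and edges are labelled by an atom (an integer, "L", "R", "I" or empty) and an optional mark (red, green, blue, grey, dashed). Rules are double-pushout rules $L\leftarrow K\to R$ with a discrete unlabelled interface $K$, applied via injective label-preserving matches that preserve and reflect roots and satisfy the dangling condition. Programs (Small GP 2) are built from calls of rule sets, "$;$", *if*/*try*–*then*–*else*, as-long-as-possible iteration $P!$ and *break*, with the usual small-step semantics: a rule set call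 fails if no rule applies; a failing loop body or condition is undone; *if* also undoes a successful condition; *break* ends the enclosing loop. The time of a terminating derivation is the number of rule set calls, including failing and undone calls and those made inside conditions and loop bodies. The time complexity of a program is the maximum of this number over the terminating derivations from inputs of the given size. **Configuration graphs.** For a configuration $S$ of $M$ and $k\ge0$ put $c=k+2$, $b=3^{c}$; $\mathrm{enc}_k(S)$ is defined if the working head is on one of the first $bc$ squares and all later squares are blank. Its nodes are: a central node (the only root), labelled by the state; the squares of the input tape, labelled by their symbols; $b$ block nodes with empty labels; and $c$ cache nodes. All but the central node form three doubly linked lists (red edges to the right neighbour, blue edges to the left). If the working head is on square $jc+i$ with $0\le i<c$ ($j$ is the *active* block), the cache is labelled with the symbols on squares $jc,\dots,jc+c-1$. A dashed edge goes from each block node $j'\neq j$ to the block node whose index is the content of squares $j'c,\dots,j'c+c-1$ read as a ternary number (leftmost digit most significant), and from block node $j$ to block node $0$. The central node has a green edge labelled "I" to the first input square, an unlabelled green edge to the position of the input head, a blue edge to block node $0$, a dashed edge to block node $j$, a red edge to the last cache node, and an unmarked unlabelled edge to cache node $i$. The *input graph* of $w$ consists of the central node labelled $q_0$, the input list and the two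 green edges, both to the first square. Graphs are taken up to isomorphism. **The program** $\mathrm{Sim}(M)$. Missing *then*/*else* parts do nothing. - $\mathrm{Main}=\mathit{setup};\ \mathrm{Simulate}!$ - $\mathrm{Simulate}=\mathrm{Transitions};$ try $\mathrm{MoveLeft};$ try $\mathrm{MoveRight};$ try $\mathrm{Left}$ then $\mathrm{PrevBlock};$ try $\mathrm{Right}$ then $\mathrm{NextBlock};$ try $\mathrm{Flag}$ then $\mathrm{Restart}$ - $\mathrm{NextBlock}=\mathrm{Encode};$ try $\mathrm{Next}$ then $(\mathrm{HeadLeft}!;\mathrm{Decode})$ else $\mathrm{SetFlag}$ - $\mathrm{PrevBlock}=\mathrm{Encode};\mathrm{Prev};\mathrm{HeadRight}!;\mathrm{Decode}$ - $\mathrm{Encode}=\mathrm{EncodeInit};\mathrm{Encoding}!;\mathrm{Update}$ - $\mathrm{Encoding}=\mathrm{CacheDec};$ try $\mathrm{Finish}$ then break; try $\mathit{next\_value}$ - $\mathrm{CacheDec}=\mathrm{CacheInit};\mathrm{Decrement}!;$ if $\mathrm{Unfinished}$ then $\mathrm{Reset}!$ - $\mathrm{Decrement}=$ try $\mathrm{Dec}$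 then $(\mathrm{Finish};$ break$)$ else $(\mathit{underflow};$ try $\mathrm{CacheNext}$ else break$)$ - $\mathrm{Reset}=\mathit{overflow};$ try $\mathrm{CachePrev}$ else break - $\mathrm{Decode}=\mathrm{DecodeInit};\mathrm{Decoding}!;\mathrm{Update}$ - $\mathrm{Decoding}=$ try $\mathit{prev\_value}$ else break; $\mathrm{CacheInc}$ - $\mathrm{CacheInc}=\mathrm{CacheInit};\mathrm{Increment}!;$ if $\mathrm{Unfinished}$ then $(\mathrm{Reset}!;\mathrm{Finish})$ - $\mathrm{Increment}=$ try $\mathrm{Inc}$ then $(\mathrm{Finish};$ break$)$ else $(\mathit{overflow};$ try $\mathrm{CacheNext}$ else break$)$ - $\mathrm{Restart}=\mathrm{RewindTapes};\mathrm{ResetCache};\mathrm{ResetBlockset}$ - $\mathrm{RewindTapes}=$ try $\mathrm{RewindInput};$ try $\mathit{rewind\_blockset};\mathrm{RewindCache}!$ - $\mathrm{ResetCache}=\mathrm{CInit};\mathrm{Erase}!;\mathit{end}$ - $\mathrm{ResetBlockset}=\mathit{binit};$ try $\mathrm{Undirect};(\mathit{copy};$ try $\mathrm{Undirect})!;\mathit{glue};\mathit{direct}!;\mathit{unroot}$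 The rule sets (the rule instances range over the states and symbols involved) do the following. *setup* adds to the input graph the cache and block nodes of $\mathrm{enc}_0$ of the initial configuration. Transitions applies an entry of $\delta$: it changes the state and the scanned cache symbol, moves the input head, and labels the unmarked edge "L" or "R" if the working head has to move. MoveLeft, MoveRight move the unmarked edge from the scanned cache node to its left, right neighbour and delete its label; Left, Right only delete that label; HeadLeft, HeadRight move the unlabelled unmarked edge one cache node. Next, Prev move the central dashed edge to the right, left neighbour of the active block node. SetFlag marks the central node grey; Flag removes that mark and sets the state to $q_0$. CacheInit makes the last cache node a red root; Dec, Inc decrease, increase by one the digit at the red root (not below $0$, above $2$); *underflow*, *overflow* change it from $0$ to $2$, from $2$ to $0$; CacheNext, CachePrev move the red root to the left, to the right; Finish removes the red root; Unfinished tests for it. EncodeInit makes block node $0$ a blue root, DecodeInit the target of the dashed edge of the active block node; *next_value*, *prev_value* move the blue root to the right, to the left; Update redirects the dashed edge of the active block node to the blue root, whose root status and mark are removed. In Restart (state $q_0$), RewindInput and *rewind_blockset* move the unlabelled green and the dashed edge of the central node to the first input square and to block node $0$; RewindCache moves the unmarked edge one cache node to the left. CInit writes $2$ on the scanned cache node and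 makes it a red root; Erase moves the red root to the right and writes $2$ there; *end* removes the red root, which is on the last cache node, and appends a cache node labelled $2$, to which the central red edge is moved. *binit* makes block node $0$ a blue root and creates two new blue roots labelled $1$ and $2$, each with a blue edge of the same label from the central node; *copy* moves the first blue root to its right neighbour and appends a node to each of the two new lists, to which the blue roots labelled $1$, $2$ move; Undirect deletes the dashed edge leaving the unlabelled blue root. *glue* links the old list, the first and the second copy in this order, deletes the two auxiliary edges, leaves of the blue roots only the one labelled $2$ (the last node) and gives it a dashed loop, and makes its left neighbour an unmarked root. *direct* adds a dashed edge from the unmarked root to the last node and moves the unmarked root to the left; *unroot* adds a dashed loop at the unmarked root (then block node $0$) and restores both roots to ordinary block nodes. **Theorem (Time Complexity).** Let $M$ be a deterministic off-line Turing machine of time complexity $t(n)$. Then $M$ is simulated by $\mathrm{Sim}(M)$ in time $O(t(n)^2)$, where $n$ is the length of the input word. In detail: 1. (Simulation) From the input graph of any nonempty word, $\mathrm{Sim}(M)$ reaches $\langle \mathrm{Simulate}!,\mathrm{enc}_0(I)\rangle$, where $I$ is the initial configuration. Whenever $I\Rightarrow_M^* S\Rightarrow_M S'$, there is $k$ such that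 $\langle \mathrm{Simulate}!,\mathrm{enc}_0(I)\rangle\to^*\langle \mathrm{Simulate}!,\mathrm{enc}_k(S)\rangle$ and $\langle \mathrm{Simulate},\mathrm{enc}_k(S)\rangle\to^*\mathrm{enc}_k(S')$. Every terminating derivation of $\mathrm{Sim}(M)$ from the input graph ends in $\mathrm{enc}_k(S)$ for some $k$, with $S$ the configuration in which $M$ halts. 2. (Time) On input graphs of words of length $n\ge1$, $\mathrm{Sim}(M)$ has no infinite derivation, the maximum $T(n)$ of the numbers of rule calls in its terminating derivations exists, and there is a constant $C$ (depending on $M$) with $T(n)\le C\,\max(1,t(n))^2$ for all $n\ge 1$. -/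

import Mathlib

/-! Small GP 2 graph programs, off-line Turing machines, and the graph program simulating them. -/

namespace SGP2

/-! ### Graphs -/

inductive Atom
  | int (z : ℤ)
  | L
  | R
  | I
  | empty

/-- `plain` stands for the absence of a mark. -/
inductive Mark
  | plain
  | red
  | green
  | blue
  | grey
  | dashed

structure Label where
  atom : Atom
  mark : Mark

structure Edge (N : Type) where
  src : N
  tgt : N
  label : Label

def Edge.map {N N' : Type} (f : N → N') (e : Edge N) : Edge N' :=
  ⟨f e.src, f e.tgt, e.label⟩

/-- Totally labelled graphs with nodes named by elements of `N`: `V` is the finite set of nodes, `P`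
the set of roots, `l` the labelling of the nodes (its values outside `V` are irrelevant).
Edges are only ever used up to renaming, and are given by the finite multiset `E` of the
triples (source, target, label); parallel edges, also with the same label, and loops are allowed. -/
structure Graph (N : Type) where
  V : Finset N
  P : Finset N
  l : N → Label
  E : Multiset (Edge N)
  root_mem : ∀ v ∈ P, v ∈ V
  edge_mem : ∀ e ∈ E, e.src ∈ V ∧ e.tgt ∈ V

/-- Isomorphism of graphs. -/
def Graph.Iso {N N' : Type} (G : Graph N) (H : Graph N') : Prop :=
  ∃ f : N → N', Set.InjOn f ↑G.V ∧ f '' ↑G.V = ↑H.V ∧ (∀ v ∈ G.V, (f v ∈ H.P ↔ v ∈ G.P)) ∧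
    (∀ v ∈ G.V, H.l (f v) = G.l v) ∧ G.E.map (Edge.map f) = H.E

/-- Host graphs: the names of nodes are natural numbers. -/
abbrev HostGraph := Graph ℕ

/-! ### Rules -/

/-- A rule `L ← K → R`; the interface consists of unlabelled nodes only, so it is a set of nodes. -/
structure Rule where
  L : Graph ℕ
  K : Finset ℕ
  R : Graph ℕ
  K_sub_L : K ⊆ L.V
  K_sub_R : K ⊆ R.V

/-- `r.Applies G H`: the host graph `H` results from `G` by applying `r`. Here `g` is the match on
nodes, `D` the multiset of the edges of `G` outside the match (an injective, source-, target-
and label-preserving map of edges exists iff `L.E.map (Edge.map g)` is a submultiset of `G.E`),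
and `h` maps the nodes of the right-hand side into `H`; created nodes get any fresh names. -/
def Rule.Applies (r : Rule) (G H : HostGraph) : Prop :=
  ∃ (g h : ℕ → ℕ) (D : Multiset (Edge ℕ)),
    -- `g` is an injective graph morphism from `L` to `G` that preserves and reflects roots
    Set.InjOn g ↑r.L.V ∧
    (∀ v ∈ r.L.V, g v ∈ G.V ∧ G.l (g v) = r.L.l v ∧ (g v ∈ G.P ↔ v ∈ r.L.P)) ∧
    G.E = r.L.E.map (Edge.map g) + D ∧
    -- the dangling condition
    (∀ v ∈ r.L.V \ r.K, ∀ e ∈ D, e.src ≠ g v ∧ e.tgt ≠ g v) ∧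
    -- `h` agrees with `g` on the interface and names the created nodes
    (∀ v ∈ r.K, h v = g v) ∧
    Set.InjOn h ↑(r.R.V \ r.K) ∧
    (∀ v ∈ r.R.V \ r.K, h v ∉ G.V \ (r.L.V \ r.K).image g) ∧
    -- the resulting graph
    H.V = (G.V \ (r.L.V \ r.K).image g) ∪ (r.R.V \ r.K).image h ∧
    H.E = D + r.R.E.map (Edge.map h) ∧
    (∀ v ∈ G.V \ r.L.V.image g, H.l v = G.l v) ∧
    (∀ v ∈ r.R.V, H.l (h v) = r.R.l v) ∧
    H.P = (G.P \ r.L.V.image g) ∪ r.R.P.image h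

/-! ### Programs and their semantics -/

inductive Com
  /-- call of a rule set -/
  | call (R : Set Rule)
  | seq (P Q : Com)
  /-- `if C then P else Q` -/
  | ite (C P Q : Com)
  /-- `try C then P else Q` -/
  | tte (C P Q : Com)
  /-- `P!` -/
  | loop (P : Com)
  | brk

inductive Config
  | run (P : Com) (G : HostGraph)
  | done (G : HostGraph)
  | fail

/-- `G ⇒ H` for a rule set. -/
def SetApplies (R : Set Rule) (G H : HostGraph) : Prop := ∃ r ∈ R, r.Applies G H

/-
`Step γ n δ` is the small-step transition relation of the semantics, and `Derives γ n δ` its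
reflexive-transitive closure; `n` is the number of calls of rule sets made, where the calls
in the premises (bodies of loops, conditions of branching commands), including the failing calls
and the calls whose effect is undone, are counted as well. Where the semantics has the transitive
closure in a premise, source and target are different, so `Derives` can be used.
-/
mutual

inductive Step : Config → ℕ → Config → Prop
  | call₁ {R : Set Rule} {G H : HostGraph} :
      SetApplies R G H → Step (.run (.call R) G) 1 (.done H)
  | call₂ {R : Set Rule} {G : HostGraph} :
      (¬ ∃ H, SetApplies R G H) → Step (.run (.call R) G) 1 .fail
  | seq₁ {P P' Q : Com} {G H : HostGraph} {n : ℕ} :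
      Step (.run P G) n (.run P' H) → Step (.run (.seq P Q) G) n (.run (.seq P' Q) H)
  | seq₂ {P Q : Com} {G H : HostGraph} {n : ℕ} :
      Step (.run P G) n (.done H) → Step (.run (.seq P Q) G) n (.run Q H)
  | seq₃ {P Q : Com} {G : HostGraph} {n : ℕ} :
      Step (.run P G) n .fail → Step (.run (.seq P Q) G) n .fail
  | if₁ {C P Q : Com} {G H : HostGraph} {n : ℕ} :
      Derives (.run C G) n (.done H) → Step (.run (.ite C P Q) G) n (.run P G)
  | if₂ {C P Q : Com} {G : HostGraph} {n : ℕ} :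
      Derives (.run C G) n .fail → Step (.run (.ite C P Q) G) n (.run Q G)
  | try₁ {C P Q : Com} {G H : HostGraph} {n : ℕ} :
      Derives (.run C G) n (.done H) → Step (.run (.tte C P Q) G) n (.run P H)
  | try₂ {C P Q : Com} {G : HostGraph} {n : ℕ} :
      Derives (.run C G) n .fail → Step (.run (.tte C P Q) G) n (.run Q G)
  | alap₁ {P : Com} {G H : HostGraph} {n : ℕ} :
      Derives (.run P G) n (.done H) → Step (.run (.loop P) G) n (.run (.loop P) H)
  | alap₂ {P : Com} {G : HostGraph} {n : ℕ} :
      Derives (.run P G) n .fail → Step (.run (.loop P) G) n (.done G)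
  | alap₃ {P : Com} {G H : HostGraph} {n : ℕ} :
      Derives (.run P G) n (.run .brk H) → Step (.run (.loop P) G) n (.done H)
  | brk {P : Com} {G : HostGraph} : Step (.run (.seq .brk P) G) 0 (.run .brk G)

inductive Derives : Config → ℕ → Config → Prop
  | refl (γ : Config) : Derives γ 0 γ
  | head {γ δ ε : Config} {m n : ℕ} : Step γ m δ → Derives δ n ε → Derives γ (m + n) ε

end

def Terminal (γ : Config) : Prop := ¬ ∃ n δ, Step γ n δ

/-- `T` is the time complexity of the program `P` on the inputs `I`, where `I n` is the set of the
inputs of size `n`: for every `n ≥ 1`, there is no infinite derivation sequence that starts with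
`P` on an input of size `n`, and `T n` is the maximal number of rule calls in terminating
derivation sequences that start with `P` on inputs of size `n`. -/
def HasTimeComplexity (P : Com) (I : ℕ → Set HostGraph) (T : ℕ → ℕ) : Prop :=
  ∀ n : ℕ, 1 ≤ n →
    (∀ G ∈ I n, ¬ ∃ γ : ℕ → Config, γ 0 = .run P G ∧ ∀ i, ∃ m, Step (γ i) m (γ (i + 1))) ∧
    IsGreatest {m | ∃ G ∈ I n, ∃ γ, Terminal γ ∧ Derives (.run P G) m γ} (T n)

/-- The command doing nothing, as a loop that is left at once; it makes no rule call. -/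
def skip : Com := .loop .brk

def tryDo (C : Com) : Com := .tte C skip skip
def tryThen (C P : Com) : Com := .tte C P skip
def tryElse (C Q : Com) : Com := .tte C skip Q
def ifThen (C P : Com) : Com := .ite C P skip

infixr:60 " ;; " => Com.seq

/-- The graph with the nodes `(name, label, whether it is a root)` and the edges listed. -/
def mkGraph (ns : List (ℕ × Label × Bool)) (es : List (Edge ℕ))
    (h : ∀ e ∈ es, e.src ∈ ns.map Prod.fst ∧ e.tgt ∈ ns.map Prod.fst) : Graph ℕ where
  V := (ns.map Prod.fst).toFinset
  P := ((ns.filter fun x => x.2.2).map Prod.fst).toFinset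
  l v := match ns.find? fun x => x.1 = v with
    | some x => x.2.1
    | none => ⟨.empty, .plain⟩
  E := es
  root_mem := by
    intro v hv
    simp only [List.mem_toFinset, List.mem_map, List.mem_filter] at hv ⊢
    obtain ⟨x, hx, rfl⟩ := hv
    exact ⟨x, hx.1, rfl⟩
  edge_mem := by
    intro e he
    simpa using h e he

/-- A rule, given by the nodes and edges of its left-hand side and of its right-hand side;
the interface consists of the nodes that occur in both. -/
def mkRule (ln : List (ℕ × Label × Bool)) (le : List (Edge ℕ))
    (rn : List (ℕ × Label × Bool)) (re : List (Edge ℕ))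
    (hl : ∀ e ∈ le, e.src ∈ ln.map Prod.fst ∧ e.tgt ∈ ln.map Prod.fst)
    (hr : ∀ e ∈ re, e.src ∈ rn.map Prod.fst ∧ e.tgt ∈ rn.map Prod.fst) : Rule where
  L := mkGraph ln le hl
  K := (mkGraph ln le hl).V ∩ (mkGraph rn re hr).V
  R := mkGraph rn re hr
  K_sub_L := Finset.inter_subset_left
  K_sub_R := Finset.inter_subset_right

/-! ### Off-line Turing machines -/

/-- Moves of a head: left, right, stay. -/
inductive Dir
  | L
  | R
  | S

/-- Deterministic off-line Turing machines: finite set `Q` of states, which are integers, initial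
state `q₀`, accepting state `hₐ`, input alphabet `{0,1}`, working tape alphabet `{0,1,2}` with
blank symbol `2`. If `δ q a b = some (q', b', D₁, D₂)`, then in state `q`, reading `a` on the
input tape and `b` on the working tape, the machine goes into state `q'`, writes `b'` on the
working tape, and moves the head on the input tape by `D₁`, the one on the working tape by `D₂`. -/
structure OfflineTM where
  Q : Finset ℤ
  q₀ : Q
  hₐ : Q
  δ : Q → Fin 2 → Fin 3 → Option (Q × Fin 3 × Dir × Dir)
  accept_halts : ∀ a b, δ hₐ a b = none

namespace OfflineTM

variable (M : OfflineTM)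

/-- Configurations, without the input word: state, position of the head on the input tape,
contents of the one-way infinite working tape, position of the head on the working tape. -/
structure Conf where
  state : M.Q
  inPos : ℕ
  tape : ℕ → Fin 3
  pos : ℕ

def init : M.Conf := ⟨M.q₀, 0, fun _ => 2, 0⟩

end OfflineTM

/-- The new position of a head; a head cannot move to the left from the leftmost square. -/
def Dir.move : Dir → ℕ → Option ℕ
  | .L, 0 => none
  | .L, i + 1 => some i
  | .R, i => some (i + 1)
  | .S, i => some i

namespace OfflineTM

variable (M : OfflineTM)

/-- `S ⇒ S'` on the input `w`. There is no transition if `δ` is undefined or if a head would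
leave its tape. -/
def Trans (w : List (Fin 2)) (S S' : M.Conf) : Prop :=
  ∃ a b' D₁ D₂, w[S.inPos]? = some a ∧ M.δ S.state a (S.tape S.pos) = some (S'.state, b', D₁, D₂) ∧
    D₁.move S.inPos = some S'.inPos ∧ S'.inPos < w.length ∧
    D₂.move S.pos = some S'.pos ∧ S'.tape = Function.update S.tape S.pos b'

/-- `M.Reach w m S`: on the input `w`, the configuration `S` is reached after `m` transitions. -/
inductive Reach (w : List (Fin 2)) : ℕ → M.Conf → Prop
  | init : Reach w 0 M.init
  | step {m : ℕ} {S S' : M.Conf} : Reach w m S → M.Trans w S S' → Reach w (m + 1) S'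

/-- On the input `w`, the machine halts in the configuration `S` after `m` transitions. -/
def HaltsIn (w : List (Fin 2)) (m : ℕ) (S : M.Conf) : Prop :=
  M.Reach w m S ∧ ¬ ∃ S', M.Trans w S S'

/-- `t` is the time complexity of `M`: `M` halts on every (nonempty) input, and for `n ≥ 1`, the
maximal number of transitions on inputs of length `n` is `t n`. -/
def HasTimeComplexity (t : ℕ → ℕ) : Prop :=
  ∀ n : ℕ, 1 ≤ n →
    (∀ w : List (Fin 2), w.length = n → ∃ m S, M.HaltsIn w m S) ∧
    IsGreatest {m | ∃ (w : List (Fin 2)) (S : M.Conf), w.length = n ∧ M.HaltsIn w m S} (t n)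

end OfflineTM

/-! ### The simulating program -/

section Sim

/-- Atom `z` (an integer) with a mark. -/
def num (z : ℤ) (m : Mark := .plain) : Label := ⟨.int z, m⟩

/-- The atom `empty` with a mark. -/
def emp (m : Mark) : Label := ⟨.empty, m⟩

/-- A node that is not a root. -/
def nd (v : ℕ) (a : Label) : ℕ × Label × Bool := (v, a, false)

/-- A root. -/
def rt (v : ℕ) (a : Label) : ℕ × Label × Bool := (v, a, true)

/-- Edge from a node to its right neighbour in a list; also from the central node to the rightmost
node of the cache. -/
def eRight {N : Type} (u v : N) : Edge N := ⟨u, v, emp .red⟩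

/-- Edge from a node to its left neighbour in a list; also from the central node to the leftmost
block node. -/
def eLeft {N : Type} (u v : N) : Edge N := ⟨u, v, emp .blue⟩

/-- Dashed edge: from the central node to the active block node, and from a block node to the block
node whose index is the content of the block. -/
def eDash {N : Type} (u v : N) : Edge N := ⟨u, v, emp .dashed⟩

/-- Edge from the central node to the leftmost square of the input tape. -/
def eFirst {N : Type} (u v : N) : Edge N := ⟨u, v, ⟨.I, .green⟩⟩

/-- Edge from the central node to the position of the head on the input tape. -/
def eIn {N : Type} (u v : N) : Edge N := ⟨u, v, emp .green⟩

/-- Edge from the central node to the position of the head in the cache; the atom is `L` or `R` as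
long as a move of the head to the left or to the right is pending. -/
def eHead {N : Type} (u v : N) (a : Atom := .empty) : Edge N := ⟨u, v, ⟨a, .plain⟩⟩

/-- The two edges between the neighbours `u` (left) and `v` (right) in a doubly linked list. -/
def link {N : Type} (u v : N) : List (Edge N) := [eRight u v, eLeft v u]

/-- The atom recording a pending move of the head on the working tape. -/
def Dir.atom : Dir → Atom
  | .L => .L
  | .R => .R
  | .S => .empty

/- In the rules below, the node `0` is the central node wherever it is an unmarked or grey root
labelled with a state. -/

variable (M : OfflineTM)

/-- Creates the cache (two nodes, `10` and `11`) and the block nodes (nine nodes, `1` to `9`) for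
an empty working tape. -/
def setup : Com := .call {mkRule [rt 0 (num M.q₀)] []
  ([rt 0 (num M.q₀), nd 1 (emp .plain), nd 2 (emp .plain), nd 3 (emp .plain), nd 4 (emp .plain),
    nd 5 (emp .plain), nd 6 (emp .plain), nd 7 (emp .plain), nd 8 (emp .plain), nd 9 (emp .plain),
    nd 10 (num 2), nd 11 (num 2)])
  (link 1 2 ++ link 2 3 ++ link 3 4 ++ link 4 5 ++ link 5 6 ++ link 6 7 ++ link 7 8 ++ link 8 9 ++
    link 10 11 ++
    [eDash 1 1, eDash 2 9, eDash 3 9, eDash 4 9, eDash 5 9, eDash 6 9, eDash 7 9, eDash 8 9,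
      eDash 9 9, eLeft 0 1, eDash 0 1, eRight 0 11, eHead 0 10])
  (by simp) (by simp [rt, nd, link, eRight, eLeft, eDash, eHead])}

/-- The rule for a transition `δ q a x = some (p, y, .S, Y)`. -/
def transStay (q : M.Q) (a : Fin 2) (x : Fin 3) (p : M.Q) (y : Fin 3) (Y : Dir) : Rule := mkRule
  [rt 0 (num q), nd 1 (num a.val), nd 2 (num x.val)] [eIn 0 1, eHead 0 2]
  [rt 0 (num p), nd 1 (num a.val), nd 2 (num y.val)] [eIn 0 1, eHead 0 2 Y.atom]
  (by simp [rt, nd, eIn, eHead]) (by simp [rt, nd, eIn, eHead])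

/-- The rule for a transition `δ q a x = some (p, y, .L, Y)` and the symbol `b` on the left of the
head on the input tape. -/
def transLeft (q : M.Q) (a : Fin 2) (x : Fin 3) (p : M.Q) (y : Fin 3) (Y : Dir) (b : Fin 2) :
    Rule := mkRule
  [rt 0 (num q), nd 1 (num a.val), nd 2 (num x.val), nd 3 (num b.val)]
  [eIn 0 1, eLeft 1 3, eHead 0 2]
  [rt 0 (num p), nd 1 (num a.val), nd 2 (num y.val), nd 3 (num b.val)]
  [eIn 0 3, eLeft 1 3, eHead 0 2 Y.atom]
  (by simp [rt, nd, eIn, eLeft, eHead]) (by simp [rt, nd, eIn, eLeft, eHead])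

/-- The rule for a transition `δ q a x = some (p, y, .R, Y)` and the symbol `b` on the right of the
head on the input tape. -/
def transRight (q : M.Q) (a : Fin 2) (x : Fin 3) (p : M.Q) (y : Fin 3) (Y : Dir) (b : Fin 2) :
    Rule := mkRule
  [rt 0 (num q), nd 1 (num a.val), nd 2 (num x.val), nd 3 (num b.val)]
  [eIn 0 1, eRight 1 3, eHead 0 2]
  [rt 0 (num p), nd 1 (num a.val), nd 2 (num y.val), nd 3 (num b.val)]
  [eIn 0 3, eRight 1 3, eHead 0 2 Y.atom]
  (by simp [rt, nd, eIn, eRight, eHead]) (by simp [rt, nd, eIn, eRight, eHead])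

/-- One rule for each entry of the transition table (and each symbol on the neighbouring square of
the input tape, if the head on the input tape moves). -/
def transitions : Com := .call {r | ∃ q a x p y Y,
  (M.δ q a x = some (p, y, .S, Y) ∧ r = transStay M q a x p y Y) ∨
  (M.δ q a x = some (p, y, .L, Y) ∧ ∃ b, r = transLeft M q a x p y Y b) ∨
  (M.δ q a x = some (p, y, .R, Y) ∧ ∃ b, r = transRight M q a x p y Y b)}

/-- Executes a pending move to the left within the cache. -/
def moveLeft : Com := .call {r | ∃ (q : M.Q) (x y : Fin 3), r = mkRule
  [rt 0 (num q), nd 1 (num x.val), nd 2 (num y.val)] [eHead 0 1 .L, eLeft 1 2]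
  [rt 0 (num q), nd 1 (num x.val), nd 2 (num y.val)] [eHead 0 2, eLeft 1 2]
  (by simp [rt, nd, eHead, eLeft]) (by simp [rt, nd, eHead, eLeft])}

/-- Executes a pending move to the right within the cache. -/
def moveRight : Com := .call {r | ∃ (q : M.Q) (x y : Fin 3), r = mkRule
  [rt 0 (num q), nd 1 (num x.val), nd 2 (num y.val)] [eHead 0 1 .R, eRight 1 2]
  [rt 0 (num q), nd 1 (num x.val), nd 2 (num y.val)] [eHead 0 2, eRight 1 2]
  (by simp [rt, nd, eHead, eRight]) (by simp [rt, nd, eHead, eRight])}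

/-- Removes the note of a move to the left that is still pending. -/
def left : Com := .call {r | ∃ (q : M.Q) (x : Fin 3), r = mkRule
  [rt 0 (num q), nd 1 (num x.val)] [eHead 0 1 .L]
  [rt 0 (num q), nd 1 (num x.val)] [eHead 0 1]
  (by simp [rt, nd, eHead]) (by simp [rt, nd, eHead])}

/-- Removes the note of a move to the right that is still pending. -/
def right : Com := .call {r | ∃ (q : M.Q) (x : Fin 3), r = mkRule
  [rt 0 (num q), nd 1 (num x.val)] [eHead 0 1 .R]
  [rt 0 (num q), nd 1 (num x.val)] [eHead 0 1]
  (by simp [rt, nd, eHead]) (by simp [rt, nd, eHead])}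

/-- Makes the right neighbour of the active block node the active one. -/
def next : Com := .call {r | ∃ q : M.Q, r = mkRule
  [rt 0 (num q), nd 1 (emp .plain), nd 2 (emp .plain)] [eDash 0 1, eRight 1 2]
  [rt 0 (num q), nd 1 (emp .plain), nd 2 (emp .plain)] [eDash 0 2, eRight 1 2]
  (by simp [rt, nd, eDash, eRight]) (by simp [rt, nd, eDash, eRight])}

/-- Makes the left neighbour of the active block node the active one. -/
def prev : Com := .call {r | ∃ q : M.Q, r = mkRule
  [rt 0 (num q), nd 1 (emp .plain), nd 2 (emp .plain)] [eDash 0 1, eLeft 1 2]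
  [rt 0 (num q), nd 1 (emp .plain), nd 2 (emp .plain)] [eDash 0 2, eLeft 1 2]
  (by simp [rt, nd, eDash, eLeft]) (by simp [rt, nd, eDash, eLeft])}

/-- Notes, by a grey mark of the central node, that the tape has to be extended. -/
def setFlag : Com := .call {r | ∃ q : M.Q, r = mkRule
  [rt 0 (num q)] [] [rt 0 (num q .grey)] [] (by simp) (by simp)}

/-- Removes the grey mark and returns to the initial state. -/
def flag : Com := .call {r | ∃ q : M.Q, r = mkRule
  [rt 0 (num q .grey)] [] [rt 0 (num M.q₀)] [] (by simp) (by simp)}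

/-- Moves the head one node to the left in the cache. -/
def headLeft : Com := .call {r | ∃ (q : M.Q) (x y : Fin 3), r = mkRule
  [rt 0 (num q), nd 1 (num x.val), nd 2 (num y.val)] [eHead 0 1, eLeft 1 2]
  [rt 0 (num q), nd 1 (num x.val), nd 2 (num y.val)] [eHead 0 2, eLeft 1 2]
  (by simp [rt, nd, eHead, eLeft]) (by simp [rt, nd, eHead, eLeft])}

/-- Moves the head one node to the right in the cache. -/
def headRight : Com := .call {r | ∃ (q : M.Q) (x y : Fin 3), r = mkRule
  [rt 0 (num q), nd 1 (num x.val), nd 2 (num y.val)] [eHead 0 1, eRight 1 2]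
  [rt 0 (num q), nd 1 (num x.val), nd 2 (num y.val)] [eHead 0 2, eRight 1 2]
  (by simp [rt, nd, eHead, eRight]) (by simp [rt, nd, eHead, eRight])}

/-! The cache as a ternary counter: a red root runs through the digits. -/

/-- Turns the rightmost digit into a red root. -/
def cacheInit : Com := .call {r | ∃ (q : M.Q) (x : Fin 3), r = mkRule
  [rt 0 (num q), nd 1 (num x.val)] [eRight 0 1]
  [rt 0 (num q), rt 1 (num x.val .red)] [eRight 0 1]
  (by simp [rt, nd, eRight]) (by simp [rt, eRight])}

/-- Changes the digit `x` at the red root into `y`. -/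
def digit (x y : ℤ) : Rule := mkRule
  [rt 0 (num x .red)] [] [rt 0 (num y .red)] [] (by simp) (by simp)

def dec : Com := .call {digit 2 1, digit 1 0}
def inc : Com := .call {digit 0 1, digit 1 2}
def underflow : Com := .call {digit 0 2}
def overflow : Com := .call {digit 2 0}

/-- Removes the red root. -/
def finish : Com := .call {r | ∃ x : Fin 3, r = mkRule
  [rt 0 (num x.val .red)] [] [nd 0 (num x.val)] [] (by simp) (by simp)}

/-- Tests whether there is a red root. -/
def unfinished : Com := .call {r | ∃ x : Fin 3, r = mkRule
  [rt 0 (num x.val .red)] [] [rt 0 (num x.val .red)] [] (by simp) (by simp)}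

/-- Moves the red root to the next digit, on its left. -/
def cacheNext : Com := .call {r | ∃ x y : Fin 3, r = mkRule
  [rt 0 (num x.val .red), nd 1 (num y.val)] [eLeft 0 1]
  [nd 0 (num x.val), rt 1 (num y.val .red)] [eLeft 0 1]
  (by simp [rt, nd, eLeft]) (by simp [rt, nd, eLeft])}

/-- Moves the red root to the previous digit, on its right. -/
def cachePrev : Com := .call {r | ∃ x y : Fin 3, r = mkRule
  [rt 0 (num x.val .red), nd 1 (num y.val)] [eRight 0 1]
  [nd 0 (num x.val), rt 1 (num y.val .red)] [eRight 0 1]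
  (by simp [rt, nd, eRight]) (by simp [rt, nd, eRight])}

def reset : Com := overflow ;; tryElse cachePrev .brk

def decrement : Com :=
  .tte dec (finish ;; .brk) (underflow ;; tryElse cacheNext .brk)

def increment : Com :=
  .tte inc (finish ;; .brk) (overflow ;; tryElse cacheNext .brk)

def cacheDec : Com :=
  cacheInit M ;; .loop decrement ;; ifThen unfinished (.loop reset)

def cacheInc : Com :=
  cacheInit M ;; .loop increment ;; ifThen unfinished (.loop reset ;; finish)

/-! Saving the cache in the block nodes and loading it: a blue root runs through the block nodes. -/

/-- Turns the leftmost block node into a blue root. -/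
def encodeInit : Com := .call {r | ∃ q : M.Q, r = mkRule
  [rt 0 (num q), nd 1 (emp .plain)] [eLeft 0 1]
  [rt 0 (num q), rt 1 (emp .blue)] [eLeft 0 1]
  (by simp [rt, nd, eLeft]) (by simp [rt, eLeft])}

/-- Turns the target of the dashed edge of the active block node into a blue root; the second rule
is for the case that the target is the active block node itself. -/
def decodeInit : Com := .call {r | ∃ q : M.Q,
  r = mkRule
    [rt 0 (num q), nd 1 (emp .plain), nd 2 (emp .plain)] [eDash 0 1, eDash 1 2]
    [rt 0 (num q), nd 1 (emp .plain), rt 2 (emp .blue)] [eDash 0 1, eDash 1 2]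
    (by simp [rt, nd, eDash]) (by simp [rt, nd, eDash]) ∨
  r = mkRule
    [rt 0 (num q), nd 1 (emp .plain)] [eDash 0 1, eDash 1 1]
    [rt 0 (num q), rt 1 (emp .blue)] [eDash 0 1, eDash 1 1]
    (by simp [rt, nd, eDash]) (by simp [rt, eDash])}

/-- Moves the blue root one block node to the right. -/
def nextValue : Com := .call {mkRule
  [rt 0 (emp .blue), nd 1 (emp .plain)] [eRight 0 1]
  [nd 0 (emp .plain), rt 1 (emp .blue)] [eRight 0 1]
  (by simp [rt, nd, eRight]) (by simp [rt, nd, eRight])}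

/-- Moves the blue root one block node to the left. -/
def prevValue : Com := .call {mkRule
  [rt 0 (emp .blue), nd 1 (emp .plain)] [eLeft 0 1]
  [nd 0 (emp .plain), rt 1 (emp .blue)] [eLeft 0 1]
  (by simp [rt, nd, eLeft]) (by simp [rt, nd, eLeft])}

/-- Redirects the dashed edge of the active block node to the blue root, which is removed. The five
rules are for the five possible coincidences among the active block node, the old target,
and the blue root. -/
def update : Com := .call {r | ∃ q : M.Q,
  r = mkRule
    [rt 0 (num q), nd 1 (emp .plain), nd 2 (emp .plain), rt 3 (emp .blue)] [eDash 0 1, eDash 1 2]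
    [rt 0 (num q), nd 1 (emp .plain), nd 2 (emp .plain), nd 3 (emp .plain)] [eDash 0 1, eDash 1 3]
    (by simp [rt, nd, eDash]) (by simp [rt, nd, eDash]) ∨
  r = mkRule
    [rt 0 (num q), nd 1 (emp .plain), rt 3 (emp .blue)] [eDash 0 1, eDash 1 1]
    [rt 0 (num q), nd 1 (emp .plain), nd 3 (emp .plain)] [eDash 0 1, eDash 1 3]
    (by simp [rt, nd, eDash]) (by simp [rt, nd, eDash]) ∨
  r = mkRule
    [rt 0 (num q), nd 1 (emp .plain), rt 2 (emp .blue)] [eDash 0 1, eDash 1 2]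
    [rt 0 (num q), nd 1 (emp .plain), nd 2 (emp .plain)] [eDash 0 1, eDash 1 2]
    (by simp [rt, nd, eDash]) (by simp [rt, nd, eDash]) ∨
  r = mkRule
    [rt 0 (num q), rt 1 (emp .blue), nd 2 (emp .plain)] [eDash 0 1, eDash 1 2]
    [rt 0 (num q), nd 1 (emp .plain), nd 2 (emp .plain)] [eDash 0 1, eDash 1 1]
    (by simp [rt, nd, eDash]) (by simp [rt, nd, eDash]) ∨
  r = mkRule
    [rt 0 (num q), rt 1 (emp .blue)] [eDash 0 1, eDash 1 1]
    [rt 0 (num q), nd 1 (emp .plain)] [eDash 0 1, eDash 1 1]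
    (by simp [rt, eDash]) (by simp [rt, nd, eDash])}

def encoding : Com := cacheDec M ;; tryThen finish .brk ;; tryDo nextValue

def encode : Com := encodeInit M ;; .loop (encoding M) ;; update M

def decoding : Com := tryElse prevValue .brk ;; cacheInc M

def decode : Com := decodeInit M ;; .loop (decoding M) ;; update M

def nextBlock : Com :=
  encode M ;; .tte (next M) (.loop (headLeft M) ;; decode M) (setFlag M)

def prevBlock : Com := encode M ;; prev M ;; .loop (headRight M) ;; decode M

/-! Restarting with a larger tape. -/

/-- Moves the head on the input tape to the leftmost square. -/
def rewindInput : Com := .call {r | ∃ a b : Fin 2, r = mkRule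
  [rt 0 (num M.q₀), nd 1 (num a.val), nd 2 (num b.val)] [eFirst 0 1, eIn 0 2]
  [rt 0 (num M.q₀), nd 1 (num a.val), nd 2 (num b.val)] [eFirst 0 1, eIn 0 1]
  (by simp [rt, nd, eFirst, eIn]) (by simp [rt, nd, eFirst, eIn])}

/-- Makes the leftmost block node the active one. -/
def rewindBlockset : Com := .call {mkRule
  [rt 0 (num M.q₀), nd 1 (emp .plain), nd 2 (emp .plain)] [eLeft 0 1, eDash 0 2]
  [rt 0 (num M.q₀), nd 1 (emp .plain), nd 2 (emp .plain)] [eLeft 0 1, eDash 0 1]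
  (by simp [rt, nd, eLeft, eDash]) (by simp [rt, nd, eLeft, eDash])}

/-- Moves the head one node to the left in the cache. -/
def rewindCache : Com := .call {r | ∃ x y : Fin 3, r = mkRule
  [rt 0 (num M.q₀), nd 1 (num x.val), nd 2 (num y.val)] [eHead 0 1, eLeft 1 2]
  [rt 0 (num M.q₀), nd 1 (num x.val), nd 2 (num y.val)] [eHead 0 2, eLeft 1 2]
  (by simp [rt, nd, eHead, eLeft]) (by simp [rt, nd, eHead, eLeft])}

/-- Writes a blank at the position of the head and makes it a red root. -/
def cInit : Com := .call {r | ∃ x : Fin 3, r = mkRule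
  [rt 0 (num M.q₀), nd 1 (num x.val)] [eHead 0 1]
  [rt 0 (num M.q₀), rt 1 (num 2 .red)] [eHead 0 1]
  (by simp [rt, nd, eHead]) (by simp [rt, eHead])}

/-- Moves the red root to the right and writes a blank there. -/
def erase : Com := .call {r | ∃ x : Fin 3, r = mkRule
  [rt 0 (num 2 .red), nd 1 (num x.val)] [eRight 0 1]
  [nd 0 (num 2), rt 1 (num 2 .red)] [eRight 0 1]
  (by simp [rt, nd, eRight]) (by simp [rt, nd, eRight])}

/-- Appends a blank at the right end of the cache and removes the red root. -/
def endCache : Com := .call {mkRule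
  [rt 0 (num M.q₀), rt 1 (num 2 .red)] [eRight 0 1]
  [rt 0 (num M.q₀), nd 1 (num 2), nd 2 (num 2)] ([eRight 0 2] ++ link 1 2)
  (by simp [rt, eRight]) (by simp [rt, nd, link, eRight, eLeft])}

/-- Turns the leftmost block node into a blue root and creates the leftmost nodes of two copies of
the list of block nodes, as blue roots labelled `1` and `2`; their positions are kept by two
additional edges from the central node. -/
def bInit : Com := .call {mkRule
  [rt 0 (num M.q₀), nd 1 (emp .plain)] [eLeft 0 1]
  [rt 0 (num M.q₀), rt 1 (emp .blue), rt 2 (num 1 .blue), rt 3 (num 2 .blue)]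
  [eLeft 0 1, ⟨0, 2, num 1 .blue⟩, ⟨0, 3, num 2 .blue⟩]
  (by simp [rt, nd, eLeft]) (by simp [rt, eLeft])}

/-- Moves the blue root to the right and appends a node to both copies. -/
def copy : Com := .call {mkRule
  [rt 0 (emp .blue), nd 1 (emp .plain), rt 2 (num 1 .blue), rt 3 (num 2 .blue)] [eRight 0 1]
  [nd 0 (emp .plain), rt 1 (emp .blue), nd 2 (emp .plain), rt 4 (num 1 .blue),
    nd 3 (emp .plain), rt 5 (num 2 .blue)]
  ([eRight 0 1] ++ link 2 4 ++ link 3 5)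
  (by simp [rt, nd, eRight]) (by simp [rt, nd, link, eRight, eLeft])}

/-- Deletes the dashed edge from the blue root; the second rule is for a loop. -/
def undirect : Com := .call {
  mkRule [rt 0 (emp .blue), nd 1 (emp .plain)] [eDash 0 1]
    [rt 0 (emp .blue), nd 1 (emp .plain)] [] (by simp [rt, nd, eDash]) (by simp),
  mkRule [rt 0 (emp .blue)] [eDash 0 0] [rt 0 (emp .blue)] [] (by simp [rt, eDash]) (by simp)}

/-- Appends the copies to the list of block nodes. The rightmost node of the result remains a blue
root labelled `2` and gets a dashed loop, its left neighbour becomes an unmarked root. The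
nodes: `1` is the last one of the original list, `2` and `3` are the first and the last one of
the first copy, `4`, `5` and `6` the first, the penultimate and the last one of the second. -/
def glue : Com := .call {mkRule
  [rt 0 (num M.q₀), rt 1 (emp .blue), nd 2 (emp .plain), rt 3 (num 1 .blue), nd 4 (emp .plain),
    nd 5 (emp .plain), rt 6 (num 2 .blue)]
  [⟨0, 2, num 1 .blue⟩, ⟨0, 4, num 2 .blue⟩, eLeft 6 5]
  [rt 0 (num M.q₀), nd 1 (emp .plain), nd 2 (emp .plain), nd 3 (emp .plain), nd 4 (emp .plain),
    rt 5 (emp .plain), rt 6 (num 2 .blue)]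
  ([eLeft 6 5, eDash 6 6] ++ link 1 2 ++ link 3 4)
  (by simp [rt, nd, eLeft]) (by simp [rt, nd, link, eRight, eLeft, eDash])}

/-- Creates a dashed edge from the unmarked root to the rightmost block node and moves the unmarked
root to the left. -/
def direct : Com := .call {mkRule
  [rt 0 (emp .plain), nd 1 (emp .plain), rt 2 (num 2 .blue)] [eLeft 0 1]
  [nd 0 (emp .plain), rt 1 (emp .plain), rt 2 (num 2 .blue)] [eLeft 0 1, eDash 0 2]
  (by simp [rt, nd, eLeft]) (by simp [rt, nd, eLeft, eDash])}

/-- Creates the dashed loop at the leftmost block node and removes the two roots. -/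
def unroot : Com := .call {mkRule
  [rt 0 (emp .plain), rt 1 (num 2 .blue)] []
  [nd 0 (emp .plain), nd 1 (emp .plain)] [eDash 0 0]
  (by simp) (by simp [nd, eDash])}

def rewindTapes : Com :=
  tryDo (rewindInput M) ;; tryDo (rewindBlockset M) ;; .loop (rewindCache M)

def resetCache : Com := cInit M ;; .loop erase ;; endCache M

def resetBlockset : Com :=
  bInit M ;; tryDo undirect ;; .loop (copy ;; tryDo undirect) ;; glue M ;; .loop direct ;; unroot

def restart : Com := rewindTapes M ;; resetCache M ;; resetBlockset M

def simulate : Com :=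
  transitions M ;; tryDo (moveLeft M) ;; tryDo (moveRight M) ;;
    tryThen (left M) (prevBlock M) ;; tryThen (right M) (nextBlock M) ;;
    tryThen (flag M) (restart M)

/-- The program `Sim(M)`. -/
def sim : Com := setup M ;; .loop (simulate M)

end Sim

/-! ### Configurations as graphs -/

section Enc

/-- Names of the nodes of configuration graphs: the central node, the squares of the input tape, the
block nodes, the nodes of the cache. -/
inductive Node
  | center
  | input (i : ℕ)
  | block (j : ℕ)
  | cache (i : ℕ)
  deriving DecidableEq

/-- The doubly linked list with the nodes `f 0, …, f (n - 1)`. -/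
def chain (f : ℕ → Node) (n : ℕ) : List (Edge Node) :=
  (List.range (n - 1)).flatMap fun i => link (f i) (f (i + 1))

theorem chain_mem {f : ℕ → Node} {n : ℕ} {e : Edge Node} (he : e ∈ chain f n) :
    (∃ i < n, e.src = f i) ∧ ∃ i < n, e.tgt = f i := by
  simp only [chain, List.mem_flatMap, List.mem_range] at he
  obtain ⟨i, hi, he⟩ := he
  simp only [link, eRight, eLeft, List.mem_cons, List.not_mem_nil, or_false] at he
  rcases he with rfl | rfl
  · exact ⟨⟨i, by omega, rfl⟩, i + 1, by omega, rfl⟩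
  · exact ⟨⟨i + 1, by omega, rfl⟩, i, by omega, rfl⟩

variable (M : OfflineTM)

/-- The input graph for the word `w`: the central node, labelled with the initial state, the input
tape, and the two edges from the central node to the leftmost square. -/
def inputGraph (w : List (Fin 2)) (hw : w ≠ []) : Graph Node where
  V := {.center} ∪ (Finset.range w.length).image .input
  P := {.center}
  l
    | .input i => num (w.getD i 0).val
    | _ => num M.q₀
  E := ↑(chain Node.input w.length ++ [eFirst Node.center (Node.input 0), eIn Node.center (Node.input 0)])
  root_mem := by simp
  edge_mem := by
    intro e he
    have hw' := List.length_pos_of_ne_nil hw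
    simp only [Multiset.mem_coe, List.mem_append, List.mem_cons, List.not_mem_nil, or_false] at he
    rcases he with he | rfl | rfl
    · obtain ⟨⟨i, hi, h1⟩, j, hj, h2⟩ := chain_mem he
      simp [h1, h2, hi, hj]
    · simp [eFirst, hw']
    · simp [eIn, hw']

/-- The input graphs of `Sim(M)` for words of length `n` (isomorphic copies are allowed). -/
def inputs (n : ℕ) : Set HostGraph :=
  {G | ∃ (w : List (Fin 2)) (hw : w ≠ []), w.length = n ∧ (inputGraph M w hw).Iso G}

/-- The content of the `j`-th block of `c` squares, as a ternary number. -/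
def content (tape : ℕ → Fin 3) (c j : ℕ) : ℕ :=
  ∑ i ∈ Finset.range c, (tape (j * c + i)).val * 3 ^ (c - 1 - i)

theorem content_lt (tape : ℕ → Fin 3) (c j : ℕ) : content tape c j < 3 ^ c := by
  have key : ∀ (f : ℕ → Fin 3) (c : ℕ), ∑ i ∈ Finset.range c, (f i).val * 3 ^ i < 3 ^ c := by
    intro f c
    induction c with
    | zero => simp
    | succ c ih =>
      rw [Finset.sum_range_succ, pow_succ]
      have h : (f c).val ≤ 2 := by omega
      have := Nat.mul_le_mul_right (3 ^ c) h
      omega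
  have := key (fun i => tape (j * c + (c - 1 - i))) c
  rw [← Finset.sum_range_reflect] at this
  refine lt_of_le_of_lt (Finset.sum_le_sum fun i hi => ?_) this
  have hi := Finset.mem_range.1 hi
  have : c - 1 - (c - 1 - i) = i := by omega
  simp [this]

/-- The configuration `S` on the input `w` can be represented with `3 ^ (k + 2)` blocks of `k + 2`
squares: the head on the working tape is on one of these squares and all others are blank. -/
structure Fits {M : OfflineTM} (w : List (Fin 2)) (k : ℕ) (S : M.Conf) : Prop where
  inPos_lt : S.inPos < w.length
  pos_lt : S.pos < 3 ^ (k + 2) * (k + 2)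
  blank : ∀ i, 3 ^ (k + 2) * (k + 2) ≤ i → S.tape i = 2

/-- The configuration graph `enc_k(S)`. The active block is the one with index
`S.pos / (k + 2)`; its content is in the cache, and its dashed edge points to block `0`. -/
def encGraph {M : OfflineTM} (w : List (Fin 2)) (k : ℕ) (S : M.Conf) (h : Fits w k S) :
    Graph Node where
  V := {.center} ∪ (Finset.range w.length).image .input ∪
    (Finset.range (3 ^ (k + 2))).image .block ∪ (Finset.range (k + 2)).image .cache
  P := {.center}
  l
    | .center => num S.state
    | .input i => num (w.getD i 0).val
    | .block _ => emp .plain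
    | .cache i => num (S.tape (S.pos / (k + 2) * (k + 2) + i)).val
  E := ↑(chain Node.input w.length ++ chain Node.block (3 ^ (k + 2)) ++ chain Node.cache (k + 2) ++
    (List.range (3 ^ (k + 2))).map (fun j => eDash (Node.block j)
      (Node.block (if j = S.pos / (k + 2) then 0 else content S.tape (k + 2) j))) ++
    [eFirst Node.center (Node.input 0), eIn Node.center (Node.input S.inPos),
      eLeft Node.center (Node.block 0), eDash Node.center (Node.block (S.pos / (k + 2))),
      eRight Node.center (Node.cache (k + 1)), eHead Node.center (Node.cache (S.pos % (k + 2)))])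
  root_mem := by simp
  edge_mem := by
    intro e he
    have h0 : 0 < w.length := lt_of_le_of_lt (Nat.zero_le _) h.inPos_lt
    have h1 : S.pos / (k + 2) < 3 ^ (k + 2) := Nat.div_lt_of_lt_mul (by
      rw [mul_comm]; exact h.pos_lt)
    have h2 : S.pos % (k + 2) < k + 2 := Nat.mod_lt _ (by omega)
    have h3 : 0 < 3 ^ (k + 2) := by positivity
    simp only [Multiset.mem_coe, List.mem_append, List.mem_cons, List.not_mem_nil, or_false,
      List.mem_map, List.mem_range] at he
    rcases he with (((he | he) | he) | ⟨j, hj, rfl⟩) | rfl | rfl | rfl | rfl | rfl | rfl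
    · obtain ⟨⟨i, hi, h1⟩, j, hj, h2⟩ := chain_mem he
      simp [h1, h2, hi, hj]
    · obtain ⟨⟨i, hi, h1⟩, j, hj, h2⟩ := chain_mem he
      simp [h1, h2, hi, hj]
    · obtain ⟨⟨i, hi, h1⟩, j, hj, h2⟩ := chain_mem he
      simp [h1, h2, hi, hj]
    · have := content_lt S.tape (k + 2) j
      by_cases hjs : j = S.pos / (k + 2)
      · simp [eDash, ← hjs, hj]
      · simp [eDash, hjs, hj, this]
    · simp [eFirst, h0]
    · simp [eIn, h.inPos_lt]
    · simp [eLeft]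
    · simp [eDash, h1]
    · simp [eRight]
    · simp [eHead, h2]

/-- The host graph `G` is (a copy of) `enc_k(S)`. -/
def Encodes {M : OfflineTM} (w : List (Fin 2)) (k : ℕ) (S : M.Conf) (G : HostGraph) : Prop :=
  ∃ h : Fits w k S, (encGraph w k S h).Iso G

/-- `P!` simulates `M`: for all configurations `S ⇒ S'` of `M` with `S` reachable from the initial
configuration `I`, for some `k`, the loop `P!` leads from `enc_0(I)` to `enc_k(S)`, and then `P`
leads from `enc_k(S)` to `enc_k(S')`. -/
def Simulates (P : Com) : Prop :=
  ∀ (w : List (Fin 2)), w ≠ [] → ∀ (G₀ : HostGraph), Encodes w 0 M.init G₀ →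
    ∀ (m : ℕ) (S S' : M.Conf), M.Reach w m S → M.Trans w S S' →
      ∃ (k : ℕ) (G G' : HostGraph) (a b : ℕ), Encodes w k S G ∧ Encodes w k S' G' ∧
        Derives (.run (.loop P) G₀) a (.run (.loop P) G) ∧ Derives (.run P G) b (.done G')

end Enc

end SGP2

namespace SGP2

/-! ### Total correctness of commands with a bound on the number of rule calls -/

-- The program chooses only matches and names of created nodes, and on the graphs that occur here
-- these choices do not matter: every rule set call has at most one result up to isomorphism. All
-- derivations can therefore be followed at once on a symbolic graph. `Good` expresses termination,
-- a bound on the rule calls and a property of the end; `Ev` specialises it to all copies of a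
-- symbolic graph. `Rep.exists_applies` and `Rep.of_applies` transfer single rule applications
-- between the symbolic graph and its copies, so that each call (`Ev.call`, `Ev.call_fail`) becomes
-- a finite check: the roots and the unique targets of edges force the match. All intermediate
-- graphs are instances of one record `St`.
--
-- The mathematics of the simulation is as follows. The content of a block of `c` squares is a
-- number below `3 ^ c`, and there are exactly `3 ^ c` block nodes, so a dashed edge to a block node
-- can store it. The active block lies in the cache, which is also a ternary counter. To save it,
-- the counter is decreased to zero while a blue root walks to the right from block `0`; to load a
-- block, the root walks back to block `0` while the counter is increased (`ev_loop_encoding`,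
-- `ev_loop_decoding`). Either takes `O(c * 3 ^ c)` calls, a constant times the number of squares
-- represented, and this bounds the cost of one simulated transition (`stepCost`, `ev_simulate`).
--
-- If the head leaves the last square on the right, the graph is enlarged to blocks of `c + 1`
-- squares and three times as many block nodes, and the computation starts again from the initial
-- configuration (`ev_simulate_restart`). Determinism of the machine makes it repeat the same run.
-- If the machine halts, the body of the main loop fails and is undone, so that the graph of the
-- halting configuration is the final one (`ev_simulate_fail`).
--
-- For the simulation statement, a configuration and its successor must be represented with the same
-- `k`. If the successor does not fit, the loop is followed through the restart until the
-- configuration is reached again with `k + 1` (`exists_derives_fits`, `exists_derives_restart`).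
--
-- For the time, let `m` be the number of transitions and `K` the least size parameter for which the
-- whole run fits. There are `K + 1` phases of at most `m + 1` rounds each, and the cost of a round
-- is at most a constant times the size of its phase. The sizes grow at least by the factor three,
-- so their sum is dominated by the last one (`sum_stepCost_le`). The last but one size was exceeded
-- by the head, which moves at most one square per transition, so the last size is `O(max 1 m)`
-- (`size_le`). The product is quadratic (`exists_ev_loop`).

theorem Derives.single {γ δ : Config} {n : ℕ} (h : Step γ n δ) : Derives γ n δ := by
  simpa using Derives.head h (Derives.refl δ)

theorem Derives.trans {γ δ ε : Config} {m n : ℕ} (h : Derives γ m δ) (h' : Derives δ n ε) :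
    Derives γ (m + n) ε := by
  revert h'
  -- `Step` and `Derives` are mutually inductive; the induction on the first derivation uses their
  -- joint recursor with a trivial motive for `Step`.
  refine Derives.rec (motive_1 := fun _ _ _ _ => True)
    (motive_2 := fun γ m δ _ => Derives δ n ε → Derives γ (m + n) ε)
    ?_ ?_ ?_ ?_ ?_ ?_ ?_ ?_ ?_ ?_ ?_ ?_ ?_ ?_ ?_ h
  all_goals try (intros; trivial)
  · intro γ h
    simpa using h
  · intro γ δ ε' m k h1 _ _ ih h
    rw [add_assoc]
    exact .head h1 (ih h)

/-- Every derivation from `γ` is finite, makes at most `n` rule calls, and ends in a configuration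
with the property `Q`. -/
inductive Good (Q : Config → Prop) : ℕ → Config → Prop
  | halt {n : ℕ} {γ : Config} : Terminal γ → Q γ → Good Q n γ
  | step {n : ℕ} {γ : Config} : (∃ m δ, Step γ m δ) → (∀ m δ, Step γ m δ → m ≤ n) →
      (∀ m δ, Step γ m δ → Good Q (n - m) δ) → Good Q n γ

theorem terminal_done (G : HostGraph) : Terminal (.done G) := by
  rintro ⟨n, δ, h⟩; cases h

theorem terminal_fail : Terminal .fail := by
  rintro ⟨n, δ, h⟩; cases h

theorem terminal_brk (G : HostGraph) : Terminal (.run .brk G) := by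
  rintro ⟨n, δ, h⟩; cases h

-- Composition of commands with bounds on rule calls

namespace Good

variable {Q : Config → Prop} {n m : ℕ} {γ δ : Config}

theorem mono (h : Good Q n γ) (hn : n ≤ m) : Good Q m γ := by
  induction h generalizing m with
  | halt h1 h2 => exact .halt h1 h2
  | step h1 h2 _ ih =>
    exact .step h1 (fun k δ hs => (h2 k δ hs).trans hn) fun k δ hs => ih k δ hs (by omega)

theorem of_terminal (h : Good Q n γ) (ht : Terminal γ) : Q γ := by
  cases h with
  | halt _ h => exact h
  | step h _ _ => exact absurd h ht

/-- The calls already spent are subtracted from the bound. Through this lemma the `Derives` premises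
of branching commands and loops inherit bound and final property. -/
theorem derives (h : Good Q n γ) (hd : Derives γ m δ) : m ≤ n ∧ Good Q (n - m) δ := by
  induction h generalizing m with
  | halt h1 h2 =>
    cases hd with
    | refl => exact ⟨Nat.zero_le _, .halt h1 h2⟩
    | head hs _ => exact absurd ⟨_, _, hs⟩ h1
  | step h1 h2 h3 ih =>
    cases hd with
    | refl => exact ⟨Nat.zero_le _, .step h1 h2 h3⟩
    | @head _ _ _ a b hs hd =>
      have := h2 _ _ hs
      obtain ⟨h5, h6⟩ := ih _ _ hs hd
      refine ⟨by omega, ?_⟩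
      rwa [Nat.sub_add_eq]

theorem derives_terminal (h : Good Q n γ) (hd : Derives γ m δ) (ht : Terminal δ) :
    m ≤ n ∧ Q δ :=
  ⟨(h.derives hd).1, (h.derives hd).2.of_terminal ht⟩

/-- Following any steps must end, which yields a terminal configuration. It supplies the premise
that a branching command or a loop needs in order to have a step at all. -/
theorem exists_derives (h : Good Q n γ) : ∃ m δ, Derives γ m δ ∧ Terminal δ ∧ Q δ := by
  induction h with
  | @halt n γ h1 h2 => exact ⟨0, γ, .refl _, h1, h2⟩
  | step h1 _ _ ih =>
    obtain ⟨m, δ, hs⟩ := h1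
    obtain ⟨k, ε, h4, h5⟩ := ih m δ hs
    exact ⟨m + k, ε, .head hs h4, h5⟩

theorem not_infinite (h : Good Q n γ) :
    ¬ ∃ c : ℕ → Config, c 0 = γ ∧ ∀ i, ∃ m, Step (c i) m (c (i + 1)) := by
  induction h with
  | halt h1 _ =>
    rintro ⟨c, rfl, hc⟩
    obtain ⟨m, hm⟩ := hc 0
    exact h1 ⟨_, _, hm⟩
  | step _ _ _ ih =>
    rintro ⟨c, rfl, hc⟩
    obtain ⟨m, hm⟩ := hc 0
    exact ih m _ hm ⟨fun i => c (i + 1), rfl, fun i => hc (i + 1)⟩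

/-- By `hrun`, a first command that stops without being done or failing has stopped at `.brk`, and
then the sequence has the free step that discards its remainder. Any other stuck command would make
the whole sequence stuck. -/
theorem seq {Q' : Config → Prop} {P R : Com} {G : HostGraph}
    (h : Good Q n (.run P G)) (hdone : ∀ H, Q (.done H) → Good Q' m (.run R H))
    (hfail : Q .fail → Q' .fail) (hbrk : ∀ H, Q (.run .brk H) → Q' (.run .brk H))
    (hrun : ∀ P' H, Q (.run P' H) → P' = .brk) : Good Q' (n + m) (.run (.seq P R) G) := by
  generalize hγ : Config.run P G = γ at h
  induction h generalizing P G with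
  | @halt n γ h1 h2 =>
    subst hγ
    obtain rfl := hrun _ _ h2
    refine .step ⟨_, _, .brk⟩ ?_ ?_
    · intro k δ hs
      cases hs with
      | seq₁ h => exact absurd ⟨_, _, h⟩ h1
      | seq₂ h => exact absurd ⟨_, _, h⟩ h1
      | seq₃ h => exact absurd ⟨_, _, h⟩ h1
      | brk => omega
    · intro k δ hs
      cases hs with
      | seq₁ h => exact absurd ⟨_, _, h⟩ h1
      | seq₂ h => exact absurd ⟨_, _, h⟩ h1
      | seq₃ h => exact absurd ⟨_, _, h⟩ h1
      | brk => exact .halt (terminal_brk _) (hbrk _ h2)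
  | @step n γ h1 h2 h3 ih =>
    subst hγ
    refine .step ?_ ?_ ?_
    · obtain ⟨k, δ, hs⟩ := h1
      cases δ with
      | run P' H => exact ⟨_, _, .seq₁ hs⟩
      | done H => exact ⟨_, _, .seq₂ hs⟩
      | fail => exact ⟨_, _, .seq₃ hs⟩
    · intro k δ hs
      cases hs with
      | seq₁ h => have := h2 _ _ h; omega
      | seq₂ h => have := h2 _ _ h; omega
      | seq₃ h => have := h2 _ _ h; omega
      | brk => omega
    · intro k δ hs
      cases hs with
      | seq₁ h =>
        have := h2 _ _ h
        exact (ih _ _ h rfl).mono (by omega)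
      | seq₂ h =>
        have := h2 _ _ h
        exact (hdone _ ((h3 _ _ h).of_terminal (terminal_done _))).mono (by omega)
      | seq₃ h => exact .halt terminal_fail (hfail ((h3 _ _ h).of_terminal terminal_fail))
      | brk =>
        obtain ⟨k, δ, hs⟩ := h1
        exact absurd ⟨k, δ, hs⟩ (terminal_brk _)

/-- The complete evaluation of the condition is the cost of a single step. A condition that is
stuck, also at `.brk`, would leave no step, and is excluded by `hrun`. -/
theorem tte {Q' : Config → Prop} {C P R : Com} {G : HostGraph}
    (h : Good Q n (.run C G)) (hdone : ∀ H, Q (.done H) → Good Q' m (.run P H))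
    (hfail : Q .fail → Good Q' m (.run R G)) (hrun : ∀ P' H, ¬ Q (.run P' H)) :
    Good Q' (n + m) (.run (.tte C P R) G) := by
  refine .step ?_ ?_ ?_
  · obtain ⟨k, δ, hd, -, hQ⟩ := h.exists_derives
    cases δ with
    | run P' H => exact absurd hQ (hrun _ _)
    | done H => exact ⟨_, _, .try₁ hd⟩
    | fail => exact ⟨_, _, .try₂ hd⟩
  · intro k δ hs
    cases hs with
    | try₁ hd => have := (h.derives hd).1; omega
    | try₂ hd => have := (h.derives hd).1; omega
  · intro k δ hs
    cases hs with
    | try₁ hd =>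
      have := h.derives_terminal hd (terminal_done _)
      exact (hdone _ this.2).mono (by omega)
    | try₂ hd =>
      have := h.derives_terminal hd terminal_fail
      exact (hfail this.2).mono (by omega)

theorem ite {Q' : Config → Prop} {C P R : Com} {G : HostGraph}
    (h : Good Q n (.run C G)) (hdone : ∀ H, Q (.done H) → Good Q' m (.run P G))
    (hfail : Q .fail → Good Q' m (.run R G)) (hrun : ∀ P' H, ¬ Q (.run P' H)) :
    Good Q' (n + m) (.run (.ite C P R) G) := by
  refine .step ?_ ?_ ?_
  · obtain ⟨k, δ, hd, -, hQ⟩ := h.exists_derives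
    cases δ with
    | run P' H => exact absurd hQ (hrun _ _)
    | done H => exact ⟨_, _, .if₁ hd⟩
    | fail => exact ⟨_, _, .if₂ hd⟩
  · intro k δ hs
    cases hs with
    | if₁ hd => have := (h.derives hd).1; omega
    | if₂ hd => have := (h.derives hd).1; omega
  · intro k δ hs
    cases hs with
    | if₁ hd =>
      have := h.derives_terminal hd (terminal_done _)
      exact (hdone _ this.2).mono (by omega)
    | if₂ hd =>
      have := h.derives_terminal hd terminal_fail
      exact (hfail this.2).mono (by omega)

/-- One evaluation of the body has three admissible outcomes: success repeats the loop on the new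
graph, failure ends it on the old graph, and a break ends it on the new one. -/
theorem loop {Q' : Config → Prop} {P : Com} {G : HostGraph}
    (h : Good Q n (.run P G)) (hdone : ∀ H, Q (.done H) → Good Q' m (.run (.loop P) H))
    (hfail : Q .fail → Q' (.done G)) (hbrk : ∀ H, Q (.run .brk H) → Q' (.done H))
    (hrun : ∀ P' H, Q (.run P' H) → P' = .brk) : Good Q' (n + m) (.run (.loop P) G) := by
  refine .step ?_ ?_ ?_
  · obtain ⟨k, δ, hd, -, hQ⟩ := h.exists_derives
    cases δ with
    | run P' H =>
      obtain rfl := hrun _ _ hQ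
      exact ⟨_, _, .alap₃ hd⟩
    | done H => exact ⟨_, _, .alap₁ hd⟩
    | fail => exact ⟨_, _, .alap₂ hd⟩
  · intro k δ hs
    cases hs with
    | alap₁ hd => have := (h.derives hd).1; omega
    | alap₂ hd => have := (h.derives hd).1; omega
    | alap₃ hd => have := (h.derives hd).1; omega
  · intro k δ hs
    cases hs with
    | alap₁ hd =>
      have := h.derives_terminal hd (terminal_done _)
      exact (hdone _ this.2).mono (by omega)
    | alap₂ hd => exact .halt (terminal_done _) (hfail (h.derives_terminal hd terminal_fail).2)
    | alap₃ hd =>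
      exact .halt (terminal_done _) (hbrk _ (h.derives_terminal hd (terminal_brk _)).2)

end Good

/-! ### Rule application up to isomorphism -/

/-- Graphs with nodes named by elements of `N`, without the well-formedness conditions. -/
structure AGraph (N : Type) where
  V : Finset N
  P : Finset N
  l : N → Label
  E : Multiset (Edge N)

namespace AGraph

variable {N : Type}

structure WF (A : AGraph N) : Prop where
  root_mem : ∀ v ∈ A.P, v ∈ A.V
  edge_mem : ∀ e ∈ A.E, e.src ∈ A.V ∧ e.tgt ∈ A.V

/-- The host graph `G` is a copy of `A`. -/
def Rep (A : AGraph N) (G : HostGraph) : Prop :=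
  A.WF ∧ ∃ f : N → ℕ, Set.InjOn f ↑A.V ∧ f '' ↑A.V = ↑G.V ∧ (∀ v ∈ A.V, (f v ∈ G.P ↔ v ∈ A.P)) ∧
    (∀ v ∈ A.V, G.l (f v) = A.l v) ∧ A.E.map (Edge.map f) = G.E

/-- `A` and `B` differ at most in the labels of names that are not nodes. -/
structure Same (A B : AGraph N) : Prop where
  V_eq : A.V = B.V
  P_eq : A.P = B.P
  l_eq : ∀ v ∈ A.V, A.l v = B.l v
  E_eq : A.E = B.E

theorem Rep.congr {A B : AGraph N} {G : HostGraph} (h : A.Rep G) (hs : A.Same B) : B.Rep G := by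
  obtain ⟨⟨h1, h2⟩, f, h3, h4, h5, h6, h7⟩ := h
  obtain ⟨e1, e2, e3, e4⟩ := hs
  have h6' : ∀ v ∈ A.V, G.l (f v) = B.l v := fun v hv => by rw [h6 v hv, e3 v hv]
  rw [e1, e2] at h1
  rw [e1, e4] at h2
  rw [e1, e2] at h5
  rw [e1] at h3 h4 h6'
  rw [e4] at h7
  exact ⟨⟨h1, h2⟩, f, h3, h4, h5, h6', h7⟩

/-- `g` is a match of the rule `r` in `A`. -/
def Match (r : Rule) (A : AGraph N) (g : ℕ → N) : Prop :=
  Set.InjOn g ↑r.L.V ∧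
    (∀ v ∈ r.L.V, g v ∈ A.V ∧ A.l (g v) = r.L.l v ∧ (g v ∈ A.P ↔ v ∈ r.L.P)) ∧
    r.L.E.map (Edge.map g) ≤ A.E

/-- `B` is the result of applying the rule `r`, which does not delete nodes, with the match `g`;
the created nodes get the names given by `h`. -/
def Result [DecidableEq N] (r : Rule) (A : AGraph N) (g h : ℕ → N) (B : AGraph N) : Prop :=
  (∀ v ∈ r.L.V, h v = g v) ∧
    Set.InjOn h ↑(r.R.V \ r.L.V) ∧ (∀ v ∈ r.R.V \ r.L.V, h v ∉ A.V) ∧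
    B.V = A.V ∪ (r.R.V \ r.L.V).image h ∧
    B.E + r.L.E.map (Edge.map g) = A.E + r.R.E.map (Edge.map h) ∧
    (∀ v, (∀ u ∈ r.R.V, h u ≠ v) → (v ∈ A.V → B.l v = A.l v) ∧ (v ∈ B.P ↔ v ∈ A.P)) ∧
    ∀ v ∈ r.R.V, B.l (h v) = r.R.l v ∧ (h v ∈ B.P ↔ v ∈ r.R.P)

/-- Since `r.K = r.L.V`, no node is deleted and the dangling condition is vacuous. A match in the
model followed by the isomorphism is a match in the copy. -/
theorem Rep.exists_applies {A : AGraph N} {G : HostGraph} (hA : A.Rep G) {r : Rule} {g : ℕ → N}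
    (hK : r.K = r.L.V) (hg : Match r A g) : ∃ H, r.Applies G H := by
  obtain ⟨hwf, f, hf, himg, hP, hl, hE⟩ := hA
  obtain ⟨hinj, hv, hle⟩ := hg
  obtain ⟨D, hD⟩ := Multiset.le_iff_exists_add.1 hle
  have hLR : r.L.V ⊆ r.R.V := hK ▸ r.K_sub_R
  have hmem : ∀ v ∈ A.V, f v ∈ G.V := fun v hv' => by
    have : f v ∈ (G.V : Set ℕ) := himg ▸ ⟨v, hv', rfl⟩
    exact this
  obtain ⟨N₀, hN₀⟩ : ∃ N₀, ∀ x ∈ G.V, x < N₀ :=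
    ⟨G.V.sup id + 1, fun x hx => Nat.lt_succ_of_le (Finset.le_sup (f := id) hx)⟩
  -- Shifting by a strict upper bound of the names in `G` makes the created names fresh and pairwise
  -- distinct.
  let h : ℕ → ℕ := fun v => if v ∈ r.L.V then f (g v) else N₀ + v
  have hL : ∀ v ∈ r.L.V, h v = f (g v) := fun v hv' => by simp [h, hv']
  have hN : ∀ v ∉ r.L.V, h v = N₀ + v := fun v hv' => by simp [h, hv']
  have hinj' : Set.InjOn h Set.univ := by
    intro a _ b _ hab
    by_cases ha : a ∈ r.L.V <;> by_cases hb : b ∈ r.L.V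
    · rw [hL a ha, hL b hb] at hab
      exact hinj ha hb (hf (hv a ha).1 (hv b hb).1 hab)
    · rw [hL a ha, hN b hb] at hab
      have := hN₀ _ (hmem _ (hv a ha).1); omega
    · rw [hN a ha, hL b hb] at hab
      have := hN₀ _ (hmem _ (hv b hb).1); omega
    · rw [hN a ha, hN b hb] at hab
      omega
  classical
  let H : HostGraph :=
    { V := G.V ∪ (r.R.V \ r.L.V).image h
      P := (G.P \ r.L.V.image (f ∘ g)) ∪ r.R.P.image h
      l := fun x => if hx : ∃ v ∈ r.R.V, h v = x then r.R.l hx.choose else G.l x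
      E := D.map (Edge.map f) + r.R.E.map (Edge.map h)
      root_mem := by
        intro v hv'
        rcases Finset.mem_union.1 hv' with hv' | hv'
        · exact Finset.mem_union_left _ (G.root_mem _ (Finset.mem_sdiff.1 hv').1)
        · obtain ⟨u, hu, rfl⟩ := Finset.mem_image.1 hv'
          by_cases huL : u ∈ r.L.V
          · rw [hL u huL]
            exact Finset.mem_union_left _ (hmem _ (hv u huL).1)
          · exact Finset.mem_union_right _ (Finset.mem_image_of_mem _
              (Finset.mem_sdiff.2 ⟨r.R.root_mem _ hu, huL⟩))
      edge_mem := by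
        have key : ∀ u ∈ r.R.V, h u ∈ G.V ∪ (r.R.V \ r.L.V).image h := by
          intro u hu
          by_cases huL : u ∈ r.L.V
          · rw [hL u huL]
            exact Finset.mem_union_left _ (hmem _ (hv u huL).1)
          · exact Finset.mem_union_right _ (Finset.mem_image_of_mem _
              (Finset.mem_sdiff.2 ⟨hu, huL⟩))
        intro e he
        rcases Multiset.mem_add.1 he with he | he
        · obtain ⟨e', he', rfl⟩ := Multiset.mem_map.1 he
          have := hwf.edge_mem e' (by rw [hD]; exact Multiset.mem_add.2 (.inr he'))
          exact ⟨Finset.mem_union_left _ (hmem _ this.1), Finset.mem_union_left _ (hmem _ this.2)⟩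
        · obtain ⟨e', he', rfl⟩ := Multiset.mem_map.1 he
          have := r.R.edge_mem e' he'
          exact ⟨key _ this.1, key _ this.2⟩ }
  have hHl : ∀ v ∈ r.R.V, H.l (h v) = r.R.l v := by
    intro v hv'
    have hx : ∃ u ∈ r.R.V, h u = h v := ⟨v, hv', rfl⟩
    have : H.l (h v) = r.R.l hx.choose := dif_pos hx
    rw [this, hinj' trivial trivial hx.choose_spec.2]
  refine ⟨H, f ∘ g, h, D.map (Edge.map f), ?_, ?_, ?_, ?_, ?_, ?_, ?_, ?_, ?_, ?_, hHl, rfl⟩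
  · intro a ha b hb hab
    exact hinj ha hb (hf (hv a ha).1 (hv b hb).1 hab)
  · intro v hv'
    obtain ⟨h1, h2, h3⟩ := hv v hv'
    exact ⟨hmem _ h1, (hl _ h1).trans h2, (hP _ h1).trans h3⟩
  · rw [← hE, hD, Multiset.map_add, Multiset.map_map]
    rfl
  · simp [hK]
  · intro v hv'
    exact hL v (hK ▸ hv')
  · exact hinj'.mono (Set.subset_univ _)
  · intro v hv' hG
    rw [hK] at hv'
    rw [hN v (Finset.mem_sdiff.1 hv').2] at hG
    have := hN₀ _ (Finset.mem_sdiff.1 hG).1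
    omega
  · simp [H, hK]
  · rfl
  · intro v hv'
    obtain ⟨h1, h2⟩ := Finset.mem_sdiff.1 hv'
    refine dif_neg ?_
    rintro ⟨u, hu, rfl⟩
    by_cases huL : u ∈ r.L.V
    · exact h2 (Finset.mem_image.2 ⟨u, huL, (hL u huL).symm⟩)
    · rw [hN u huL] at h1
      have := hN₀ _ h1
      omega

/-- The match is pulled back along the inverse `fi` of the isomorphism. The new isomorphism is the
old one on `A.V` and sends the names given by `h` to those chosen in the application. Hence one
model result covers all choices of fresh names. -/
theorem Rep.of_applies [DecidableEq N] [Nonempty N] {A : AGraph N} {G H : HostGraph} (hA : A.Rep G) {r : Rule}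
    (hK : r.K = r.L.V) (hr : r.Applies G H) :
    ∃ g, Match r A g ∧ ∀ h B, Result r A g h B → B.Rep H := by
  obtain ⟨hwf, f, hf, himg, hP, hl, hE⟩ := hA
  obtain ⟨g₀, h₀, D₀, a1, a2, a3, -, a5, a6, a7, a8, a9, a10, a11, a12⟩ := hr
  rw [hK] at a5 a6 a7 a8
  simp only [Finset.sdiff_self, Finset.image_empty, Finset.sdiff_empty] at a7 a8
  have hLR : r.L.V ⊆ r.R.V := hK ▸ r.K_sub_R
  have hmem : ∀ v, v ∈ A.V → f v ∈ G.V := fun v hv' => by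
    have : f v ∈ (G.V : Set ℕ) := himg ▸ ⟨v, hv', rfl⟩
    exact this
  let fi : ℕ → N := Function.invFunOn f ↑A.V
  have hfi : ∀ x ∈ G.V, fi x ∈ A.V ∧ f (fi x) = x := by
    intro x hx
    have hx' : x ∈ f '' ↑A.V := by rw [himg]; exact hx
    exact ⟨Function.invFunOn_mem hx', Function.invFunOn_eq hx'⟩
  have hif : ∀ v ∈ A.V, fi (f v) = v := by
    intro v hv
    exact hf (hfi _ (hmem v hv)).1 hv (hfi _ (hmem v hv)).2
  have hD₀ : ∀ e ∈ D₀, e.src ∈ G.V ∧ e.tgt ∈ G.V := fun e he =>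
    G.edge_mem e (by rw [a3]; exact Multiset.mem_add.2 (.inr he))
  have hAE : A.E = r.L.E.map (Edge.map (fi ∘ g₀)) + D₀.map (Edge.map fi) := by
    have h1 : G.E.map (Edge.map fi) = A.E := by
      rw [← hE, Multiset.map_map]
      conv_rhs => rw [← Multiset.map_id A.E]
      refine Multiset.map_congr rfl fun e he => ?_
      have := hwf.edge_mem e he
      simp only [Function.comp, Edge.map, hif _ this.1, hif _ this.2, id]
    rw [← h1, a3, Multiset.map_add, Multiset.map_map]
    rfl
  refine ⟨fi ∘ g₀, ⟨?_, ?_, ?_⟩, ?_⟩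
  · intro a ha b hb hab
    apply a1 ha hb
    rw [← (hfi _ (a2 a ha).1).2, ← (hfi _ (a2 b hb).1).2]
    exact congrArg f hab
  · intro v hv
    obtain ⟨h1, h2, h3⟩ := a2 v hv
    obtain ⟨h4, h5⟩ := hfi _ h1
    refine ⟨h4, ?_, ?_⟩
    · rw [← h2, Function.comp, ← hl _ h4, h5]
    · rw [← h3, Function.comp, ← hP _ h4, h5]
  · rw [hAE]
    exact Multiset.le_add_right _ _
  rintro h B ⟨b1, b2, b3, b4, b5, b6, b7⟩
  -- The matched edges are cancelled from the additive equation in `Result`, so no subtraction of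
  -- multisets is needed.
  have hBE : B.E = D₀.map (Edge.map fi) + r.R.E.map (Edge.map h) := by
    rw [hAE, add_assoc, add_comm (Multiset.map _ r.L.E)] at b5
    exact add_right_cancel b5
  have hA_of : ∀ v ∈ r.L.V, h v ∈ A.V := fun v hv => by
    rw [b1 v hv]; exact (hfi _ (a2 v hv).1).1
  have hBV : ∀ v ∈ r.R.V, h v ∈ B.V := by
    intro v hv
    rw [b4]
    by_cases hvL : v ∈ r.L.V
    · exact Finset.mem_union_left _ (hA_of v hvL)
    · exact Finset.mem_union_right _ (Finset.mem_image_of_mem _ (Finset.mem_sdiff.2 ⟨hv, hvL⟩))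
  classical
  let f' : N → ℕ := fun x => if x ∈ A.V then f x else h₀ (Function.invFunOn h ↑(r.R.V \ r.L.V) x)
  have hf'A : ∀ x ∈ A.V, f' x = f x := fun x hx => by simp [f', hx]
  have hf'h : ∀ v ∈ r.R.V, f' (h v) = h₀ v := by
    intro v hv
    by_cases hvL : v ∈ r.L.V
    · rw [hf'A _ (hA_of v hvL), b1 v hvL, a5 v hvL]
      exact (hfi _ (a2 v hvL).1).2
    · have hv' : v ∈ (↑(r.R.V \ r.L.V) : Set ℕ) := Finset.mem_sdiff.2 ⟨hv, hvL⟩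
      have h1 := b3 v hv'
      have h2 : h v ∈ h '' ↑(r.R.V \ r.L.V) := ⟨v, hv', rfl⟩
      have h3 := b2 (Function.invFunOn_mem h2) hv' (Function.invFunOn_eq h2)
      simp only [f', h1, if_false]
      rw [h3]
  have hBcases : ∀ x ∈ B.V, x ∈ A.V ∨ ∃ v ∈ r.R.V \ r.L.V, h v = x := by
    intro x hx
    rw [b4] at hx
    rcases Finset.mem_union.1 hx with hx | hx
    · exact .inl hx
    · exact .inr (Finset.mem_image.1 hx)
  have hA_not : ∀ x ∈ B.V, (∀ u ∈ r.R.V, h u ≠ x) → x ∈ A.V := by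
    intro x hx hxR
    rcases hBcases x hx with hx | ⟨u, hu, rfl⟩
    · exact hx
    · exact absurd rfl (hxR u (Finset.mem_sdiff.1 hu).1)
  -- Created names are fresh for `G`; a right-hand node found in `G` must come from the interface.
  have hh₀G : ∀ u ∈ r.R.V, h₀ u ∈ G.V → u ∈ r.L.V := by
    intro u hu huG
    by_contra huL
    exact a7 u (Finset.mem_sdiff.2 ⟨hu, huL⟩) huG
  have hfx : ∀ x ∈ A.V, (∀ u ∈ r.R.V, h u ≠ x) → ∀ u ∈ r.R.V, h₀ u ≠ f x := by
    intro x hx hxR u hu hux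
    have huL := hh₀G u hu (hux ▸ hmem x hx)
    apply hxR u hu
    rw [b1 u huL]
    rw [a5 u huL] at hux
    simp only [Function.comp, hux, hif x hx]
  have hh₀ : ∀ u ∈ r.R.V, ∀ v ∈ r.R.V, h₀ u = h₀ v → u = v := by
    intro u hu v hv huv
    by_cases huL : u ∈ r.L.V
    · have hvL := hh₀G v hv (by rw [← huv, a5 u huL]; exact (a2 u huL).1)
      rw [a5 u huL, a5 v hvL] at huv
      exact a1 huL hvL huv
    · have hvL : v ∉ r.L.V := fun hvL =>
        huL (hh₀G u hu (by rw [huv, a5 v hvL]; exact (a2 v hvL).1))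
      exact a6 (Finset.mem_sdiff.2 ⟨hu, huL⟩) (Finset.mem_sdiff.2 ⟨hv, hvL⟩) huv
  have hroot : ∀ u ∈ r.R.V, (h₀ u ∈ H.P ↔ u ∈ r.R.P) := by
    intro u hu
    rw [a12, Finset.mem_union, Finset.mem_sdiff]
    constructor
    · rintro (⟨h1, h2⟩ | h1)
      · have huL := hh₀G u hu (G.root_mem _ h1)
        exact absurd (Finset.mem_image.2 ⟨u, huL, (a5 u huL).symm⟩) h2
      · obtain ⟨v, hv, hvu⟩ := Finset.mem_image.1 h1
        exact hh₀ v (r.R.root_mem v hv) u hu hvu ▸ hv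
    · exact fun h1 => .inr (Finset.mem_image_of_mem _ h1)
  refine ⟨⟨?_, ?_⟩, f', ?_, ?_, ?_, ?_, ?_⟩
  · intro v hv
    by_cases hvR : ∃ u ∈ r.R.V, h u = v
    · obtain ⟨u, hu, rfl⟩ := hvR
      exact hBV u hu
    · push Not at hvR
      rw [b4]
      exact Finset.mem_union_left _ (hwf.root_mem _ (((b6 v hvR).2).1 hv))
  · intro e he
    rw [hBE] at he
    rcases Multiset.mem_add.1 he with he | he
    · obtain ⟨e', he', rfl⟩ := Multiset.mem_map.1 he
      rw [b4]
      exact ⟨Finset.mem_union_left _ (hfi _ (hD₀ e' he').1).1,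
        Finset.mem_union_left _ (hfi _ (hD₀ e' he').2).1⟩
    · obtain ⟨e', he', rfl⟩ := Multiset.mem_map.1 he
      exact ⟨hBV _ (r.R.edge_mem e' he').1, hBV _ (r.R.edge_mem e' he').2⟩
  · intro x hx y hy hxy
    rcases hBcases x hx with hx | ⟨u, hu, rfl⟩ <;> rcases hBcases y hy with hy | ⟨v, hv, rfl⟩
    · rw [hf'A x hx, hf'A y hy] at hxy
      exact hf hx hy hxy
    · rw [hf'A x hx, hf'h v (Finset.mem_sdiff.1 hv).1] at hxy
      exact absurd (hxy ▸ hmem x hx) (a7 v hv)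
    · rw [hf'A y hy, hf'h u (Finset.mem_sdiff.1 hu).1] at hxy
      exact absurd (hxy ▸ hmem y hy) (a7 u hu)
    · rw [hf'h u (Finset.mem_sdiff.1 hu).1, hf'h v (Finset.mem_sdiff.1 hv).1] at hxy
      rw [a6 hu hv hxy]
  · ext x
    rw [a8]
    simp only [Set.mem_image, Finset.mem_coe, Finset.mem_union, Finset.mem_image]
    constructor
    · rintro ⟨y, hy, rfl⟩
      rcases hBcases y hy with hy | ⟨u, hu, rfl⟩
      · exact .inl (by rw [hf'A y hy]; exact hmem y hy)
      · exact .inr ⟨u, hu, (hf'h u (Finset.mem_sdiff.1 hu).1).symm⟩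
    · rintro (hx | ⟨u, hu, rfl⟩)
      · obtain ⟨h1, h2⟩ := hfi x hx
        exact ⟨fi x, by rw [b4]; exact Finset.mem_union_left _ h1, by rw [hf'A _ h1, h2]⟩
      · have := (Finset.mem_sdiff.1 hu).1
        exact ⟨h u, hBV u this, hf'h u this⟩
  · intro x hx
    by_cases hxR : ∃ u ∈ r.R.V, h u = x
    · obtain ⟨u, hu, rfl⟩ := hxR
      rw [hf'h u hu, (b7 u hu).2, hroot u hu]
    · push Not at hxR
      have hxA := hA_not x hx hxR
      rw [(b6 x hxR).2, hf'A x hxA, ← hP x hxA, a12, Finset.mem_union, Finset.mem_sdiff]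
      have h1 : f x ∉ r.L.V.image g₀ := fun h1 => by
        obtain ⟨u, hu, hux⟩ := Finset.mem_image.1 h1
        exact hfx x hxA hxR u (hLR hu) (by rw [a5 u hu, hux])
      have h2 : f x ∉ r.R.P.image h₀ := fun h2 => by
        obtain ⟨u, hu, hux⟩ := Finset.mem_image.1 h2
        exact hfx x hxA hxR u (r.R.root_mem u hu) hux
      simp [h1, h2]
  · intro x hx
    by_cases hxR : ∃ u ∈ r.R.V, h u = x
    · obtain ⟨u, hu, rfl⟩ := hxR
      rw [hf'h u hu, (b7 u hu).1, a11 u hu]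
    · push Not at hxR
      have hxA := hA_not x hx hxR
      rw [(b6 x hxR).1 hxA, hf'A x hxA, ← hl x hxA, a10]
      refine Finset.mem_sdiff.2 ⟨hmem x hxA, fun h1 => ?_⟩
      obtain ⟨u, hu, hux⟩ := Finset.mem_image.1 h1
      exact hfx x hxA hxR u (hLR hu) (by rw [a5 u hu, hux])
  · rw [hBE, a9, Multiset.map_add, Multiset.map_map, Multiset.map_map]
    congr 1
    · conv_rhs => rw [← Multiset.map_id D₀]
      refine Multiset.map_congr rfl fun e he => ?_
      obtain ⟨h1, h2⟩ := hD₀ e he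
      obtain ⟨h3, h4⟩ := hfi _ h1
      obtain ⟨h5, h6⟩ := hfi _ h2
      simp only [Function.comp, Edge.map, hf'A _ h3, hf'A _ h5, h4, h6, id]
    · refine Multiset.map_congr rfl fun e he => ?_
      obtain ⟨h1, h2⟩ := r.R.edge_mem e he
      simp only [Function.comp, Edge.map, hf'h _ h1, hf'h _ h2]

end AGraph

/-! ### Matches and results for rules given by lists -/

section MkRule

variable {N : Type}

theorem mkGraph_mem_V {ns : List (ℕ × Label × Bool)} {es : List (Edge ℕ)} {h} {v : ℕ} :
    v ∈ (mkGraph ns es h).V ↔ ∃ x ∈ ns, x.1 = v := by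
  simp [mkGraph]

/-- Because the names are distinct, the lookup by name finds the listed entry and no other. -/
theorem mkGraph_spec {ns : List (ℕ × Label × Bool)} {es : List (Edge ℕ)} {h}
    (hnd : (ns.map Prod.fst).Nodup) {x : ℕ × Label × Bool} (hx : x ∈ ns) :
    (mkGraph ns es h).l x.1 = x.2.1 ∧ (x.1 ∈ (mkGraph ns es h).P ↔ x.2.2 = true) := by
  have huniq : ∀ y ∈ ns, y.1 = x.1 → y = x := fun y hy hyx =>
    List.inj_on_of_nodup_map hnd hy hx hyx
  constructor
  · have : ns.find? (fun y => y.1 = x.1) = some x := by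
      cases hf : ns.find? (fun y => y.1 = x.1) with
      | none => exact absurd (List.find?_eq_none.1 hf x hx) (by simp)
      | some y =>
        have h1 := List.find?_some hf
        rw [huniq y (List.mem_of_find?_eq_some hf) (by simpa using h1)]
    simp only [mkGraph, this]
  · simp only [mkGraph, List.mem_toFinset, List.mem_map, List.mem_filter]
    constructor
    · rintro ⟨y, ⟨hy, hy'⟩, hyx⟩
      rwa [← huniq y hy hyx]
    · exact fun h => ⟨x, ⟨hx, h⟩, rfl⟩

variable {ln rn : List (ℕ × Label × Bool)} {le re : List (Edge ℕ)}
  {hl : ∀ e ∈ le, e.src ∈ ln.map Prod.fst ∧ e.tgt ∈ ln.map Prod.fst}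
  {hr : ∀ e ∈ re, e.src ∈ rn.map Prod.fst ∧ e.tgt ∈ rn.map Prod.fst}
  {A B : AGraph N} {g h : ℕ → N}

theorem mkRule_K (hsub : ∀ x ∈ ln, x.1 ∈ rn.map Prod.fst) :
    (mkRule ln le rn re hl hr).K = (mkRule ln le rn re hl hr).L.V := by
  refine Finset.inter_eq_left.2 fun v hv => ?_
  obtain ⟨x, hx, rfl⟩ := mkGraph_mem_V.1 hv
  simpa [mkGraph] using hsub x hx

theorem AGraph.Match.elim (hm : AGraph.Match (mkRule ln le rn re hl hr) A g)
    (hnd : (ln.map Prod.fst).Nodup) :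
    (ln.map fun x => g x.1).Nodup ∧
      (∀ x ∈ ln, g x.1 ∈ A.V ∧ A.l (g x.1) = x.2.1 ∧ (g x.1 ∈ A.P ↔ x.2.2 = true)) ∧
      ∀ e ∈ le, e.map g ∈ A.E := by
  obtain ⟨h1, h2, h3⟩ := hm
  refine ⟨?_, fun x hx => ?_, fun e he => ?_⟩
  · have : (ln.map fun x => g x.1) = (ln.map Prod.fst).map g := by simp
    rw [this]
    refine List.Nodup.map_on (fun a ha b hb hab => ?_) hnd
    exact h1 (by simpa [mkRule, mkGraph] using ha) (by simpa [mkRule, mkGraph] using hb) hab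
  · obtain ⟨h4, h5, h6⟩ := h2 x.1 ((mkGraph_mem_V (h := hl)).2 ⟨x, hx, rfl⟩)
    obtain ⟨h7, h8⟩ := mkGraph_spec (es := le) (h := hl) hnd hx
    exact ⟨h4, h5.trans h7, h6.trans h8⟩
  · exact Multiset.mem_of_le h3 (Multiset.mem_map_of_mem _ he)

/-- The images of the left-hand edges are required to be distinct, for then containment of multisets
reduces to membership of single edges. -/
theorem AGraph.Match.intro (hnd : (ln.map Prod.fst).Nodup) (h1 : (ln.map fun x => g x.1).Nodup)
    (h2 : ∀ x ∈ ln, g x.1 ∈ A.V ∧ A.l (g x.1) = x.2.1 ∧ (g x.1 ∈ A.P ↔ x.2.2 = true))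
    (h3 : (le.map (Edge.map g)).Nodup) (h4 : ∀ e ∈ le, e.map g ∈ A.E) :
    AGraph.Match (mkRule ln le rn re hl hr) A g := by
  refine ⟨?_, fun v hv => ?_, ?_⟩
  · intro a ha b hb hab
    obtain ⟨x, hx, rfl⟩ := (mkGraph_mem_V (h := hl)).1 ha
    obtain ⟨y, hy, rfl⟩ := (mkGraph_mem_V (h := hl)).1 hb
    rw [List.inj_on_of_nodup_map h1 hx hy hab]
  · obtain ⟨x, hx, rfl⟩ := (mkGraph_mem_V (h := hl)).1 hv
    obtain ⟨h5, h6, h7⟩ := h2 x hx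
    obtain ⟨h8, h9⟩ := mkGraph_spec (es := le) (h := hl) hnd hx
    exact ⟨h5, h6.trans h8.symm, h7.trans h9.symm⟩
  · show (↑(le.map (Edge.map g)) : Multiset (Edge N)) ≤ A.E
    refine (Multiset.le_iff_subset (Multiset.coe_nodup.2 h3)).2 fun e he => ?_
    obtain ⟨e', he', rfl⟩ := List.mem_map.1 (Multiset.mem_coe.1 he)
    exact h4 e' he'

/-- With the created nodes listed in `nw`, freshness and injectivity become finite checks. The edges
appear as sums of singletons, so that their balance is an identity in a commutative monoid. -/
theorem AGraph.Result.intro [DecidableEq N] (hnd : (rn.map Prod.fst).Nodup)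
    (h1 : ∀ x ∈ ln, h x.1 = g x.1) (nw : List ℕ)
    (hnw : ∀ v, v ∈ nw ↔ v ∈ rn.map Prod.fst ∧ v ∉ ln.map Prod.fst)
    (h2 : (nw.map h).Nodup) (h3 : ∀ v ∈ nw, h v ∉ A.V) (h4 : B.V = A.V ∪ (nw.map h).toFinset)
    (h5 : B.E + (le.map fun e => {e.map g}).sum = A.E + (re.map fun e => {e.map h}).sum)
    (h6 : ∀ v, (∀ x ∈ rn, h x.1 ≠ v) → (v ∈ A.V → B.l v = A.l v) ∧ (v ∈ B.P ↔ v ∈ A.P))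
    (h7 : ∀ x ∈ rn, B.l (h x.1) = x.2.1 ∧ (h x.1 ∈ B.P ↔ x.2.2 = true)) :
    AGraph.Result (mkRule ln le rn re hl hr) A g h B := by
  have hV : (mkGraph rn re hr).V \ (mkGraph ln le hl).V = nw.toFinset := by
    ext v
    rw [List.mem_toFinset, hnw]
    simp [mkGraph]
  have hsum : ∀ (es : List (Edge ℕ)) (g : ℕ → N),
      (es.map fun e => ({e.map g} : Multiset (Edge N))).sum = (es : Multiset _).map (Edge.map g) := by
    intro es g
    induction es with
    | nil => rfl
    | cons e es ih =>
      rw [List.map_cons, List.sum_cons, ih, ← Multiset.cons_coe, Multiset.map_cons,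
        Multiset.singleton_add]
  rw [hsum, hsum] at h5
  refine ⟨?_, ?_, ?_, ?_, h5, ?_, ?_⟩
  · intro v hv
    obtain ⟨x, hx, rfl⟩ := (mkGraph_mem_V (h := hl)).1 hv
    exact h1 x hx
  · show Set.InjOn h ↑((mkGraph rn re hr).V \ (mkGraph ln le hl).V)
    rw [hV]
    intro a ha b hb hab
    simp only [List.coe_toFinset, Set.mem_ofPred_eq] at ha hb
    exact List.inj_on_of_nodup_map h2 ha hb hab
  · show ∀ v ∈ (mkGraph rn re hr).V \ (mkGraph ln le hl).V, _
    rw [hV]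
    simpa using h3
  · show B.V = A.V ∪ ((mkGraph rn re hr).V \ (mkGraph ln le hl).V).image h
    rw [hV, h4]
    congr 1
    ext
    simp
  · intro v hv
    exact h6 v fun x hx => hv _ ((mkGraph_mem_V (h := hr)).2 ⟨x, hx, rfl⟩)
  · intro v hv
    obtain ⟨x, hx, rfl⟩ := (mkGraph_mem_V (h := hr)).1 hv
    obtain ⟨h8, h9⟩ := mkGraph_spec (es := re) (h := hr) hnd hx
    obtain ⟨h10, h11⟩ := h7 x hx
    exact ⟨h10.trans h8.symm, h11.trans h9.symm⟩

/-- The case of a rule that does not create nodes. -/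
theorem AGraph.Result.intro_same [DecidableEq N] (hnd : (rn.map Prod.fst).Nodup)
    (hln : ∀ v, v ∈ ln.map Prod.fst ↔ v ∈ rn.map Prod.fst) (h4 : B.V = A.V)
    (h5 : B.E + (le.map fun e => {e.map g}).sum = A.E + (re.map fun e => {e.map g}).sum)
    (h6 : ∀ v, (∀ x ∈ rn, g x.1 ≠ v) → (v ∈ A.V → B.l v = A.l v) ∧ (v ∈ B.P ↔ v ∈ A.P))
    (h7 : ∀ x ∈ rn, B.l (g x.1) = x.2.1 ∧ (g x.1 ∈ B.P ↔ x.2.2 = true)) :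
    ∃ h, AGraph.Result (mkRule ln le rn re hl hr) A g h B :=
  ⟨g, .intro hnd (fun _ _ => rfl) [] (fun v => by rw [hln, and_not_self_iff]; exact iff_of_false List.not_mem_nil id) (by simp) (by simp) (by simp [h4]) h5 h6 h7⟩

end MkRule

/-! ### Evaluation of commands up to isomorphism -/

/-- Outcomes of a command. -/
inductive Out
  | done (A : AGraph Node)
  | brk (A : AGraph Node)
  | fail

def Out.Rep : Out → Config → Prop
  | .done A, .done G => A.Rep G
  | .brk A, .run .brk G => A.Rep G
  | .fail, .fail => True
  | _, _ => False

/-- On all copies of `A`, all derivations of the command `P` are finite, make at most `n` rule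
calls and have the outcome `o`. -/
def Ev (P : Com) (A : AGraph Node) (n : ℕ) (o : Out) : Prop :=
  ∀ G, A.Rep G → Good o.Rep n (.run P G)

namespace Ev

variable {A B : AGraph Node} {P R C : Com} {m n : ℕ} {o : Out}

theorem out_done_run {P : Com} {G : HostGraph} : ¬ (Out.done A).Rep (.run P G) := by
  simp [Out.Rep]

theorem out_fail_run {P : Com} {G : HostGraph} : ¬ Out.fail.Rep (.run P G) := by
  simp [Out.Rep]

theorem out_brk_run {P : Com} {G : HostGraph} (h : (Out.brk A).Rep (.run P G)) : P = .brk := by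
  cases P <;> simp_all [Out.Rep]

theorem mono (h : Ev P A m o) (hmn : m ≤ n) : Ev P A n o := fun G hG => (h G hG).mono hmn

/-- Labels of names that are not nodes, such as digits beyond the end of the cache, are invisible in
the copies, but the records computed for a program may disagree there. -/
theorem congr_done (h : Ev P A n (.done B)) {B' : AGraph Node} (hB : B.Same B') :
    Ev P A n (.done B') := by
  have key : ∀ k γ, Good (Out.done B).Rep k γ → Good (Out.done B').Rep k γ := by
    intro k γ h
    induction h with
    | @halt n γ h1 h2 =>
      refine .halt h1 ?_
      cases γ with
      | done H => exact AGraph.Rep.congr h2 hB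
      | run P H => exact absurd h2 out_done_run
      | fail => exact h2.elim
    | step h1 h2 _ ih => exact .step h1 h2 ih
  exact fun G hG => key _ _ (h G hG)

theorem brk : Ev .brk A 0 (.brk A) := fun G hG => .halt (terminal_brk G) hG

theorem seq (h : Ev P A n (.done B)) (h' : Ev R B m o) : Ev (P ;; R) A (n + m) o :=
  fun G hG => (h G hG).seq h' (fun h => h.elim) (fun _ h => (out_done_run h).elim)
    fun _ _ h => (out_done_run h).elim

theorem seq_fail (h : Ev P A n .fail) : Ev (P ;; R) A n .fail :=
  fun G hG => (h G hG).seq (m := 0) (fun _ h => h.elim) (fun h => h)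
    (fun _ h => (out_fail_run h).elim) fun _ _ h => (out_fail_run h).elim

theorem seq_brk (h : Ev P A n (.brk B)) : Ev (P ;; R) A n (.brk B) :=
  fun G hG => (h G hG).seq (m := 0) (fun _ h => h.elim) (fun h => h.elim)
    (fun _ h => h) fun _ _ h => out_brk_run h

theorem tte (h : Ev C A n (.done B)) (h' : Ev P B m o) : Ev (.tte C P R) A (n + m) o :=
  fun G hG => (h G hG).tte h' (fun h => h.elim) fun _ _ => out_done_run

theorem tte_fail (h : Ev C A n .fail) (h' : Ev R A m o) : Ev (.tte C P R) A (n + m) o :=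
  fun G hG => (h G hG).tte (fun _ h => h.elim) (fun _ => h' G hG) fun _ _ => out_fail_run

theorem ite (h : Ev C A n (.done B)) (h' : Ev P A m o) : Ev (.ite C P R) A (n + m) o :=
  fun G hG => (h G hG).ite (fun _ _ => h' G hG) (fun h => h.elim) fun _ _ => out_done_run

theorem ite_fail (h : Ev C A n .fail) (h' : Ev R A m o) : Ev (.ite C P R) A (n + m) o :=
  fun G hG => (h G hG).ite (fun _ h => h.elim) (fun _ => h' G hG) fun _ _ => out_fail_run

theorem loop (h : Ev P A n (.done B)) (h' : Ev (.loop P) B m (.done D)) :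
    Ev (.loop P) A (n + m) (.done D) :=
  fun G hG => (h G hG).loop h' (fun h => h.elim) (fun _ h => (out_done_run h).elim)
    fun _ _ h => (out_done_run h).elim

theorem loop_fail (h : Ev P A n .fail) : Ev (.loop P) A n (.done A) :=
  fun G hG => (h G hG).loop (m := 0) (fun _ h => h.elim) (fun _ => hG)
    (fun _ h => (out_fail_run h).elim) fun _ _ h => (out_fail_run h).elim

theorem loop_brk (h : Ev P A n (.brk B)) : Ev (.loop P) A n (.done B) :=
  fun G hG => (h G hG).loop (m := 0) (fun _ h => h.elim) (fun h => h.elim)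
    (fun _ h => h) fun _ _ h => out_brk_run h

theorem skip : Ev skip A 0 (.done A) := loop_brk brk

theorem tryDo (h : Ev C A n (.done B)) : Ev (tryDo C) A n (.done B) := tte h skip

theorem tryDo_fail (h : Ev C A n .fail) : Ev (SGP2.tryDo C) A n (.done A) := tte_fail h skip

theorem tryThen_fail (h : Ev C A n .fail) : Ev (tryThen C P) A n (.done A) := tte_fail h skip

theorem tryElse (h : Ev C A n (.done B)) : Ev (tryElse C P) A n (.done B) := tte h skip

theorem tryElse_brk (h : Ev C A n .fail) : Ev (SGP2.tryElse C .brk) A n (.brk A) := tte_fail h brk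

theorem ifThen_fail (h : Ev C A n .fail) : Ev (ifThen C P) A n (.done A) := ite_fail h skip

/-- Uniqueness of the outcome has two halves: some rule has a match, and every match of every rule
in the set leads to the same graph `B` up to the names of created nodes. -/
theorem call {S : Set Rule} (hK : ∀ r ∈ S, r.K = r.L.V)
    (hex : A.WF → ∃ r ∈ S, ∃ g, AGraph.Match r A g)
    (hall : ∀ r ∈ S, ∀ g, A.WF → AGraph.Match r A g → ∃ h, AGraph.Result r A g h B) :
    Ev (.call S) A 1 (.done B) := by
  intro G hG
  have : Nonempty Node := ⟨.center⟩
  obtain ⟨r, hr, g, hg⟩ := hex hG.1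
  obtain ⟨H, hH⟩ := hG.exists_applies (hK r hr) hg
  have hne : ∃ H, SetApplies S G H := ⟨H, r, hr, hH⟩
  refine .step ⟨_, _, .call₁ ⟨r, hr, hH⟩⟩ ?_ ?_
  · intro m δ hs
    cases hs <;> rfl
  · intro m δ hs
    cases hs with
    | call₁ h =>
      obtain ⟨r, hr, hH⟩ := h
      obtain ⟨g, hg, hB⟩ := hG.of_applies (hK r hr) hH
      obtain ⟨h, hres⟩ := hall r hr g hG.1 hg
      exact .halt (terminal_done _) (hB h B hres)
    | call₂ h => exact absurd hne h

theorem call_fail {S : Set Rule} (hK : ∀ r ∈ S, r.K = r.L.V)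
    (hall : ∀ r ∈ S, ∀ g, A.WF → ¬ AGraph.Match r A g) : Ev (.call S) A 1 .fail := by
  intro G hG
  have : Nonempty Node := ⟨.center⟩
  have hne : ¬ ∃ H, SetApplies S G H := by
    rintro ⟨H, r, hr, hH⟩
    obtain ⟨g, hg, -⟩ := hG.of_applies (hK r hr) hH
    exact hall r hr g hG.1 hg
  refine .step ⟨_, _, .call₂ hne⟩ ?_ ?_
  · intro m δ hs
    cases hs <;> rfl
  · intro m δ hs
    cases hs with
    | call₁ h => exact absurd ⟨_, h⟩ hne
    | call₂ h => exact .halt terminal_fail trivial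

end Ev

/-! ### The graphs occurring in derivations of the simulating program -/

/-- The edges between `f i` and `f (i + 1)` for `i ∈ F`, in both directions. -/
def links (f : ℕ → Node) (F : Finset ℕ) : Multiset (Edge Node) :=
  F.val.map (fun i => eRight (f i) (f (i + 1))) + F.val.map (fun i => eLeft (f (i + 1)) (f i))

def dashes (F : Finset ℕ) (T : ℕ → ℕ) : Multiset (Edge Node) :=
  F.val.map fun j => eDash (Node.block j) (Node.block (T j))

theorem links_insert {f : ℕ → Node} {F : Finset ℕ} {i : ℕ} (hi : i ∉ F) :
    links f (insert i F) = links f F + {eRight (f i) (f (i + 1))} + {eLeft (f (i + 1)) (f i)} := by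
  simp only [links, Finset.insert_val_of_notMem hi, Multiset.map_cons]
  simp only [← Multiset.singleton_add]
  abel

theorem dashes_insert {F : Finset ℕ} {T : ℕ → ℕ} {i : ℕ} (hi : i ∉ F) :
    dashes (insert i F) T = dashes F T + {eDash (.block i) (.block (T i))} := by
  simp only [dashes, Finset.insert_val_of_notMem hi, Multiset.map_cons]
  simp only [← Multiset.singleton_add]
  abel

theorem dashes_congr {F : Finset ℕ} {T T' : ℕ → ℕ} (h : ∀ i ∈ F, T i = T' i) :
    dashes F T = dashes F T' :=
  Multiset.map_congr rfl fun i hi => by rw [h i hi]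

theorem dashes_erase {F : Finset ℕ} {T : ℕ → ℕ} {i : ℕ} (hi : i ∈ F) :
    dashes F T = dashes (F.erase i) T + {eDash (.block i) (.block (T i))} := by
  conv_lhs => rw [← Finset.insert_erase hi]
  exact dashes_insert (Finset.notMem_erase i F)

theorem dashes_update {F : Finset ℕ} {T : ℕ → ℕ} {i : ℕ} (hi : i ∈ F) (v : ℕ) :
    dashes F (Function.update T i v) =
      dashes (F.erase i) T + {eDash (.block i) (.block v)} := by
  rw [dashes_erase hi, Function.update_self]
  congr 1
  exact dashes_congr fun j hj => Function.update_of_ne (Finset.ne_of_mem_erase hj) _ _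

theorem Edge.map_std {N N' : Type} (f : N → N') :
    (∀ u v a, (eHead u v a).map f = eHead (f u) (f v) a) ∧
    (∀ u v, (eLeft u v).map f = eLeft (f u) (f v)) ∧
    (∀ u v, (eRight u v).map f = eRight (f u) (f v)) ∧
    (∀ u v, (eDash u v).map f = eDash (f u) (f v)) ∧
    (∀ u v, (eIn u v).map f = eIn (f u) (f v)) ∧
    (∀ u v, (eFirst u v).map f = eFirst (f u) (f v)) ∧
    ∀ u v a, (⟨u, v, a⟩ : Edge N).map f = ⟨f u, f v, a⟩ :=
  ⟨fun _ _ _ => rfl, fun _ _ => rfl, fun _ _ => rfl, fun _ _ => rfl, fun _ _ => rfl,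
    fun _ _ => rfl, fun _ _ _ => rfl⟩

/-- The assignment of the nodes in a list to the names `0, 1, …`. -/
def asg (l : List Node) (i : ℕ) : Node := l.getD i .center

/-- A description of a graph with a central node labelled `q`, marked grey if `grey` holds, an input
list for the word `w`, a cache list with `c` nodes labelled by the digits `dig`, and block nodes
with indices in `bV`. The optional numbers `red`, `blue`, `one`, `two`, `pl` are the indices of
the red root of the cache, and of the blue roots (unlabelled or labelled `1`, `2`) and of the
unmarked root among the block nodes. The finite set `lk` consists of the `j` such that block nodes
`j` and `j + 1` are linked, block node `j` has a dashed edge to `T j` if `j ∈ dm`, and `aux` are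
the targets of the auxiliary edges of the central node. -/
structure St where
  w : List (Fin 2)
  q : ℤ
  grey : Bool
  inp : ℕ
  c : ℕ
  dig : ℕ → Fin 3
  red : Option ℕ
  hd : ℕ
  pa : Atom
  bV : Finset ℕ
  lk : Finset ℕ
  dm : Finset ℕ
  T : ℕ → ℕ
  act : ℕ
  blue : Option ℕ
  one : Option ℕ
  two : Option ℕ
  pl : Option ℕ
  aux : Option (ℕ × ℕ)

namespace St

variable (s : St)

def V : Finset Node :=
  {.center} ∪ (Finset.range s.w.length).image .input ∪ s.bV.image .block ∪
    (Finset.range s.c).image .cache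

def P : Finset Node :=
  {.center} ∪ s.red.toFinset.image .cache ∪
    (s.blue.toFinset ∪ s.one.toFinset ∪ s.two.toFinset ∪ s.pl.toFinset).image .block

def l : Node → Label
  | .center => ⟨.int s.q, if s.grey then .grey else .plain⟩
  | .input i => num (s.w.getD i 0).val
  | .block j => if s.blue = some j then emp .blue else if s.one = some j then num 1 .blue else
      if s.two = some j then num 2 .blue else emp .plain
  | .cache i => ⟨.int (s.dig i).val, if s.red = some i then .red else .plain⟩

def auxE : Option (ℕ × ℕ) → Multiset (Edge Node)
  | none => 0
  | some (u, v) => {⟨.center, .block u, num 1 .blue⟩} + {⟨.center, .block v, num 2 .blue⟩}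

def E : Multiset (Edge Node) :=
  links .input (Finset.range (s.w.length - 1)) + links .cache (Finset.range (s.c - 1)) +
    links .block s.lk + dashes s.dm s.T + {eFirst .center (.input 0)} +
    {eIn .center (.input s.inp)} + {eLeft .center (.block 0)} +
    {eDash .center (.block s.act)} + {eRight .center (.cache (s.c - 1))} +
    {eHead .center (.cache s.hd) s.pa} + auxE s.aux

def toA : AGraph Node := ⟨s.V, s.P, s.l, s.E⟩

-- Edges and roots that determine matches

section

variable {s} {i j : ℕ} {v : Node} {a : Atom}

@[simp] theorem toA_V : s.toA.V = s.V := rfl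
@[simp] theorem toA_P : s.toA.P = s.P := rfl
@[simp] theorem toA_l : s.toA.l = s.l := rfl
@[simp] theorem toA_E : s.toA.E = s.E := rfl

@[simp] theorem center_mem_V : Node.center ∈ s.V := by simp [V]
@[simp] theorem input_mem_V : Node.input i ∈ s.V ↔ i < s.w.length := by simp [V]
@[simp] theorem block_mem_V : Node.block i ∈ s.V ↔ i ∈ s.bV := by simp [V]
@[simp] theorem cache_mem_V : Node.cache i ∈ s.V ↔ i < s.c := by simp [V]

@[simp] theorem center_mem_P : Node.center ∈ s.P := by simp [P]
@[simp] theorem input_mem_P : Node.input i ∉ s.P := by simp [P]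
@[simp] theorem block_mem_P : Node.block i ∈ s.P ↔
    s.blue = some i ∨ s.one = some i ∨ s.two = some i ∨ s.pl = some i := by
  simp [P]
@[simp] theorem cache_mem_P : Node.cache i ∈ s.P ↔ s.red = some i := by simp [P]

theorem l_center : s.l .center = ⟨.int s.q, if s.grey then .grey else .plain⟩ := rfl
theorem l_input : s.l (.input i) = num (s.w.getD i 0).val := rfl
theorem l_block : s.l (.block j) = if s.blue = some j then emp .blue else
    if s.one = some j then num 1 .blue else
      if s.two = some j then num 2 .blue else emp .plain := rfl
theorem l_cache : s.l (.cache i) = ⟨.int (s.dig i).val, if s.red = some i then .red else .plain⟩ :=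
  rfl

/-- Edges are told apart by source, atom and mark. The membership lemmas that follow are read off
from this list; each shows that an edge of a given kind has at most one target once its source is
known. -/
theorem mem_E {e : Edge Node} : e ∈ s.E ↔
    (∃ i, i + 1 < s.w.length ∧ (e = eRight (.input i) (.input (i + 1)) ∨
      e = eLeft (.input (i + 1)) (.input i))) ∨
    (∃ i, i + 1 < s.c ∧ (e = eRight (.cache i) (.cache (i + 1)) ∨
      e = eLeft (.cache (i + 1)) (.cache i))) ∨
    (∃ i, i ∈ s.lk ∧ (e = eRight (.block i) (.block (i + 1)) ∨
      e = eLeft (.block (i + 1)) (.block i))) ∨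
    (∃ i, i ∈ s.dm ∧ e = eDash (.block i) (.block (s.T i))) ∨
    e = eFirst .center (.input 0) ∨ e = eIn .center (.input s.inp) ∨
    e = eLeft .center (.block 0) ∨ e = eDash .center (.block s.act) ∨
    e = eRight .center (.cache (s.c - 1)) ∨ e = eHead .center (.cache s.hd) s.pa ∨
    ∃ u v, s.aux = some (u, v) ∧ (e = ⟨.center, .block u, num 1 .blue⟩ ∨
      e = ⟨.center, .block v, num 2 .blue⟩) := by
  have hl : ∀ (f : ℕ → Node) (n : ℕ), e ∈ links f (Finset.range (n - 1)) ↔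
      ∃ i, i + 1 < n ∧ (e = eRight (f i) (f (i + 1)) ∨ e = eLeft (f (i + 1)) (f i)) := by
    intro f n
    simp only [links, Multiset.mem_add, Multiset.mem_map, Finset.mem_val, Finset.mem_range,
      ← exists_or, ← and_or_left, Nat.lt_sub_iff_add_lt, eq_comm (a := e)]
  have hb : e ∈ links .block s.lk ↔ ∃ i, i ∈ s.lk ∧ (e = eRight (.block i) (.block (i + 1)) ∨
      e = eLeft (.block (i + 1)) (.block i)) := by
    simp only [links, Multiset.mem_add, Multiset.mem_map, Finset.mem_val,
      ← exists_or, ← and_or_left, eq_comm (a := e)]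
  have hd : e ∈ dashes s.dm s.T ↔ ∃ i, i ∈ s.dm ∧ e = eDash (.block i) (.block (s.T i)) := by
    simp only [dashes, Multiset.mem_map, Finset.mem_val, eq_comm (a := e)]
  have ha : e ∈ auxE s.aux ↔ ∃ u v, s.aux = some (u, v) ∧ (e = ⟨.center, .block u, num 1 .blue⟩ ∨
      e = ⟨.center, .block v, num 2 .blue⟩) := by
    rcases h : s.aux with _ | ⟨u, v⟩
    · simp [auxE]
    · simp only [auxE, Multiset.mem_add, Multiset.mem_singleton, Option.some.injEq, Prod.mk.injEq]
      constructor
      · exact fun h => ⟨u, v, ⟨rfl, rfl⟩, h⟩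
      · rintro ⟨_, _, ⟨rfl, rfl⟩, h⟩
        exact h
  simp only [E, Multiset.mem_add, Multiset.mem_singleton, hl, hb, hd, ha, or_assoc]

@[simp] theorem eHead_mem : eHead .center v a ∈ s.E ↔ v = .cache s.hd ∧ a = s.pa := by
  simp [mem_E, eHead, eLeft, eRight, eFirst, eIn, eDash, emp, num]

@[simp] theorem eIn_mem : eIn .center v ∈ s.E ↔ v = .input s.inp := by
  simp [mem_E, eHead, eLeft, eRight, eFirst, eIn, eDash, emp, num]

@[simp] theorem eFirst_mem : eFirst .center v ∈ s.E ↔ v = .input 0 := by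
  simp [mem_E, eHead, eLeft, eRight, eFirst, eIn, eDash, emp, num]

@[simp] theorem eLeft_center_mem : eLeft .center v ∈ s.E ↔ v = .block 0 := by
  simp [mem_E, eHead, eLeft, eRight, eFirst, eIn, eDash, emp, num]

@[simp] theorem eRight_center_mem : eRight .center v ∈ s.E ↔ v = .cache (s.c - 1) := by
  simp [mem_E, eHead, eLeft, eRight, eFirst, eIn, eDash, emp, num]

@[simp] theorem eDash_center_mem : eDash .center v ∈ s.E ↔ v = .block s.act := by
  simp [mem_E, eHead, eLeft, eRight, eFirst, eIn, eDash, emp, num]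

@[simp] theorem aux_one_mem :
    (⟨.center, v, num 1 .blue⟩ : Edge Node) ∈ s.E ↔ ∃ u, v = .block u ∧ ∃ u', s.aux = some (u, u') := by
  simp only [mem_E, eHead, eLeft, eRight, eFirst, eIn, eDash, emp, num]
  simp
  grind

@[simp] theorem aux_two_mem :
    (⟨.center, v, num 2 .blue⟩ : Edge Node) ∈ s.E ↔ ∃ u, v = .block u ∧ ∃ u', s.aux = some (u', u) := by
  simp only [mem_E, eHead, eLeft, eRight, eFirst, eIn, eDash, emp, num]
  simp
  grind

@[simp] theorem eLeft_input_mem :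
    eLeft (.input i) v ∈ s.E ↔ ∃ j, i = j + 1 ∧ v = .input j ∧ j + 1 < s.w.length := by
  simp [mem_E, eHead, eLeft, eRight, eFirst, eIn, eDash, emp, num]
  grind

@[simp] theorem eRight_input_mem :
    eRight (.input i) v ∈ s.E ↔ v = .input (i + 1) ∧ i + 1 < s.w.length := by
  simp [mem_E, eHead, eLeft, eRight, eFirst, eIn, eDash, emp, num]
  grind

@[simp] theorem eLeft_cache_mem :
    eLeft (.cache i) v ∈ s.E ↔ ∃ j, i = j + 1 ∧ v = .cache j ∧ j + 1 < s.c := by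
  simp [mem_E, eHead, eLeft, eRight, eFirst, eIn, eDash, emp, num]
  grind

@[simp] theorem eRight_cache_mem :
    eRight (.cache i) v ∈ s.E ↔ v = .cache (i + 1) ∧ i + 1 < s.c := by
  simp [mem_E, eHead, eLeft, eRight, eFirst, eIn, eDash, emp, num]
  grind

@[simp] theorem eLeft_block_mem :
    eLeft (.block i) v ∈ s.E ↔ ∃ j, i = j + 1 ∧ v = .block j ∧ j ∈ s.lk := by
  simp [mem_E, eHead, eLeft, eRight, eFirst, eIn, eDash, emp, num]
  grind

@[simp] theorem eRight_block_mem :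
    eRight (.block i) v ∈ s.E ↔ v = .block (i + 1) ∧ i ∈ s.lk := by
  simp [mem_E, eHead, eLeft, eRight, eFirst, eIn, eDash, emp, num]
  grind

@[simp] theorem eDash_block_mem :
    eDash (.block i) v ∈ s.E ↔ v = .block (s.T i) ∧ i ∈ s.dm := by
  simp [mem_E, eHead, eLeft, eRight, eFirst, eIn, eDash, emp, num]
  grind

/-- The central node is the only root whose label is an unmarked integer. Such facts fix the images
of the roots of a rule, from which the remaining images are found along edges. -/
theorem root_num {z : ℤ} (hv : v ∈ s.P) (hl : s.l v = num z) :
    v = .center ∧ s.q = z ∧ s.grey = false := by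
  cases v with
  | center => simpa [l, num] using hl
  | input i => simp at hv
  | block i =>
    rw [l_block] at hl
    split_ifs at hl <;> simp [num, emp] at hl
  | cache i => simp_all [l, num]

theorem root_grey {z : ℤ} (hv : v ∈ s.P) (hl : s.l v = num z .grey) :
    v = .center ∧ s.q = z ∧ s.grey = true := by
  cases v with
  | center => simpa [l, num] using hl
  | input i => simp at hv
  | block i =>
    rw [l_block] at hl
    split_ifs at hl <;> simp [num, emp] at hl
  | cache i => simp_all [l, num]

theorem root_red {z : ℤ} (hv : v ∈ s.P) (hl : s.l v = num z .red) :
    ∃ i, v = .cache i ∧ s.red = some i ∧ z = (s.dig i).val := by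
  cases v with
  | center =>
    rw [l_center] at hl
    split_ifs at hl <;> simp [num] at hl
  | input i => simp at hv
  | block i =>
    rw [l_block] at hl
    split_ifs at hl <;> simp [num, emp] at hl
  | cache i =>
    simp only [cache_mem_P] at hv
    simp only [l, hv, if_true, num, Label.mk.injEq, Atom.int.injEq] at hl
    exact ⟨i, rfl, hv, hl.1.symm⟩

theorem root_blue (hv : v ∈ s.P) (hl : s.l v = emp .blue) :
    ∃ i, v = .block i ∧ s.blue = some i := by
  cases v with
  | center => simp [l_center, emp] at hl
  | input i => simp at hv
  | block i =>
    rw [l_block] at hl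
    split_ifs at hl with h <;> simp_all [num, emp]
  | cache i => simp [l_cache, emp] at hl

theorem root_one (hv : v ∈ s.P) (hl : s.l v = num 1 .blue) :
    ∃ i, v = .block i ∧ s.one = some i := by
  cases v with
  | center => rw [l_center] at hl; split_ifs at hl <;> simp [num] at hl
  | input i => simp at hv
  | block i =>
    rw [l_block] at hl
    split_ifs at hl with h <;> simp_all [num, emp]
  | cache i => rw [l_cache] at hl; split_ifs at hl <;> simp [num] at hl

theorem root_two (hv : v ∈ s.P) (hl : s.l v = num 2 .blue) :
    ∃ i, v = .block i ∧ s.two = some i := by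
  cases v with
  | center => rw [l_center] at hl; split_ifs at hl <;> simp [num] at hl
  | input i => simp at hv
  | block i =>
    rw [l_block] at hl
    split_ifs at hl with h <;> simp_all [num, emp]
  | cache i => rw [l_cache] at hl; split_ifs at hl <;> simp [num] at hl

theorem root_plain (hv : v ∈ s.P) (hl : s.l v = emp .plain) :
    ∃ i, v = .block i ∧ s.pl = some i := by
  cases v with
  | center => simp [l_center, emp] at hl
  | input i => simp at hv
  | block i =>
    rw [l_block] at hl
    split_ifs at hl with h <;> simp_all [num, emp]
  | cache i => simp [l_cache, emp] at hl

end

end St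

namespace St

variable {M : OfflineTM} {s : St} {i : ℕ}

attribute [local simp] rt nd asg

/-! ### Moves of the head in the cache -/

section Head

variable {S : Set Rule} {a b : Atom}

/-- The rule set is a parameter because `moveLeft`, `headLeft` and `rewindCache` have the same
shape. `hS` restricts the rules that may occur, `hS'` provides those needed for the current state
and arbitrary symbols. -/
theorem ev_head_left (hS : ∀ r ∈ S, ∃ (z : ℤ) (x y : Fin 3) (hl : _) (hr : _), r = mkRule
      [rt 0 (num z), nd 1 (num x.val), nd 2 (num y.val)] [eHead 0 1 a, eLeft 1 2]
      [rt 0 (num z), nd 1 (num x.val), nd 2 (num y.val)] [eHead 0 2 b, eLeft 1 2] hl hr)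
    (hS' : ∀ x y : Fin 3, ∃ hl hr, mkRule
      [rt 0 (num s.q), nd 1 (num x.val), nd 2 (num y.val)] [eHead 0 1 a, eLeft 1 2]
      [rt 0 (num s.q), nd 1 (num x.val), nd 2 (num y.val)] [eHead 0 2 b, eLeft 1 2] hl hr ∈ S)
    (hg : s.grey = false) (hh : s.hd = i + 1) (hpa : s.pa = a) (hred : s.red = none) :
    Ev (.call S) s.toA 1 (.done {s with hd := i, pa := b}.toA) := by
  refine Ev.call ?_ ?_ ?_
  · intro r hr
    obtain ⟨z, x, y, hl, hr, rfl⟩ := hS r hr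
    exact mkRule_K (by simp)
  · intro wf
    have h1 := wf.edge_mem (eHead .center (.cache (i + 1)) a) (by simp [hh, hpa])
    simp only [eHead, toA_V, center_mem_V, cache_mem_V, true_and] at h1
    obtain ⟨hl, hr, hm⟩ := hS' (s.dig (i + 1)) (s.dig i)
    refine ⟨_, hm, asg [.center, .cache (i + 1), .cache i],
      .intro (by simp) (by simp) ?_ ?_ ?_⟩
    · simp [l_center, l_cache, hred, hg, num]
      omega
    · simp [eHead, eLeft, Edge.map, emp]
    · simp [Edge.map_std, hh, hpa]
      omega
  · intro r hr g wf hm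
    obtain ⟨z, x, y, hl, hr, rfl⟩ := hS r hr
    -- The match is forced: the root is the center, its head edge leads to one cache node, and the
    -- list edge from there to one neighbour.
    obtain ⟨-, h2, h3⟩ := hm.elim (by simp)
    simp at h2
    simp [Edge.map_std] at h3
    obtain ⟨⟨-, h4, h5⟩, ⟨-, h6, h7⟩, -, h8, h9⟩ := h2
    obtain ⟨g0, h10, h11⟩ := root_num h5 h4
    simp only [g0, eHead_mem] at h3
    obtain ⟨⟨g1, -⟩, h3⟩ := h3
    simp only [g1, eLeft_cache_mem] at h3
    obtain ⟨j, e1, g2, -⟩ := h3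
    obtain rfl : i = j := by omega
    refine AGraph.Result.intro_same (by simp) (by simp) rfl ?_ ?_ ?_
    · simp only [toA_E, E, List.map, List.sum_cons, List.sum_nil, Edge.map_std, g0, g1, g2, hh, hpa]
      abel
    · exact fun v hv => ⟨fun _ => rfl, Iff.rfl⟩
    · simp [g0, g1, g2] at *
      simp_all [toA, l_cache, l_center]

theorem ev_head_left_fail (hS : ∀ r ∈ S, ∃ (z : ℤ) (x y : Fin 3) (hl : _) (hr : _), r = mkRule
      [rt 0 (num z), nd 1 (num x.val), nd 2 (num y.val)] [eHead 0 1 a, eLeft 1 2]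
      [rt 0 (num z), nd 1 (num x.val), nd 2 (num y.val)] [eHead 0 2 b, eLeft 1 2] hl hr)
    (h : s.hd = 0 ∨ s.pa ≠ a) : Ev (.call S) s.toA 1 .fail := by
  refine Ev.call_fail ?_ ?_
  · intro r hr
    obtain ⟨z, x, y, hl, hr, rfl⟩ := hS r hr
    exact mkRule_K (by simp)
  · intro r hr g wf hm
    obtain ⟨z, x, y, hl, hr, rfl⟩ := hS r hr
    obtain ⟨-, h2, h3⟩ := hm.elim (by simp)
    simp at h2
    simp [Edge.map_std] at h3
    obtain ⟨⟨-, h4, h5⟩, -⟩ := h2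
    obtain ⟨g0, -⟩ := root_num h5 h4
    simp only [g0, eHead_mem] at h3
    obtain ⟨⟨g1, h6⟩, h3⟩ := h3
    simp only [g1, eLeft_cache_mem] at h3
    obtain ⟨j, e1, g2, -⟩ := h3
    rcases h with h | h
    · omega
    · exact h h6.symm

theorem ev_head_right (hS : ∀ r ∈ S, ∃ (z : ℤ) (x y : Fin 3) (hl : _) (hr : _), r = mkRule
      [rt 0 (num z), nd 1 (num x.val), nd 2 (num y.val)] [eHead 0 1 a, eRight 1 2]
      [rt 0 (num z), nd 1 (num x.val), nd 2 (num y.val)] [eHead 0 2 b, eRight 1 2] hl hr)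
    (hS' : ∀ x y : Fin 3, ∃ hl hr, mkRule
      [rt 0 (num s.q), nd 1 (num x.val), nd 2 (num y.val)] [eHead 0 1 a, eRight 1 2]
      [rt 0 (num s.q), nd 1 (num x.val), nd 2 (num y.val)] [eHead 0 2 b, eRight 1 2] hl hr ∈ S)
    (hg : s.grey = false) (hh : s.hd + 1 < s.c) (hpa : s.pa = a) (hred : s.red = none) :
    Ev (.call S) s.toA 1 (.done {s with hd := s.hd + 1, pa := b}.toA) := by
  refine Ev.call ?_ ?_ ?_
  · intro r hr
    obtain ⟨z, x, y, hl, hr, rfl⟩ := hS r hr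
    exact mkRule_K (by simp)
  · intro wf
    obtain ⟨hl, hr, hm⟩ := hS' (s.dig s.hd) (s.dig (s.hd + 1))
    refine ⟨_, hm, asg [.center, .cache s.hd, .cache (s.hd + 1)],
      .intro (by simp) (by simp) ?_ ?_ ?_⟩
    · simp [l_center, l_cache, hred, hg, num]
      omega
    · simp [eHead, eRight, Edge.map, emp]
    · simp [Edge.map_std, hpa, hh]
  · intro r hr g wf hm
    obtain ⟨z, x, y, hl, hr, rfl⟩ := hS r hr
    obtain ⟨-, h2, h3⟩ := hm.elim (by simp)
    simp at h2
    simp [Edge.map_std] at h3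
    obtain ⟨⟨-, h4, h5⟩, ⟨-, h6, h7⟩, -, h8, h9⟩ := h2
    obtain ⟨g0, h10, h11⟩ := root_num h5 h4
    simp only [g0, eHead_mem] at h3
    obtain ⟨⟨g1, -⟩, h3⟩ := h3
    simp only [g1, eRight_cache_mem] at h3
    obtain ⟨g2, -⟩ := h3
    refine AGraph.Result.intro_same (by simp) (by simp) rfl ?_ ?_ ?_
    · simp only [toA_E, E, List.map, List.sum_cons, List.sum_nil, Edge.map_std, g0, g1, g2, hpa]
      abel
    · exact fun v hv => ⟨fun _ => rfl, Iff.rfl⟩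
    · simp [g0, g1, g2] at *
      simp_all [toA, l_cache, l_center]

theorem ev_head_right_fail (hS : ∀ r ∈ S, ∃ (z : ℤ) (x y : Fin 3) (hl : _) (hr : _), r = mkRule
      [rt 0 (num z), nd 1 (num x.val), nd 2 (num y.val)] [eHead 0 1 a, eRight 1 2]
      [rt 0 (num z), nd 1 (num x.val), nd 2 (num y.val)] [eHead 0 2 b, eRight 1 2] hl hr)
    (h : s.c ≤ s.hd + 1 ∨ s.pa ≠ a) : Ev (.call S) s.toA 1 .fail := by
  refine Ev.call_fail ?_ ?_
  · intro r hr
    obtain ⟨z, x, y, hl, hr, rfl⟩ := hS r hr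
    exact mkRule_K (by simp)
  · intro r hr g wf hm
    obtain ⟨z, x, y, hl, hr, rfl⟩ := hS r hr
    obtain ⟨-, h2, h3⟩ := hm.elim (by simp)
    simp at h2
    simp [Edge.map_std] at h3
    obtain ⟨⟨-, h4, h5⟩, -⟩ := h2
    obtain ⟨g0, -⟩ := root_num h5 h4
    simp only [g0, eHead_mem] at h3
    obtain ⟨⟨g1, h6⟩, h3⟩ := h3
    simp only [g1, eRight_cache_mem] at h3
    rcases h with h | h
    · omega
    · exact h h6.symm

theorem ev_note (hS : ∀ r ∈ S, ∃ (z : ℤ) (x : Fin 3) (hl : _) (hr : _), r = mkRule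
      [rt 0 (num z), nd 1 (num x.val)] [eHead 0 1 a]
      [rt 0 (num z), nd 1 (num x.val)] [eHead 0 1 b] hl hr)
    (hS' : ∀ x : Fin 3, ∃ hl hr, mkRule
      [rt 0 (num s.q), nd 1 (num x.val)] [eHead 0 1 a]
      [rt 0 (num s.q), nd 1 (num x.val)] [eHead 0 1 b] hl hr ∈ S)
    (hg : s.grey = false) (hpa : s.pa = a) (hred : s.red = none) :
    Ev (.call S) s.toA 1 (.done {s with pa := b}.toA) := by
  refine Ev.call ?_ ?_ ?_
  · intro r hr
    obtain ⟨z, x, hl, hr, rfl⟩ := hS r hr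
    exact mkRule_K (by simp)
  · intro wf
    have h1 := wf.edge_mem (eHead .center (.cache s.hd) a) (by simp [hpa])
    simp only [eHead, toA_V, center_mem_V, cache_mem_V, true_and] at h1
    obtain ⟨hl, hr, hm⟩ := hS' (s.dig s.hd)
    refine ⟨_, hm, asg [.center, .cache s.hd], .intro (by simp) (by simp) ?_ ?_ ?_⟩
    · simp [l_center, l_cache, hred, hg, num, h1]
    · simp
    · simp [Edge.map_std, hpa]
  · intro r hr g wf hm
    obtain ⟨z, x, hl, hr, rfl⟩ := hS r hr
    obtain ⟨-, h2, h3⟩ := hm.elim (by simp)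
    simp at h2
    simp [Edge.map_std] at h3
    obtain ⟨⟨-, h4, h5⟩, ⟨-, h6, h7⟩⟩ := h2
    obtain ⟨g0, h10, h11⟩ := root_num h5 h4
    simp only [g0, eHead_mem] at h3
    obtain ⟨g1, -⟩ := h3
    refine AGraph.Result.intro_same (by simp) (by simp) rfl ?_ ?_ ?_
    · simp only [toA_E, E, List.map, List.sum_cons, List.sum_nil, Edge.map_std, g0, g1, hpa]
      abel
    · exact fun v hv => ⟨fun _ => rfl, Iff.rfl⟩
    · simp [g0, g1] at *
      simp_all [toA, l_cache, l_center]

theorem ev_note_fail (hS : ∀ r ∈ S, ∃ (z : ℤ) (x : Fin 3) (hl : _) (hr : _), r = mkRule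
      [rt 0 (num z), nd 1 (num x.val)] [eHead 0 1 a]
      [rt 0 (num z), nd 1 (num x.val)] [eHead 0 1 b] hl hr)
    (h : s.pa ≠ a) : Ev (.call S) s.toA 1 .fail := by
  refine Ev.call_fail ?_ ?_
  · intro r hr
    obtain ⟨z, x, hl, hr, rfl⟩ := hS r hr
    exact mkRule_K (by simp)
  · intro r hr g wf hm
    obtain ⟨z, x, hl, hr, rfl⟩ := hS r hr
    obtain ⟨-, h2, h3⟩ := hm.elim (by simp)
    simp at h2
    simp [Edge.map_std] at h3
    obtain ⟨⟨-, h4, h5⟩, -⟩ := h2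
    obtain ⟨g0, -⟩ := root_num h5 h4
    simp only [g0, eHead_mem] at h3
    exact h h3.2.symm

end Head

theorem ev_moveLeft (hq : s.q ∈ M.Q) (hg : s.grey = false) (hh : s.hd = i + 1)
    (hpa : s.pa = .L) (hred : s.red = none) :
    Ev (moveLeft M) s.toA 1 (.done {s with hd := i, pa := .empty}.toA) :=
  ev_head_left (fun _ ⟨q, x, y, h⟩ => ⟨q, x, y, _, _, h⟩)
    (fun x y => ⟨_, _, ⟨s.q, hq⟩, x, y, rfl⟩) hg hh hpa hred

theorem ev_moveLeft_fail (h : s.hd = 0 ∨ s.pa ≠ .L) : Ev (moveLeft M) s.toA 1 .fail :=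
  ev_head_left_fail (fun _ ⟨q, x, y, h⟩ => ⟨q, x, y, _, _, h⟩) h

theorem ev_headLeft (hq : s.q ∈ M.Q) (hg : s.grey = false) (hh : s.hd = i + 1)
    (hpa : s.pa = .empty) (hred : s.red = none) :
    Ev (headLeft M) s.toA 1 (.done {s with hd := i, pa := .empty}.toA) :=
  ev_head_left (fun _ ⟨q, x, y, h⟩ => ⟨q, x, y, _, _, h⟩)
    (fun x y => ⟨_, _, ⟨s.q, hq⟩, x, y, rfl⟩) hg hh hpa hred

theorem ev_headLeft_fail (h : s.hd = 0) : Ev (headLeft M) s.toA 1 .fail :=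
  ev_head_left_fail (fun _ ⟨q, x, y, h⟩ => ⟨q, x, y, _, _, h⟩) (.inl h)

theorem ev_rewindCache (hq : s.q = M.q₀) (hg : s.grey = false) (hh : s.hd = i + 1)
    (hpa : s.pa = .empty) (hred : s.red = none) :
    Ev (rewindCache M) s.toA 1 (.done {s with hd := i, pa := .empty}.toA) :=
  ev_head_left (fun _ ⟨x, y, h⟩ => ⟨M.q₀, x, y, _, _, h⟩)
    (fun x y => ⟨_, _, x, y, by rw [hq]; rfl⟩) hg hh hpa hred

theorem ev_rewindCache_fail (h : s.hd = 0) : Ev (rewindCache M) s.toA 1 .fail :=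
  ev_head_left_fail (fun _ ⟨x, y, h⟩ => ⟨M.q₀, x, y, _, _, h⟩) (.inl h)

theorem ev_moveRight (hq : s.q ∈ M.Q) (hg : s.grey = false) (hh : s.hd + 1 < s.c)
    (hpa : s.pa = .R) (hred : s.red = none) :
    Ev (moveRight M) s.toA 1 (.done {s with hd := s.hd + 1, pa := .empty}.toA) :=
  ev_head_right (fun _ ⟨q, x, y, h⟩ => ⟨q, x, y, _, _, h⟩)
    (fun x y => ⟨_, _, ⟨s.q, hq⟩, x, y, rfl⟩) hg hh hpa hred

theorem ev_moveRight_fail (h : s.c ≤ s.hd + 1 ∨ s.pa ≠ .R) : Ev (moveRight M) s.toA 1 .fail :=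
  ev_head_right_fail (fun _ ⟨q, x, y, h⟩ => ⟨q, x, y, _, _, h⟩) h

theorem ev_headRight (hq : s.q ∈ M.Q) (hg : s.grey = false) (hh : s.hd + 1 < s.c)
    (hpa : s.pa = .empty) (hred : s.red = none) :
    Ev (headRight M) s.toA 1 (.done {s with hd := s.hd + 1, pa := .empty}.toA) :=
  ev_head_right (fun _ ⟨q, x, y, h⟩ => ⟨q, x, y, _, _, h⟩)
    (fun x y => ⟨_, _, ⟨s.q, hq⟩, x, y, rfl⟩) hg hh hpa hred

theorem ev_headRight_fail (h : s.c ≤ s.hd + 1) : Ev (headRight M) s.toA 1 .fail :=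
  ev_head_right_fail (fun _ ⟨q, x, y, h⟩ => ⟨q, x, y, _, _, h⟩) (.inl h)

theorem ev_left (hq : s.q ∈ M.Q) (hg : s.grey = false) (hpa : s.pa = .L) (hred : s.red = none) :
    Ev (left M) s.toA 1 (.done {s with pa := .empty}.toA) :=
  ev_note (fun _ ⟨q, x, h⟩ => ⟨q, x, _, _, h⟩) (fun x => ⟨_, _, ⟨s.q, hq⟩, x, rfl⟩) hg hpa hred

theorem ev_left_fail (hpa : s.pa ≠ .L) : Ev (left M) s.toA 1 .fail :=
  ev_note_fail (fun _ ⟨q, x, h⟩ => ⟨q, x, _, _, h⟩) hpa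

theorem ev_right (hq : s.q ∈ M.Q) (hg : s.grey = false) (hpa : s.pa = .R) (hred : s.red = none) :
    Ev (right M) s.toA 1 (.done {s with pa := .empty}.toA) :=
  ev_note (fun _ ⟨q, x, h⟩ => ⟨q, x, _, _, h⟩) (fun x => ⟨_, _, ⟨s.q, hq⟩, x, rfl⟩) hg hpa hred

theorem ev_right_fail (hpa : s.pa ≠ .R) : Ev (right M) s.toA 1 .fail :=
  ev_note_fail (fun _ ⟨q, x, h⟩ => ⟨q, x, _, _, h⟩) hpa

/-! ### Flag and active block node -/

theorem ev_setFlag (hq : s.q ∈ M.Q) (hg : s.grey = false) :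
    Ev (setFlag M) s.toA 1 (.done {s with grey := true}.toA) := by
  refine Ev.call ?_ ?_ ?_
  · rintro _ ⟨q, rfl⟩
    exact mkRule_K (by simp)
  · intro wf
    refine ⟨_, ⟨⟨s.q, hq⟩, rfl⟩, asg [.center], .intro (by simp) (by simp) ?_ (by simp) (by simp)⟩
    simp [l_center, hg, num]
  · rintro _ ⟨q, rfl⟩ g wf hm
    obtain ⟨-, h2, -⟩ := hm.elim (by simp)
    simp at h2
    obtain ⟨-, h4, h5⟩ := h2
    obtain ⟨g0, h10, h11⟩ := root_num h5 h4
    refine AGraph.Result.intro_same (by simp) (by simp) rfl ?_ ?_ ?_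
    · simp [E]
    · rintro (_ | v | v | v) hv
      · simp [g0] at hv
      all_goals exact ⟨fun _ => rfl, Iff.rfl⟩
    · simp [g0, l_center, num, h10]

theorem ev_flag (hq : s.q ∈ M.Q) (hg : s.grey = true) :
    Ev (flag M) s.toA 1 (.done {s with grey := false, q := M.q₀}.toA) := by
  refine Ev.call ?_ ?_ ?_
  · rintro _ ⟨q, rfl⟩
    exact mkRule_K (by simp)
  · intro wf
    refine ⟨_, ⟨⟨s.q, hq⟩, rfl⟩, asg [.center], .intro (by simp) (by simp) ?_ (by simp) (by simp)⟩
    simp [l_center, hg, num]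
  · rintro _ ⟨q, rfl⟩ g wf hm
    obtain ⟨-, h2, -⟩ := hm.elim (by simp)
    simp at h2
    obtain ⟨-, h4, h5⟩ := h2
    obtain ⟨g0, h10, h11⟩ := root_grey h5 h4
    refine AGraph.Result.intro_same (by simp) (by simp) rfl ?_ ?_ ?_
    · simp [E]
    · rintro (_ | v | v | v) hv
      · simp [g0] at hv
      all_goals exact ⟨fun _ => rfl, Iff.rfl⟩
    · simp [g0, l_center, num]

theorem ev_flag_fail (hg : s.grey = false) : Ev (flag M) s.toA 1 .fail := by
  refine Ev.call_fail ?_ ?_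
  · rintro _ ⟨q, rfl⟩
    exact mkRule_K (by simp)
  · rintro _ ⟨q, rfl⟩ g wf hm
    obtain ⟨-, h2, -⟩ := hm.elim (by simp)
    simp at h2
    obtain ⟨-, h4, h5⟩ := h2
    obtain ⟨g0, h10, h11⟩ := root_grey h5 h4
    simp [hg] at h11

theorem ev_next (hq : s.q ∈ M.Q) (hg : s.grey = false) (ha : s.act ∈ s.lk)
    (h1 : s.blue = none) (h2 : s.one = none) (h3 : s.two = none) (h4 : s.pl = none) :
    Ev (next M) s.toA 1 (.done {s with act := s.act + 1}.toA) := by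
  refine Ev.call ?_ ?_ ?_
  · rintro _ ⟨q, rfl⟩
    exact mkRule_K (by simp)
  · intro wf
    have h5 := wf.edge_mem (eRight (.block s.act) (.block (s.act + 1))) (by simp [ha])
    simp [eRight] at h5
    refine ⟨_, ⟨⟨s.q, hq⟩, rfl⟩, asg [.center, .block s.act, .block (s.act + 1)],
      .intro (by simp) (by simp) ?_ ?_ ?_⟩
    · simp [l_center, num, l_block, *]
    · simp [eDash, eRight, Edge.map, emp]
    · simp [Edge.map_std, ha]
  · rintro _ ⟨q, rfl⟩ g wf hm
    obtain ⟨-, h5, h6⟩ := hm.elim (by simp)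
    simp at h5
    simp [Edge.map_std] at h6
    obtain ⟨⟨-, h7, h8⟩, ⟨-, h9, h10⟩, -, h11, h12⟩ := h5
    obtain ⟨g0, -⟩ := root_num h8 h7
    simp only [g0, eDash_center_mem] at h6
    obtain ⟨g1, h6⟩ := h6
    simp only [g1, eRight_block_mem] at h6
    obtain ⟨g2, -⟩ := h6
    refine AGraph.Result.intro_same (by simp) (by simp) rfl ?_ ?_ ?_
    · simp only [toA_E, E, List.map, List.sum_cons, List.sum_nil, Edge.map_std, g0, g1, g2]
      abel
    · exact fun v hv => ⟨fun _ => rfl, Iff.rfl⟩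
    · simp [g0, g1, g2] at *
      simp_all [toA, l_block, l_center]

theorem ev_next_fail (ha : s.act ∉ s.lk) : Ev (next M) s.toA 1 .fail := by
  refine Ev.call_fail ?_ ?_
  · rintro _ ⟨q, rfl⟩
    exact mkRule_K (by simp)
  · rintro _ ⟨q, rfl⟩ g wf hm
    obtain ⟨-, h5, h6⟩ := hm.elim (by simp)
    simp at h5
    simp [Edge.map_std] at h6
    obtain ⟨⟨-, h7, h8⟩, -⟩ := h5
    obtain ⟨g0, -⟩ := root_num h8 h7
    simp only [g0, eDash_center_mem] at h6
    obtain ⟨g1, h6⟩ := h6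
    simp only [g1, eRight_block_mem] at h6
    exact ha h6.2

theorem ev_prev (hq : s.q ∈ M.Q) (hg : s.grey = false) (ha : s.act = i + 1) (hi : i ∈ s.lk)
    (h1 : s.blue = none) (h2 : s.one = none) (h3 : s.two = none) (h4 : s.pl = none) :
    Ev (prev M) s.toA 1 (.done {s with act := i}.toA) := by
  refine Ev.call ?_ ?_ ?_
  · rintro _ ⟨q, rfl⟩
    exact mkRule_K (by simp)
  · intro wf
    have h5 := wf.edge_mem (eRight (.block i) (.block (i + 1))) (by simp [hi])
    simp [eRight] at h5
    refine ⟨_, ⟨⟨s.q, hq⟩, rfl⟩, asg [.center, .block (i + 1), .block i],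
      .intro (by simp) (by simp) ?_ ?_ ?_⟩
    · simp [l_center, num, l_block, *]
    · simp [eDash, eLeft, Edge.map, emp]
    · simp [Edge.map_std, ha, hi]
  · rintro _ ⟨q, rfl⟩ g wf hm
    obtain ⟨-, h5, h6⟩ := hm.elim (by simp)
    simp at h5
    simp [Edge.map_std] at h6
    obtain ⟨⟨-, h7, h8⟩, ⟨-, h9, h10⟩, -, h11, h12⟩ := h5
    obtain ⟨g0, -⟩ := root_num h8 h7
    simp only [g0, eDash_center_mem] at h6
    obtain ⟨g1, h6⟩ := h6
    simp only [g1, eLeft_block_mem] at h6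
    obtain ⟨j, e1, g2, -⟩ := h6
    obtain rfl : i = j := by omega
    refine AGraph.Result.intro_same (by simp) (by simp) rfl ?_ ?_ ?_
    · simp only [toA_E, E, List.map, List.sum_cons, List.sum_nil, Edge.map_std, g0, g1, g2, ha]
      abel
    · exact fun v hv => ⟨fun _ => rfl, Iff.rfl⟩
    · simp [g0, g1, g2] at *
      simp_all [toA, l_block, l_center]

theorem ev_prev_fail (ha : s.act = 0) : Ev (prev M) s.toA 1 .fail := by
  refine Ev.call_fail ?_ ?_
  · rintro _ ⟨q, rfl⟩
    exact mkRule_K (by simp)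
  · rintro _ ⟨q, rfl⟩ g wf hm
    obtain ⟨-, h5, h6⟩ := hm.elim (by simp)
    simp at h5
    simp [Edge.map_std] at h6
    obtain ⟨⟨-, h7, h8⟩, -⟩ := h5
    obtain ⟨g0, -⟩ := root_num h8 h7
    simp only [g0, eDash_center_mem] at h6
    obtain ⟨g1, h6⟩ := h6
    simp only [g1, eLeft_block_mem] at h6
    obtain ⟨j, e1, -⟩ := h6
    omega

end St

namespace St

variable {M : OfflineTM} {s : St} {i p : ℕ}

attribute [local simp] rt nd asg

/-! ### The red root of the cache -/

theorem ev_cacheInit (hq : s.q ∈ M.Q) (hg : s.grey = false) (hred : s.red = none) :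
    Ev (cacheInit M) s.toA 1 (.done {s with red := some (s.c - 1)}.toA) := by
  refine Ev.call ?_ ?_ ?_
  · rintro _ ⟨q, x, rfl⟩
    exact mkRule_K (by simp)
  · intro wf
    have h1 := wf.edge_mem (eRight .center (.cache (s.c - 1))) (by simp)
    simp only [eRight, toA_V, center_mem_V, cache_mem_V, true_and] at h1
    refine ⟨_, ⟨⟨s.q, hq⟩, s.dig (s.c - 1), rfl⟩, asg [.center, .cache (s.c - 1)],
      .intro (by simp) (by simp) ?_ (by simp) (by simp [Edge.map_std])⟩
    simp [l_center, hg, num, l_cache, hred, h1]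
  · rintro _ ⟨q, x, rfl⟩ g wf hm
    obtain ⟨-, h5, h6⟩ := hm.elim (by simp)
    simp at h5
    simp [Edge.map_std] at h6
    obtain ⟨⟨-, h7, h8⟩, ⟨-, h9, h10⟩⟩ := h5
    obtain ⟨g0, h11, h12⟩ := root_num h8 h7
    simp only [g0, eRight_center_mem] at h6
    refine AGraph.Result.intro_same (by simp) (by simp) rfl ?_ ?_ ?_
    · simp [E]
    · rintro (_ | v | v | v) hv
      · exact ⟨fun _ => rfl, by simp⟩
      · exact ⟨fun _ => rfl, by simp⟩
      · exact ⟨fun _ => rfl, by simp⟩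
      · simp [g0, h6] at hv
        simp [l_cache, hv, hred]
    · simp [g0, h6] at *
      simp_all [num, l_cache, l_center]

section Digit

variable {S : Set Rule} {D : ℤ → ℤ → Prop}

/-- `D` relates old and new digits of the rules in `S`. It need be single-valued only at the scanned
digit, which makes the result unique even if `S` has several rules. -/
theorem ev_digit {y : Fin 3} (hS : ∀ r ∈ S, ∃ x y, D x y ∧ r = digit x y)
    (hS' : digit (s.dig p).val y.val ∈ S) (hD : ∀ z, D (s.dig p).val z → z = y.val)
    (hred : s.red = some p) :
    Ev (.call S) s.toA 1 (.done {s with dig := Function.update s.dig p y}.toA) := by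
  refine Ev.call ?_ ?_ ?_
  · intro r hr
    obtain ⟨x, z, -, rfl⟩ := hS r hr
    exact mkRule_K (by simp)
  · intro wf
    have h1 := wf.root_mem (.cache p) (by simp [hred])
    simp only [toA_V, cache_mem_V] at h1
    refine ⟨_, hS', asg [.cache p], .intro (by simp) (by simp) ?_ (by simp) (by simp)⟩
    simp [num, l_cache, hred, h1]
  · intro r hr g wf hm
    obtain ⟨x, z, hxz, rfl⟩ := hS r hr
    obtain ⟨-, h5, -⟩ := hm.elim (by simp)
    simp at h5
    obtain ⟨-, h7, h8⟩ := h5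
    obtain ⟨j, g0, h9, h10⟩ := root_red h8 h7
    obtain rfl : p = j := by simpa [hred] using h9
    refine AGraph.Result.intro_same (by simp) (by simp) rfl ?_ ?_ ?_
    · simp [E]
    · rintro (_ | v | v | v) hv
      · exact ⟨fun _ => rfl, by simp⟩
      · exact ⟨fun _ => rfl, by simp⟩
      · exact ⟨fun _ => rfl, by simp⟩
      · simp [g0] at hv
        simp [l_cache, Function.update_of_ne (Ne.symm hv)]
    · rw [h10] at hxz
      simp [g0, l_cache, hred, num, hD z hxz]

theorem ev_digit_fail (hS : ∀ r ∈ S, ∃ x y, D x y ∧ r = digit x y)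
    (hD : ∀ z, ¬ D (s.dig p).val z) (hred : s.red = some p) : Ev (.call S) s.toA 1 .fail := by
  refine Ev.call_fail ?_ ?_
  · intro r hr
    obtain ⟨x, z, -, rfl⟩ := hS r hr
    exact mkRule_K (by simp)
  · intro r hr g wf hm
    obtain ⟨x, z, hxz, rfl⟩ := hS r hr
    obtain ⟨-, h5, -⟩ := hm.elim (by simp)
    simp at h5
    obtain ⟨-, h7, h8⟩ := h5
    obtain ⟨j, g0, h9, h10⟩ := root_red h8 h7
    obtain rfl : p = j := by simpa [hred] using h9
    exact hD z (h10 ▸ hxz)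

end Digit

theorem ev_dec (hred : s.red = some p) (hp : s.dig p ≠ 0) :
    Ev dec s.toA 1 (.done {s with dig := Function.update s.dig p (s.dig p - 1)}.toA) := by
  refine ev_digit (D := fun x y => y = x - 1) ?_ ?_ ?_ hred
  · rintro r (rfl | rfl)
    · exact ⟨2, 1, by norm_num, rfl⟩
    · exact ⟨1, 0, by norm_num, rfl⟩
  · generalize s.dig p = d at hp ⊢
    fin_cases d
    · exact absurd rfl hp
    · exact .inr rfl
    · exact .inl rfl
  · generalize s.dig p = d at hp ⊢
    rintro z rfl
    fin_cases d
    · exact absurd rfl hp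
    · rfl
    · rfl

theorem ev_dec_fail (hred : s.red = some p) (hp : s.dig p = 0) : Ev dec s.toA 1 .fail := by
  refine ev_digit_fail (D := fun x _ => x ≠ 0) ?_ ?_ hred
  · rintro r (rfl | rfl)
    · exact ⟨2, 1, by norm_num, rfl⟩
    · exact ⟨1, 0, by norm_num, rfl⟩
  · simp [hp]

theorem ev_inc (hred : s.red = some p) (hp : s.dig p ≠ 2) :
    Ev inc s.toA 1 (.done {s with dig := Function.update s.dig p (s.dig p + 1)}.toA) := by
  refine ev_digit (D := fun x y => y = x + 1) ?_ ?_ ?_ hred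
  · rintro r (rfl | rfl)
    · exact ⟨0, 1, by norm_num, rfl⟩
    · exact ⟨1, 2, by norm_num, rfl⟩
  · generalize s.dig p = d at hp ⊢
    fin_cases d
    · exact .inl rfl
    · exact .inr rfl
    · exact absurd rfl hp
  · generalize s.dig p = d at hp ⊢
    rintro z rfl
    fin_cases d
    · rfl
    · rfl
    · exact absurd rfl hp

theorem ev_inc_fail (hred : s.red = some p) (hp : s.dig p = 2) : Ev inc s.toA 1 .fail := by
  refine ev_digit_fail (D := fun x _ => x ≠ 2) ?_ ?_ hred
  · rintro r (rfl | rfl)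
    · exact ⟨0, 1, by norm_num, rfl⟩
    · exact ⟨1, 2, by norm_num, rfl⟩
  · simp [hp]

theorem ev_underflow (hred : s.red = some p) (hp : s.dig p = 0) :
    Ev underflow s.toA 1 (.done {s with dig := Function.update s.dig p 2}.toA) := by
  refine ev_digit (D := fun _ y => y = 2) ?_ ?_ ?_ hred
  · rintro r rfl
    exact ⟨0, 2, rfl, rfl⟩
  · rw [hp]
    rfl
  · rintro z rfl
    rfl

theorem ev_overflow (hred : s.red = some p) (hp : s.dig p = 2) :
    Ev overflow s.toA 1 (.done {s with dig := Function.update s.dig p 0}.toA) := by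
  refine ev_digit (D := fun _ y => y = 0) ?_ ?_ ?_ hred
  · rintro r rfl
    exact ⟨2, 0, rfl, rfl⟩
  · rw [hp]
    rfl
  · rintro z rfl
    rfl

theorem ev_finish (hred : s.red = some p) :
    Ev finish s.toA 1 (.done {s with red := none}.toA) := by
  refine Ev.call ?_ ?_ ?_
  · rintro _ ⟨x, rfl⟩
    exact mkRule_K (by simp)
  · intro wf
    have h1 := wf.root_mem (.cache p) (by simp [hred])
    simp only [toA_V, cache_mem_V] at h1
    refine ⟨_, ⟨s.dig p, rfl⟩, asg [.cache p], .intro (by simp) (by simp) ?_ (by simp) (by simp)⟩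
    simp [num, l_cache, hred, h1]
  · rintro _ ⟨x, rfl⟩ g wf hm
    obtain ⟨-, h5, -⟩ := hm.elim (by simp)
    simp at h5
    obtain ⟨-, h7, h8⟩ := h5
    obtain ⟨j, g0, h9, h10⟩ := root_red h8 h7
    obtain rfl : p = j := by simpa [hred] using h9
    refine AGraph.Result.intro_same (by simp) (by simp) rfl ?_ ?_ ?_
    · simp [E]
    · rintro (_ | v | v | v) hv
      · exact ⟨fun _ => rfl, by simp⟩
      · exact ⟨fun _ => rfl, by simp⟩
      · exact ⟨fun _ => rfl, by simp⟩
      · simp [g0] at hv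
        simp [l_cache, hv, hred]
    · simp [g0, l_cache, num, h10]

theorem ev_finish_fail (hred : s.red = none) : Ev finish s.toA 1 .fail := by
  refine Ev.call_fail ?_ ?_
  · rintro _ ⟨x, rfl⟩
    exact mkRule_K (by simp)
  · rintro _ ⟨x, rfl⟩ g wf hm
    obtain ⟨-, h5, -⟩ := hm.elim (by simp)
    simp at h5
    obtain ⟨-, h7, h8⟩ := h5
    obtain ⟨j, g0, h9, h10⟩ := root_red h8 h7
    simp [hred] at h9

theorem ev_unfinished (hred : s.red = some p) : Ev unfinished s.toA 1 (.done s.toA) := by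
  refine Ev.call ?_ ?_ ?_
  · rintro _ ⟨x, rfl⟩
    exact mkRule_K (by simp)
  · intro wf
    have h1 := wf.root_mem (.cache p) (by simp [hred])
    simp only [toA_V, cache_mem_V] at h1
    refine ⟨_, ⟨s.dig p, rfl⟩, asg [.cache p], .intro (by simp) (by simp) ?_ (by simp) (by simp)⟩
    simp [num, l_cache, hred, h1]
  · rintro _ ⟨x, rfl⟩ g wf hm
    obtain ⟨-, h5, -⟩ := hm.elim (by simp)
    simp at h5
    obtain ⟨-, h7, h8⟩ := h5
    refine AGraph.Result.intro_same (by simp) (by simp) rfl rfl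
      (fun v hv => ⟨fun _ => rfl, Iff.rfl⟩) ?_
    simp [h7, h8]

theorem ev_unfinished_fail (hred : s.red = none) : Ev unfinished s.toA 1 .fail := by
  refine Ev.call_fail ?_ ?_
  · rintro _ ⟨x, rfl⟩
    exact mkRule_K (by simp)
  · rintro _ ⟨x, rfl⟩ g wf hm
    obtain ⟨-, h5, -⟩ := hm.elim (by simp)
    simp at h5
    obtain ⟨-, h7, h8⟩ := h5
    obtain ⟨j, g0, h9, h10⟩ := root_red h8 h7
    simp [hred] at h9

theorem ev_cacheNext (hred : s.red = some (p + 1)) :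
    Ev cacheNext s.toA 1 (.done {s with red := some p}.toA) := by
  refine Ev.call ?_ ?_ ?_
  · rintro _ ⟨x, y, rfl⟩
    exact mkRule_K (by simp)
  · intro wf
    have h1 := wf.root_mem (.cache (p + 1)) (by simp [hred])
    simp only [toA_V, cache_mem_V] at h1
    refine ⟨_, ⟨s.dig (p + 1), s.dig p, rfl⟩, asg [.cache (p + 1), .cache p],
      .intro (by simp) (by simp) ?_ (by simp) ?_⟩
    · simp [num, l_cache, hred, h1]
      omega
    · simp [Edge.map_std, h1]
  · rintro _ ⟨x, y, rfl⟩ g wf hm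
    obtain ⟨-, h5, h6⟩ := hm.elim (by simp)
    simp at h5
    simp [Edge.map_std] at h6
    obtain ⟨⟨-, h7, h8⟩, -, h11, h12⟩ := h5
    obtain ⟨j, g0, h9, h10⟩ := root_red h8 h7
    obtain rfl : p + 1 = j := by simpa [hred] using h9
    simp only [g0, eLeft_cache_mem] at h6
    obtain ⟨j, e1, g1, -⟩ := h6
    obtain rfl : p = j := by omega
    refine AGraph.Result.intro_same (by simp) (by simp) rfl ?_ ?_ ?_
    · simp [E]
    · rintro (_ | v | v | v) hv
      · exact ⟨fun _ => rfl, by simp⟩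
      · exact ⟨fun _ => rfl, by simp⟩
      · exact ⟨fun _ => rfl, by simp⟩
      · simp [g0, g1] at hv
        simp [l_cache, hv, hred]
    · have h13 : s.l (.cache _) = _ := g1 ▸ h11
      simp [l_cache, hred, num] at h13
      simp [g0, g1, l_cache, num, h10, h13]

theorem ev_cacheNext_fail (hred : s.red = some 0) : Ev cacheNext s.toA 1 .fail := by
  refine Ev.call_fail ?_ ?_
  · rintro _ ⟨x, y, rfl⟩
    exact mkRule_K (by simp)
  · rintro _ ⟨x, y, rfl⟩ g wf hm
    obtain ⟨-, h5, h6⟩ := hm.elim (by simp)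
    simp at h5
    simp [Edge.map_std] at h6
    obtain ⟨⟨-, h7, h8⟩, -⟩ := h5
    obtain ⟨j, g0, h9, h10⟩ := root_red h8 h7
    obtain rfl : 0 = j := by simpa [hred] using h9
    simp only [g0, eLeft_cache_mem] at h6
    obtain ⟨j, e1, -⟩ := h6
    omega

theorem ev_cachePrev (hred : s.red = some p) (hp : p + 1 < s.c) :
    Ev cachePrev s.toA 1 (.done {s with red := some (p + 1)}.toA) := by
  refine Ev.call ?_ ?_ ?_
  · rintro _ ⟨x, y, rfl⟩
    exact mkRule_K (by simp)
  · intro wf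
    refine ⟨_, ⟨s.dig p, s.dig (p + 1), rfl⟩, asg [.cache p, .cache (p + 1)],
      .intro (by simp) (by simp) ?_ (by simp) ?_⟩
    · simp [num, l_cache, hred, hp]
      omega
    · simp [Edge.map_std, hp]
  · rintro _ ⟨x, y, rfl⟩ g wf hm
    obtain ⟨-, h5, h6⟩ := hm.elim (by simp)
    simp at h5
    simp [Edge.map_std] at h6
    obtain ⟨⟨-, h7, h8⟩, -, h11, h12⟩ := h5
    obtain ⟨j, g0, h9, h10⟩ := root_red h8 h7
    obtain rfl : p = j := by simpa [hred] using h9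
    simp only [g0, eRight_cache_mem] at h6
    obtain ⟨g1, -⟩ := h6
    refine AGraph.Result.intro_same (by simp) (by simp) rfl ?_ ?_ ?_
    · simp [E]
    · rintro (_ | v | v | v) hv
      · exact ⟨fun _ => rfl, by simp⟩
      · exact ⟨fun _ => rfl, by simp⟩
      · exact ⟨fun _ => rfl, by simp⟩
      · simp [g0, g1] at hv
        simp [l_cache, hv, hred]
    · have h13 : s.l (.cache _) = _ := g1 ▸ h11
      simp [l_cache, hred, num] at h13
      simp [g0, g1, l_cache, num, h10, h13]

theorem ev_cachePrev_fail (hred : s.red = some p) (hp : s.c ≤ p + 1) :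
    Ev cachePrev s.toA 1 .fail := by
  refine Ev.call_fail ?_ ?_
  · rintro _ ⟨x, y, rfl⟩
    exact mkRule_K (by simp)
  · rintro _ ⟨x, y, rfl⟩ g wf hm
    obtain ⟨-, h5, h6⟩ := hm.elim (by simp)
    simp at h5
    simp [Edge.map_std] at h6
    obtain ⟨⟨-, h7, h8⟩, -⟩ := h5
    obtain ⟨j, g0, h9, h10⟩ := root_red h8 h7
    obtain rfl : p = j := by simpa [hred] using h9
    simp only [g0, eRight_cache_mem] at h6
    omega

-- Erasing and lengthening the cache

theorem ev_cInit (hq : s.q = M.q₀) (hg : s.grey = false) (hpa : s.pa = .empty)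
    (hred : s.red = none) :
    Ev (cInit M) s.toA 1
      (.done {s with red := some s.hd, dig := Function.update s.dig s.hd 2}.toA) := by
  refine Ev.call ?_ ?_ ?_
  · rintro _ ⟨x, rfl⟩
    exact mkRule_K (by simp)
  · intro wf
    have h1 := wf.edge_mem (eHead .center (.cache s.hd)) (by simp [hpa])
    simp only [eHead, toA_V, center_mem_V, cache_mem_V, true_and] at h1
    refine ⟨_, ⟨s.dig s.hd, rfl⟩, asg [.center, .cache s.hd],
      .intro (by simp) (by simp) ?_ (by simp) (by simp [Edge.map_std, hpa])⟩
    simp [l_center, hg, num, l_cache, hred, h1, hq]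
  · rintro _ ⟨x, rfl⟩ g wf hm
    obtain ⟨-, h5, h6⟩ := hm.elim (by simp)
    simp at h5
    simp [Edge.map_std] at h6
    obtain ⟨⟨-, h7, h8⟩, ⟨-, h9, h10⟩⟩ := h5
    obtain ⟨g0, h11, h12⟩ := root_num h8 h7
    simp only [g0, eHead_mem] at h6
    obtain ⟨g1, -⟩ := h6
    refine AGraph.Result.intro_same (by simp) (by simp) rfl ?_ ?_ ?_
    · simp [E]
    · rintro (_ | v | v | v) hv
      · exact ⟨fun _ => rfl, by simp⟩
      · exact ⟨fun _ => rfl, by simp⟩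
      · exact ⟨fun _ => rfl, by simp⟩
      · simp [g0, g1] at hv
        simp [l_cache, hv, hred, Function.update_of_ne (Ne.symm hv)]
    · simp [g0, g1, l_cache, l_center, num, h11, h12]

theorem ev_erase (hred : s.red = some p) (hd : s.dig p = 2) (hp : p + 1 < s.c) :
    Ev erase s.toA 1
      (.done {s with red := some (p + 1), dig := Function.update s.dig (p + 1) 2}.toA) := by
  refine Ev.call ?_ ?_ ?_
  · rintro _ ⟨x, rfl⟩
    exact mkRule_K (by simp)
  · intro wf
    refine ⟨_, ⟨s.dig (p + 1), rfl⟩, asg [.cache p, .cache (p + 1)],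
      .intro (by simp) (by simp) ?_ (by simp) ?_⟩
    · simp [num, l_cache, hred, hp, hd]
      omega
    · simp [Edge.map_std, hp]
  · rintro _ ⟨x, rfl⟩ g wf hm
    obtain ⟨-, h5, h6⟩ := hm.elim (by simp)
    simp at h5
    simp [Edge.map_std] at h6
    obtain ⟨⟨-, h7, h8⟩, -, h11, h12⟩ := h5
    obtain ⟨j, g0, h9, h10⟩ := root_red h8 h7
    obtain rfl : p = j := by simpa [hred] using h9
    simp only [g0, eRight_cache_mem] at h6
    obtain ⟨g1, -⟩ := h6
    refine AGraph.Result.intro_same (by simp) (by simp) rfl ?_ ?_ ?_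
    · simp [E]
    · rintro (_ | v | v | v) hv
      · exact ⟨fun _ => rfl, by simp⟩
      · exact ⟨fun _ => rfl, by simp⟩
      · exact ⟨fun _ => rfl, by simp⟩
      · simp [g0, g1] at hv
        simp [l_cache, hv, hred, Function.update_of_ne (Ne.symm hv.2)]
    · simp [g0, g1, l_cache, num, hd]

theorem ev_erase_fail (hred : s.red = some p) (hp : s.c ≤ p + 1) : Ev erase s.toA 1 .fail := by
  refine Ev.call_fail ?_ ?_
  · rintro _ ⟨x, rfl⟩
    exact mkRule_K (by simp)
  · rintro _ ⟨x, rfl⟩ g wf hm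
    obtain ⟨-, h5, h6⟩ := hm.elim (by simp)
    simp at h5
    simp [Edge.map_std] at h6
    obtain ⟨⟨-, h7, h8⟩, -⟩ := h5
    obtain ⟨j, g0, h9, h10⟩ := root_red h8 h7
    obtain rfl : p = j := by simpa [hred] using h9
    simp only [g0, eRight_cache_mem] at h6
    omega

theorem ev_endCache (hq : s.q = M.q₀) (hg : s.grey = false) (hred : s.red = some p)
    (hd : s.dig p = 2) (hp : p + 1 = s.c) :
    Ev (endCache M) s.toA 1
      (.done {s with red := none, dig := Function.update s.dig s.c 2, c := s.c + 1}.toA) := by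
  have hc : s.c - 1 = p := by omega
  refine Ev.call ?_ ?_ ?_
  · rintro _ rfl
    exact mkRule_K (by simp)
  · intro wf
    refine ⟨_, rfl, asg [.center, .cache p], .intro (by simp) (by simp) ?_ (by simp) ?_⟩
    · simp [l_center, hg, num, l_cache, hred, hq, hd]
      omega
    · simp [Edge.map_std, hc]
  · rintro _ rfl g wf hm
    obtain ⟨-, h5, h6⟩ := hm.elim (by simp)
    simp at h5
    simp [Edge.map_std] at h6
    obtain ⟨⟨-, h7, h8⟩, ⟨-, h9, h10⟩⟩ := h5
    obtain ⟨g0, h11, h12⟩ := root_num h8 h7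
    simp only [g0, eRight_center_mem, hc] at h6
    refine ⟨asg [.center, .cache p, .cache (p + 1)],
      AGraph.Result.intro (by simp) (by simp [g0, h6]) [2] ?_ (by simp) ?_ ?_ ?_ ?_ ?_⟩
    · simp
      omega
    · simp [hp]
    · ext (_ | v | v | v) <;> simp
      omega
    · have hr : Finset.range s.c = insert p (Finset.range (s.c - 1)) := by
        rw [hc, ← hp, Finset.range_add_one]
      have hpn : p ∉ Finset.range (s.c - 1) := by simp [hc]
      simp only [toA_E, E, Nat.add_sub_cancel, hr, links_insert hpn, link, List.map,
        List.cons_append, List.nil_append, List.sum_cons, List.sum_nil, Edge.map_std, g0, h6]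
      simp only [← hp, asg, List.getD_cons_zero, List.getD_cons_succ]
      abel
    · rintro (_ | v | v | v) hv
      · exact ⟨fun _ => rfl, by simp⟩
      · exact ⟨fun _ => rfl, by simp⟩
      · exact ⟨fun _ => rfl, by simp⟩
      · simp at hv
        simp [l_cache, hv, hred, ← hp, Function.update_of_ne (Ne.symm hv.2)]
    · simp [l_cache, l_center, num, h11, h12, hp]
      rw [← hp]
      simp [hd]

end St

namespace St

variable {M : OfflineTM} {s : St} {i v : ℕ}

attribute [local simp] rt nd asg

/-! ### The blue root among the block nodes -/

/-- There is no root among the block nodes except possibly an unlabelled blue one. -/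
structure OnlyBlue (s : St) : Prop where
  one : s.one = none
  two : s.two = none
  pl : s.pl = none

theorem ev_encodeInit (hq : s.q ∈ M.Q) (hg : s.grey = false) (hb : s.blue = none)
    (ho : s.OnlyBlue) : Ev (encodeInit M) s.toA 1 (.done {s with blue := some 0}.toA) := by
  refine Ev.call ?_ ?_ ?_
  · rintro _ ⟨q, rfl⟩
    exact mkRule_K (by simp)
  · intro wf
    have h5 := wf.edge_mem (eLeft .center (.block 0)) (by simp)
    simp only [eLeft, toA_V, center_mem_V, block_mem_V, true_and] at h5
    refine ⟨_, ⟨⟨s.q, hq⟩, rfl⟩, asg [.center, .block 0], .intro (by simp) (by simp) ?_ (by simp)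
      (by simp [Edge.map_std])⟩
    simp [l_center, hg, num, l_block, ho.one, ho.two, ho.pl, h5, hb]
  · rintro _ ⟨q, rfl⟩ g wf hm
    obtain ⟨-, h5, h6⟩ := hm.elim (by simp)
    simp at h5
    simp [Edge.map_std] at h6
    obtain ⟨⟨-, h7, h8⟩, -⟩ := h5
    obtain ⟨g0, h9, h10⟩ := root_num h8 h7
    simp only [g0, eLeft_center_mem] at h6
    refine AGraph.Result.intro_same (by simp) (by simp) rfl ?_ ?_ ?_
    · simp [E]
    · rintro (_ | k | k | k) hv
      · exact ⟨fun _ => rfl, by simp⟩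
      · exact ⟨fun _ => rfl, by simp⟩
      · simp [g0, h6] at hv
        simp [l_block, ho.one, ho.two, ho.pl, hb, hv]
      · exact ⟨fun _ => rfl, by simp⟩
    · simp [g0, h6, l_center, h9, h10, num, l_block, ho.one, ho.two, ho.pl]

theorem ev_decodeInit (hq : s.q ∈ M.Q) (hg : s.grey = false) (hb : s.blue = none)
    (ho : s.OnlyBlue) (ha : s.act ∈ s.dm) :
    Ev (decodeInit M) s.toA 1 (.done {s with blue := some (s.T s.act)}.toA) := by
  refine Ev.call ?_ ?_ ?_
  · rintro _ ⟨q, rfl | rfl⟩ <;> exact mkRule_K (by simp)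
  · intro wf
    have h5 := wf.edge_mem (eDash (.block s.act) (.block (s.T s.act))) (by simp [ha])
    simp only [eDash, toA_V, block_mem_V] at h5
    -- Matches are injective, so a dashed loop and a dashed edge between two nodes are matched by
    -- different rules.
    by_cases hT : s.act = s.T s.act
    · refine ⟨_, ⟨⟨s.q, hq⟩, .inr rfl⟩, asg [.center, .block s.act], .intro (by simp) (by simp) ?_
        (by simp [Edge.map, eDash]) ?_⟩
      · simp [l_center, hg, num, l_block, ho.one, ho.two, ho.pl, h5, hb]
      · simpa [Edge.map_std, ha] using hT
    · refine ⟨_, ⟨⟨s.q, hq⟩, .inl rfl⟩, asg [.center, .block s.act, .block (s.T s.act)],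
        .intro (by simp) (by simpa using hT) ?_ (by simp [Edge.map, eDash]) ?_⟩
      · simp [l_center, hg, num, l_block, ho.one, ho.two, ho.pl, h5, hb]
      · simp [Edge.map_std, ha]
  · have key : ∀ k, k ≠ s.T s.act →
        ({s with blue := some (s.T s.act)} : St).l (.block k) = s.l (.block k) ∧
        (Node.block k ∈ ({s with blue := some (s.T s.act)} : St).P ↔ Node.block k ∈ s.P) := by
      intro k hk
      simp [l_block, ho.one, ho.two, ho.pl, hb, Ne.symm hk]
    rintro _ ⟨q, rfl | rfl⟩ g wf hm
    · obtain ⟨h4, h5, h6⟩ := hm.elim (by simp)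
      simp at h4 h5
      simp [Edge.map_std] at h6
      obtain ⟨⟨-, h7, h8⟩, -⟩ := h5
      obtain ⟨g0, h9, h10⟩ := root_num h8 h7
      simp only [g0, eDash_center_mem] at h6
      obtain ⟨g1, h6⟩ := h6
      simp only [g1, eDash_block_mem] at h6
      obtain ⟨g2, -⟩ := h6
      simp [g1, g2] at h4
      refine AGraph.Result.intro_same (by simp) (by simp) rfl ?_ ?_ ?_
      · simp [E]
      · rintro (_ | k | k | k) hv
        · exact ⟨fun _ => rfl, by simp⟩
        · exact ⟨fun _ => rfl, by simp⟩
        · simp [g0, g1, g2] at hv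
          exact ⟨fun _ => (key k (Ne.symm hv.2)).1, (key k (Ne.symm hv.2)).2⟩
        · exact ⟨fun _ => rfl, by simp⟩
      · have := Ne.symm h4.2
        simp [g0, g1, g2, l_center, h9, h10, num, l_block, ho.one, ho.two, ho.pl, this]
    · obtain ⟨h4, h5, h6⟩ := hm.elim (by simp)
      simp at h4 h5
      simp [Edge.map_std] at h6
      obtain ⟨⟨-, h7, h8⟩, -⟩ := h5
      obtain ⟨g0, h9, h10⟩ := root_num h8 h7
      simp only [g0, eDash_center_mem] at h6
      obtain ⟨g1, h6⟩ := h6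
      simp [g1] at h6
      refine AGraph.Result.intro_same (by simp) (by simp) rfl ?_ ?_ ?_
      · simp [E]
      · rintro (_ | k | k | k) hv
        · exact ⟨fun _ => rfl, by simp⟩
        · exact ⟨fun _ => rfl, by simp⟩
        · simp [g0, g1] at hv
          have hv : k ≠ s.T s.act := by omega
          exact ⟨fun _ => (key k hv).1, (key k hv).2⟩
        · exact ⟨fun _ => rfl, by simp⟩
      · simp [g0, g1, l_center, h9, h10, num, l_block, ho.one, ho.two, ho.pl, ← h6.1]

theorem ev_nextValue (hb : s.blue = some i) (ho : s.OnlyBlue) (hi : i ∈ s.lk) :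
    Ev nextValue s.toA 1 (.done {s with blue := some (i + 1)}.toA) := by
  refine Ev.call ?_ ?_ ?_
  · rintro _ rfl
    exact mkRule_K (by simp)
  · intro wf
    have h5 := wf.edge_mem (eRight (.block i) (.block (i + 1))) (by simp [hi])
    simp only [eRight, toA_V, block_mem_V] at h5
    refine ⟨_, rfl, asg [.block i, .block (i + 1)], .intro (by simp) (by simp) ?_ (by simp)
      (by simp [Edge.map_std, hi])⟩
    simp [l_block, ho.one, ho.two, ho.pl, h5, hb]
  · rintro _ rfl g wf hm
    obtain ⟨-, h5, h6⟩ := hm.elim (by simp)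
    simp at h5
    simp [Edge.map_std] at h6
    obtain ⟨⟨-, h7, h8⟩, -⟩ := h5
    obtain ⟨j, g0, h9⟩ := root_blue h8 h7
    obtain rfl : i = j := by simpa [hb] using h9
    simp only [g0, eRight_block_mem] at h6
    obtain ⟨g1, -⟩ := h6
    refine AGraph.Result.intro_same (by simp) (by simp) rfl ?_ ?_ ?_
    · simp [E]
    · rintro (_ | k | k | k) hv
      · exact ⟨fun _ => rfl, by simp⟩
      · exact ⟨fun _ => rfl, by simp⟩
      · simp [g0, g1] at hv
        simp [l_block, ho.one, ho.two, ho.pl, hb, hv]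
      · exact ⟨fun _ => rfl, by simp⟩
    · simp [g0, g1, l_block, ho.one, ho.two, ho.pl]

theorem ev_prevValue (hb : s.blue = some (i + 1)) (ho : s.OnlyBlue) (hi : i ∈ s.lk) :
    Ev prevValue s.toA 1 (.done {s with blue := some i}.toA) := by
  refine Ev.call ?_ ?_ ?_
  · rintro _ rfl
    exact mkRule_K (by simp)
  · intro wf
    have h5 := wf.edge_mem (eRight (.block i) (.block (i + 1))) (by simp [hi])
    simp only [eRight, toA_V, block_mem_V] at h5
    refine ⟨_, rfl, asg [.block (i + 1), .block i], .intro (by simp) (by simp) ?_ (by simp)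
      (by simp [Edge.map_std, hi])⟩
    simp [l_block, ho.one, ho.two, ho.pl, h5, hb]
  · rintro _ rfl g wf hm
    obtain ⟨-, h5, h6⟩ := hm.elim (by simp)
    simp at h5
    simp [Edge.map_std] at h6
    obtain ⟨⟨-, h7, h8⟩, -⟩ := h5
    obtain ⟨j, g0, h9⟩ := root_blue h8 h7
    obtain rfl : i + 1 = j := by simpa [hb] using h9
    simp only [g0, eLeft_block_mem] at h6
    obtain ⟨j, e1, g1, -⟩ := h6
    obtain rfl : i = j := by omega
    refine AGraph.Result.intro_same (by simp) (by simp) rfl ?_ ?_ ?_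
    · simp [E]
    · rintro (_ | k | k | k) hv
      · exact ⟨fun _ => rfl, by simp⟩
      · exact ⟨fun _ => rfl, by simp⟩
      · simp [g0, g1] at hv
        simp [l_block, ho.one, ho.two, ho.pl, hb, hv]
      · exact ⟨fun _ => rfl, by simp⟩
    · simp [g0, g1, l_block, ho.one, ho.two, ho.pl]

theorem ev_prevValue_fail (hb : s.blue = some 0) : Ev prevValue s.toA 1 .fail := by
  refine Ev.call_fail ?_ ?_
  · rintro _ rfl
    exact mkRule_K (by simp)
  · rintro _ rfl g wf hm
    obtain ⟨-, h5, h6⟩ := hm.elim (by simp)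
    simp at h5
    simp [Edge.map_std] at h6
    obtain ⟨⟨-, h7, h8⟩, -⟩ := h5
    obtain ⟨j, g0, h9⟩ := root_blue h8 h7
    obtain rfl : 0 = j := by simpa [hb] using h9
    simp only [g0, eLeft_block_mem] at h6
    obtain ⟨j, e1, -⟩ := h6
    omega

theorem ev_update (hq : s.q ∈ M.Q) (hg : s.grey = false) (hb : s.blue = some v)
    (ho : s.OnlyBlue) (ha : s.act ∈ s.dm) :
    Ev (update M) s.toA 1
      (.done {s with blue := none, T := Function.update s.T s.act v}.toA) := by
  -- All five rules have this one effect on the edges; they differ only in which nodes coincide.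
  have hE : ({s with blue := none, T := Function.update s.T s.act v} : St).E +
      {eDash (.block s.act) (.block (s.T s.act))} = s.E + {eDash (.block s.act) (.block v)} := by
    simp only [E, dashes_update ha, dashes_erase ha]
    abel
  have key : ∀ k, (∀ x : Node, x = .block v → x ≠ k) →
      (({s with blue := none, T := Function.update s.T s.act v} : St).l k = s.l k) ∧
      (k ∈ ({s with blue := none, T := Function.update s.T s.act v} : St).P ↔ k ∈ s.P) := by
    rintro (_ | k | k | k) hk
    · exact ⟨rfl, by simp⟩
    · exact ⟨rfl, by simp⟩
    · have hk := hk _ rfl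
      simp at hk
      simp [l_block, ho.one, ho.two, ho.pl, hb, hk]
    · exact ⟨rfl, by simp⟩
  refine Ev.call ?_ ?_ ?_
  · rintro _ ⟨q, rfl | rfl | rfl | rfl | rfl⟩ <;> exact mkRule_K (by simp)
  · intro wf
    have h5 := wf.edge_mem (eDash (.block s.act) (.block (s.T s.act))) (by simp [ha])
    simp only [eDash, toA_V, block_mem_V] at h5
    have h6 := wf.root_mem (.block v) (by simp [hb])
    simp only [toA_V, block_mem_V] at h6
    by_cases hT : s.T s.act = s.act
    · by_cases hv : v = s.act
      · refine ⟨_, ⟨⟨s.q, hq⟩, .inr (.inr (.inr (.inr rfl)))⟩, asg [.center, .block s.act],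
          .intro (by simp) (by simp) ?_ (by simp [Edge.map, eDash]) ?_⟩
        · simp [l_center, hg, num, l_block, ho.one, ho.two, ho.pl, h5, hb, hv]
        · simp [Edge.map_std, ha, hT]
      · refine ⟨_, ⟨⟨s.q, hq⟩, .inr (.inl rfl)⟩,
          asg [.center, .block s.act, .center, .block v],
          .intro (by simp) (by simpa using Ne.symm hv) ?_ (by simp [Edge.map, eDash]) ?_⟩
        · simp [l_center, hg, num, l_block, ho.one, ho.two, ho.pl, h5, h6, hb, hv]
        · simp [Edge.map_std, ha, hT]
    · by_cases hv : v = s.act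
      · refine ⟨_, ⟨⟨s.q, hq⟩, .inr (.inr (.inr (.inl rfl)))⟩,
          asg [.center, .block s.act, .block (s.T s.act)],
          .intro (by simp) (by simpa using Ne.symm hT) ?_ (by simp [Edge.map, eDash]) ?_⟩
        · simp [l_center, hg, num, l_block, ho.one, ho.two, ho.pl, h5, hb, hv, Ne.symm hT]
        · simp [Edge.map_std, ha]
      · by_cases hvT : v = s.T s.act
        · refine ⟨_, ⟨⟨s.q, hq⟩, .inr (.inr (.inl rfl))⟩,
            asg [.center, .block s.act, .block (s.T s.act)],
            .intro (by simp) (by simpa using Ne.symm hT) ?_ (by simp [Edge.map, eDash]) ?_⟩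
          · simp [l_center, hg, num, l_block, ho.one, ho.two, ho.pl, h5, hb, hvT, hT]
          · simp [Edge.map_std, ha]
        · refine ⟨_, ⟨⟨s.q, hq⟩, .inl rfl⟩,
            asg [.center, .block s.act, .block (s.T s.act), .block v],
            .intro (by simp) ?_ ?_ (by simp [Edge.map, eDash]) ?_⟩
          · simp [Ne.symm hT, Ne.symm hv, Ne.symm hvT]
          · simp [l_center, hg, num, l_block, ho.one, ho.two, ho.pl, h5, h6, hb, hvT, hv]
          · simp [Edge.map_std, ha]
  · have hE' : ∀ u t x y : Node, u = .block s.act → t = .block (s.T s.act) → x = .block v →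
        ({s with blue := none, T := Function.update s.T s.act v} : St).E +
        ({eDash y u} + ({eDash u t} + 0)) = s.E + ({eDash y u} + ({eDash u x} + 0)) := by
      rintro _ _ _ y rfl rfl rfl
      rw [add_zero, add_zero, add_left_comm, hE, add_left_comm]
    rintro _ ⟨q, hr⟩ g wf hm
    rcases hr with rfl | rfl | rfl | rfl | rfl
    all_goals
      obtain ⟨-, h5, h6⟩ := hm.elim (by simp)
      simp at h5
      simp [Edge.map_std] at h6
      obtain ⟨⟨-, h7, h8⟩, h5⟩ := h5
      obtain ⟨g0, h9, h10⟩ := root_num h8 h7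
      simp only [g0, eDash_center_mem] at h6
      obtain ⟨g1, h6⟩ := h6
      simp only [g1, eDash_block_mem] at h6
      obtain ⟨h6, -⟩ := h6
    · obtain ⟨-, -, -, h11, h12⟩ := h5
      obtain ⟨j, g3, h13⟩ := root_blue h12 h11
      obtain rfl : v = j := by simpa [hb] using h13
      refine AGraph.Result.intro_same (by simp) (by simp) rfl ?_ ?_ ?_
      · exact hE' _ _ _ _ g1 h6 g3
      · intro k hk
        have := key k fun x hx => by
          have := hk (nd 3 (emp .plain)) (by simp)
          simpa [hx, g3] using this
        exact ⟨fun _ => this.1, this.2⟩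
      · simp [g0, g1, h6, g3, l_center, num, h9, h10, l_block, ho.one, ho.two, ho.pl]
    · obtain ⟨-, -, h11, h12⟩ := h5
      obtain ⟨j, g3, h13⟩ := root_blue h12 h11
      obtain rfl : v = j := by simpa [hb] using h13
      refine AGraph.Result.intro_same (by simp) (by simp) rfl ?_ ?_ ?_
      · exact hE' _ _ _ _ g1 (g1.trans h6) g3
      · intro k hk
        have := key k fun x hx => by
          have := hk (nd 3 (emp .plain)) (by simp)
          simpa [hx, g3] using this
        exact ⟨fun _ => this.1, this.2⟩
      · simp [g0, g1, g3, l_center, num, h9, h10, l_block, ho.one, ho.two, ho.pl]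
    · obtain ⟨-, -, h11, h12⟩ := h5
      obtain ⟨j, g3, h13⟩ := root_blue h12 h11
      obtain rfl : v = j := by simpa [hb] using h13
      refine AGraph.Result.intro_same (by simp) (by simp) rfl ?_ ?_ ?_
      · exact hE' _ _ _ _ g1 h6 g3
      · intro k hk
        have := key k fun x hx => by
          have := hk (nd 2 (emp .plain)) (by simp)
          simpa [hx, g3] using this
        exact ⟨fun _ => this.1, this.2⟩
      · simp [g0, g1, g3, l_center, num, h9, h10, l_block, ho.one, ho.two, ho.pl]
    · obtain ⟨⟨-, h11, h12⟩, -⟩ := h5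
      obtain ⟨j, g3, h13⟩ := root_blue h12 h11
      obtain rfl : v = j := by simpa [hb] using h13
      refine AGraph.Result.intro_same (by simp) (by simp) rfl ?_ ?_ ?_
      · exact hE' _ _ _ _ g1 h6 g3
      · intro k hk
        have := key k fun x hx => by
          have := hk (nd 1 (emp .plain)) (by simp)
          simpa [hx, g3] using this
        exact ⟨fun _ => this.1, this.2⟩
      · simp [g0, g1, h6, l_center, num, h9, h10, l_block, ho.one, ho.two, ho.pl]
    · obtain ⟨-, h11, h12⟩ := h5
      obtain ⟨j, g3, h13⟩ := root_blue h12 h11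
      obtain rfl : v = j := by simpa [hb] using h13
      refine AGraph.Result.intro_same (by simp) (by simp) rfl ?_ ?_ ?_
      · exact hE' _ _ _ _ g1 (g1.trans h6) g3
      · intro k hk
        have := key k fun x hx => by
          have := hk (nd 1 (emp .plain)) (by simp)
          simpa [hx, g3] using this
        exact ⟨fun _ => this.1, this.2⟩
      · simp [g0, g1, l_center, num, h9, h10, l_block, ho.one, ho.two, ho.pl]

end St

namespace St

variable {M : OfflineTM} {s : St} {i v : ℕ}

attribute [local simp] rt nd asg

/-! ### Transitions -/

theorem l_input_of_getElem? {a : Fin 2} (h : s.w[i]? = some a) : s.l (.input i) = num a.val := by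
  simp [l_input, List.getD_eq_getElem?_getD, h]

theorem getElem?_of_l_input {a : Fin 2} (h : s.l (.input i) = num a.val) (hi : i < s.w.length) :
    s.w[i]? = some a := by
  simp [l_input, num, List.getD_eq_getElem?_getD, hi, Fin.val_inj] at h
  simp [hi, h]

theorem transitions_K {r : Rule} (hr : ∃ q a x p y Y,
    (M.δ q a x = some (p, y, .S, Y) ∧ r = transStay M q a x p y Y) ∨
    (M.δ q a x = some (p, y, .L, Y) ∧ ∃ b, r = transLeft M q a x p y Y b) ∨
    (M.δ q a x = some (p, y, .R, Y) ∧ ∃ b, r = transRight M q a x p y Y b)) : r.K = r.L.V := by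
  obtain ⟨q, a, x, p, y, Y, ⟨-, rfl⟩ | ⟨-, b, rfl⟩ | ⟨-, b, rfl⟩⟩ := hr <;>
    exact mkRule_K (by simp)

theorem ev_transitions {q p : M.Q} {a : Fin 2} {y : Fin 3} {D₁ D₂ : Dir} (hq : s.q = q)
    (hg : s.grey = false) (hpa : s.pa = .empty) (hred : s.red = none) (hw : s.w[s.inp]? = some a)
    (hδ : M.δ q a (s.dig s.hd) = some (p, y, D₁, D₂)) (hD : D₁.move s.inp = some i)
    (hi : i < s.w.length) :
    Ev (transitions M) s.toA 1 (.done
      {s with q := p, dig := Function.update s.dig s.hd y, inp := i, pa := D₂.atom}.toA) := by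
  have hwi : s.inp < s.w.length := (List.getElem?_eq_some_iff.1 hw).1
  refine Ev.call (fun _ => transitions_K) ?_ ?_
  · intro wf
    have h1 := wf.edge_mem (eHead .center (.cache s.hd)) (by simp [hpa])
    simp only [eHead, toA_V, center_mem_V, cache_mem_V, true_and] at h1
    have hlb : s.l (.input i) = num (s.w[i].val) := l_input_of_getElem? (by simp [hi])
    cases D₁ with
    | S =>
      refine ⟨_, ⟨q, a, _, p, y, D₂, .inl ⟨hδ, rfl⟩⟩, asg [.center, .input s.inp, .cache s.hd],
        .intro (by simp) (by simp) ?_ (by simp [Edge.map, eIn, eHead, emp])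
          (by simp [Edge.map_std, hpa])⟩
      simp [l_center, l_cache, l_input_of_getElem? hw, hg, hq, hred, hwi, h1, num]
    | L =>
      obtain ⟨j, hj⟩ : ∃ j, s.inp = j + 1 := by
        refine Nat.exists_eq_succ_of_ne_zero fun h => ?_
        simp [h, Dir.move] at hD
      obtain rfl : j = i := by simpa [hj, Dir.move] using hD
      refine ⟨_, ⟨q, a, _, p, y, D₂, .inr (.inl ⟨hδ, s.w[j], rfl⟩)⟩,
        asg [.center, .input (j + 1), .cache s.hd, .input j],
        .intro (by simp) (by simp) ?_ (by simp [Edge.map, eIn, eHead, eLeft, emp])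
          (by simp [Edge.map_std, hpa, hj]; omega)⟩
      rw [hj] at hw
      simp [l_center, l_cache, l_input_of_getElem? hw, hlb, hg, hq, hred, hi, h1, num]
      omega
    | R =>
      obtain rfl : s.inp + 1 = i := by simpa [Dir.move] using hD
      refine ⟨_, ⟨q, a, _, p, y, D₂, .inr (.inr ⟨hδ, s.w[s.inp + 1], rfl⟩)⟩,
        asg [.center, .input s.inp, .cache s.hd, .input (s.inp + 1)],
        .intro (by simp) (by simp) ?_ (by simp [Edge.map, eIn, eHead, eRight, emp])
          (by simp [Edge.map_std, hpa]; omega)⟩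
      simp [l_center, l_cache, l_input_of_getElem? hw, hlb, hg, hq, hred, hwi, hi, h1, num]
  · have key : ∀ {q' : M.Q} {a' : Fin 2} {x' : Fin 3} {p' : M.Q} {y' : Fin 3} {D₁' D₂' : Dir},
        s.q = q' → s.l (.input s.inp) = num a'.val → s.l (.cache s.hd) = num x'.val →
        M.δ q' a' x' = some (p', y', D₁', D₂') → p' = p ∧ y' = y ∧ D₁' = D₁ ∧ D₂' = D₂ := by
      intro q' a' x' p' y' D₁' D₂' h1 h2 h3 h4
      obtain rfl : q = q' := Subtype.ext (hq.symm.trans h1)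
      have h2 := getElem?_of_l_input h2 hwi
      obtain rfl : a = a' := by simpa [hw] using h2
      obtain rfl : s.dig s.hd = x' := by simpa [l_cache, num, hred, Fin.val_inj] using h3
      rw [hδ] at h4
      simp only [Option.some.injEq, Prod.mk.injEq] at h4
      simp [h4]
    have hl : ∀ k, (∀ x : Node, x = .center → x ≠ k) → (∀ x : Node, x = .cache s.hd → x ≠ k) →
        ({s with q := p, dig := Function.update s.dig s.hd y, inp := i, pa := D₂.atom} : St).l k =
          s.l k := by
      rintro (_ | k | k | k) h1 h2
      · exact absurd rfl (h1 _ rfl)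
      · rfl
      · rfl
      · have := h2 _ rfl
        simp at this
        simp [l_cache, Function.update_of_ne (Ne.symm this)]
    rintro _ ⟨q', a', x', p', y', Y', ⟨h1, rfl⟩ | ⟨h1, b, rfl⟩ | ⟨h1, b, rfl⟩⟩ g wf hm
    · obtain ⟨-, h5, h6⟩ := hm.elim (by simp)
      simp at h5
      simp [Edge.map_std] at h6
      obtain ⟨⟨-, h7, h8⟩, ⟨-, h9, h10⟩, -, h11, h12⟩ := h5
      obtain ⟨g0, h13, h14⟩ := root_num h8 h7
      simp only [g0, eIn_mem, eHead_mem] at h6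
      obtain ⟨g1, g2, -⟩ := h6
      rw [g1] at h9
      rw [g2] at h11
      obtain ⟨rfl, rfl, rfl, rfl⟩ := key h13 h9 h11 h1
      obtain rfl : s.inp = i := by simpa [Dir.move] using hD
      refine AGraph.Result.intro_same (by simp) (by simp) rfl ?_ ?_ ?_
      · simp only [toA_E, E, List.map, List.sum_cons, List.sum_nil, Edge.map_std, g0, g1, g2, hpa]
        abel
      · intro k hk
        exact ⟨fun _ => hl k (fun x hx => by have := hk (rt 0 (num p')) (by simp); simpa [hx, g0])
          (fun x hx => by have := hk (nd 2 (num y'.val)) (by simp); simpa [hx, g2]), Iff.rfl⟩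
      · rw [l_input] at h9
        simp [g0, g1, g2, l_center, l_input, l_cache, num, hg, hred] at h9 ⊢
        exact h9
    · obtain ⟨-, h5, h6⟩ := hm.elim (by simp)
      simp at h5
      simp [Edge.map_std] at h6
      obtain ⟨⟨-, h7, h8⟩, ⟨-, h9, h10⟩, ⟨-, h11, h12⟩, -, h15, h16⟩ := h5
      obtain ⟨g0, h13, h14⟩ := root_num h8 h7
      simp only [g0, eIn_mem, eHead_mem] at h6
      obtain ⟨g1, h6, g2, -⟩ := h6
      rw [g1] at h9
      rw [g2] at h11
      obtain ⟨rfl, rfl, rfl, rfl⟩ := key h13 h9 h11 h1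
      simp only [g1, eLeft_input_mem] at h6
      obtain ⟨j, hj, g3, -⟩ := h6
      obtain rfl : j = i := by simpa [hj, Dir.move] using hD
      refine AGraph.Result.intro_same (by simp) (by simp) rfl ?_ ?_ ?_
      · simp only [toA_E, E, List.map, List.sum_cons, List.sum_nil, Edge.map_std, g0, g1, g2, g3,
          hpa]
        abel
      · intro k hk
        exact ⟨fun _ => hl k (fun x hx => by have := hk (rt 0 (num p')) (by simp); simpa [hx, g0])
          (fun x hx => by have := hk (nd 2 (num y'.val)) (by simp); simpa [hx, g2]), Iff.rfl⟩
      · rw [g3] at h15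
        rw [l_input] at h9 h15
        simp [g0, g1, g2, g3, l_center, l_input, l_cache, num, hg, hred] at h9 h15 ⊢
        exact ⟨h9, h15⟩
    · obtain ⟨-, h5, h6⟩ := hm.elim (by simp)
      simp at h5
      simp [Edge.map_std] at h6
      obtain ⟨⟨-, h7, h8⟩, ⟨-, h9, h10⟩, ⟨-, h11, h12⟩, -, h15, h16⟩ := h5
      obtain ⟨g0, h13, h14⟩ := root_num h8 h7
      simp only [g0, eIn_mem, eHead_mem] at h6
      obtain ⟨g1, h6, g2, -⟩ := h6
      rw [g1] at h9
      rw [g2] at h11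
      obtain ⟨rfl, rfl, rfl, rfl⟩ := key h13 h9 h11 h1
      simp only [g1, eRight_input_mem] at h6
      obtain ⟨g3, -⟩ := h6
      obtain rfl : s.inp + 1 = i := by simpa [Dir.move] using hD
      refine AGraph.Result.intro_same (by simp) (by simp) rfl ?_ ?_ ?_
      · simp only [toA_E, E, List.map, List.sum_cons, List.sum_nil, Edge.map_std, g0, g1, g2, g3,
          hpa]
        abel
      · intro k hk
        exact ⟨fun _ => hl k (fun x hx => by have := hk (rt 0 (num p')) (by simp); simpa [hx, g0])
          (fun x hx => by have := hk (nd 2 (num y'.val)) (by simp); simpa [hx, g2]), Iff.rfl⟩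
      · rw [g3] at h15
        rw [l_input] at h9 h15
        simp [g0, g1, g2, g3, l_center, l_input, l_cache, num, hg, hred] at h9 h15 ⊢
        exact ⟨h9, h15⟩

/-- Besides undefined entries, this covers an input head that would leave its tape: there is no
neighbouring input node to match. A working head leaving its tape is not noticed here, but only by
`prev`. -/
theorem ev_transitions_fail {q : M.Q} (hq : s.q = q) (hred : s.red = none)
    (h : ∀ a p y D₁ D₂ i, s.w[s.inp]? = some a → M.δ q a (s.dig s.hd) = some (p, y, D₁, D₂) →
      D₁.move s.inp = some i → s.w.length ≤ i) : Ev (transitions M) s.toA 1 .fail := by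
  refine Ev.call_fail (fun _ => transitions_K) ?_
  have key : ∀ {q' : M.Q} {a' : Fin 2} {x' : Fin 3} {p' : M.Q} {y' : Fin 3} {D₁' D₂' : Dir},
      s.q = q' → s.l (.input s.inp) = num a'.val → s.l (.cache s.hd) = num x'.val →
      M.δ q' a' x' = some (p', y', D₁', D₂') → s.inp < s.w.length →
      ∀ i, D₁'.move s.inp = some i → s.w.length ≤ i := by
    intro q' a' x' p' y' D₁' D₂' h1 h2 h3 h4 hwi
    obtain rfl : q = q' := Subtype.ext (hq.symm.trans h1)
    have h2 := getElem?_of_l_input h2 hwi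
    obtain rfl : s.dig s.hd = x' := by simpa [l_cache, num, hred, Fin.val_inj] using h3
    exact fun i => h _ _ _ _ _ _ h2 h4
  intro r hr g wf hm
  have hwi := (wf.edge_mem (eIn .center (.input s.inp)) (by simp)).2
  simp only [eIn, toA_V, input_mem_V] at hwi
  obtain ⟨q', a', x', p', y', Y', ⟨h1, rfl⟩ | ⟨h1, b, rfl⟩ | ⟨h1, b, rfl⟩⟩ := hr
  all_goals
    obtain ⟨-, h5, h6⟩ := hm.elim (by simp)
    simp at h5
    simp [Edge.map_std] at h6
    obtain ⟨⟨-, h7, h8⟩, ⟨-, h9, h10⟩, h11⟩ := h5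
    obtain ⟨g0, h13, h14⟩ := root_num h8 h7
    simp only [g0, eIn_mem, eHead_mem] at h6
  · obtain ⟨-, h11, -⟩ := h11
    obtain ⟨g1, g2, -⟩ := h6
    rw [g1] at h9
    rw [g2] at h11
    have := key h13 h9 h11 h1 hwi _ rfl
    omega
  · obtain ⟨⟨-, h11, -⟩, -⟩ := h11
    obtain ⟨g1, h6, g2, -⟩ := h6
    rw [g1] at h9 h6
    rw [g2] at h11
    simp only [eLeft_input_mem] at h6
    obtain ⟨j, hj, g3, -⟩ := h6
    have := key h13 h9 h11 h1 hwi j (by simp [hj, Dir.move])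
    omega
  · obtain ⟨⟨-, h11, -⟩, -⟩ := h11
    obtain ⟨g1, h6, g2, -⟩ := h6
    rw [g1] at h9 h6
    rw [g2] at h11
    simp only [eRight_input_mem] at h6
    have := key h13 h9 h11 h1 hwi _ rfl
    omega

/-! ### Rewinding and erasing the tapes -/

/-- If the head is on the first square already, both green edges have the same target and no
injective match exists; `try` then leaves the graph as it should be. -/
theorem ev_rewindInput (hq : s.q = M.q₀) (hg : s.grey = false) :
    Ev (tryDo (rewindInput M)) s.toA 1 (.done {s with inp := 0}.toA) := by
  by_cases h0 : s.inp = 0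
  · have hs : ({s with inp := 0} : St) = s := by rw [← h0]
    rw [hs]
    refine Ev.tryDo_fail (Ev.call_fail ?_ ?_)
    · rintro _ ⟨a, b, rfl⟩
      exact mkRule_K (by simp)
    · rintro _ ⟨a, b, rfl⟩ g wf hm
      obtain ⟨h4, h5, h6⟩ := hm.elim (by simp)
      simp at h4 h5
      simp [Edge.map_std] at h6
      obtain ⟨⟨-, h7, h8⟩, -⟩ := h5
      obtain ⟨g0, -⟩ := root_num h8 h7
      simp only [g0, eFirst_mem, eIn_mem] at h6
      simp [h6, h0] at h4
  · refine Ev.tryDo (Ev.call ?_ ?_ ?_)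
    · rintro _ ⟨a, b, rfl⟩
      exact mkRule_K (by simp)
    · intro wf
      have h1 := (wf.edge_mem (eIn .center (.input s.inp)) (by simp)).2
      simp only [eIn, toA_V, input_mem_V] at h1
      refine ⟨_, ⟨s.w.getD 0 0, s.w.getD s.inp 0, rfl⟩, asg [.center, .input 0, .input s.inp],
        .intro (by simp) (by simpa using Ne.symm h0) ?_ (by simp [Edge.map, eFirst, eIn, emp])
          (by simp [Edge.map_std])⟩
      simp [l_center, l_input, hq, hg, num, h1]
      omega
    · rintro _ ⟨a, b, rfl⟩ g wf hm
      obtain ⟨-, h5, h6⟩ := hm.elim (by simp)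
      simp at h5
      simp [Edge.map_std] at h6
      obtain ⟨⟨-, h7, h8⟩, ⟨-, h9, -⟩, -, h10, -⟩ := h5
      obtain ⟨g0, -⟩ := root_num h8 h7
      simp only [g0, eFirst_mem, eIn_mem] at h6
      obtain ⟨g1, g2⟩ := h6
      refine AGraph.Result.intro_same (by simp) (by simp) rfl ?_ ?_ ?_
      · simp only [toA_E, E, List.map, List.sum_cons, List.sum_nil, Edge.map_std, g0, g1, g2]
        abel
      · exact fun v hv => ⟨fun _ => rfl, Iff.rfl⟩
      · rw [g1, l_input] at h9
        rw [g2, l_input] at h10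
        simp only [List.forall_mem_cons, rt, nd, g0, g1, g2, toA_l, toA_P, l_center, l_input, h9,
          h10]
        simp [num, hq, hg]

/-- A restart begins with the last block active, so the case of block `0`, which has no injective
match, does not arise. -/
theorem ev_rewindBlockset (hq : s.q = M.q₀) (hg : s.grey = false) (hb : s.blue = none)
    (ho : s.OnlyBlue) (ha : s.act ≠ 0) :
    Ev (rewindBlockset M) s.toA 1 (.done {s with act := 0}.toA) := by
  refine Ev.call ?_ ?_ ?_
  · rintro _ rfl
    exact mkRule_K (by simp)
  · intro wf
    have h1 := (wf.edge_mem (eDash .center (.block s.act)) (by simp)).2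
    have h2 := (wf.edge_mem (eLeft .center (.block 0)) (by simp)).2
    simp only [eDash, eLeft, toA_V, block_mem_V] at h1 h2
    refine ⟨_, rfl, asg [.center, .block 0, .block s.act],
      .intro (by simp) (by simpa using Ne.symm ha) ?_ (by simp [Edge.map, eLeft, eDash, emp])
        (by simp [Edge.map_std])⟩
    simp [l_center, l_block, hb, ho.one, ho.two, ho.pl, hq, hg, num, h1, h2]
  · rintro _ rfl g wf hm
    obtain ⟨-, h5, h6⟩ := hm.elim (by simp)
    simp at h5
    simp [Edge.map_std] at h6
    obtain ⟨⟨-, h7, h8⟩, -⟩ := h5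
    obtain ⟨g0, -⟩ := root_num h8 h7
    simp only [g0, eLeft_center_mem, eDash_center_mem] at h6
    obtain ⟨g1, g2⟩ := h6
    refine AGraph.Result.intro_same (by simp) (by simp) rfl ?_ ?_ ?_
    · simp only [toA_E, E, List.map, List.sum_cons, List.sum_nil, Edge.map_std, g0, g1, g2]
      abel
    · exact fun v hv => ⟨fun _ => rfl, Iff.rfl⟩
    · simp [g0, g1, g2, l_center, l_block, num, hb, ho.one, ho.two, ho.pl, hq, hg]

end St

namespace St

variable {M : OfflineTM} {s : St} {i u v : ℕ}

attribute [local simp] rt nd asg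

/-! ### Extending the list of block nodes -/

/-- The indices of the two new nodes are free. They will be chosen so far apart that each copy can
grow into a range of its own. -/
theorem ev_bInit (hq : s.q = M.q₀) (hg : s.grey = false) (hb : s.blue = none) (ho : s.OnlyBlue)
    (ha : s.aux = none) (hu : u ∉ s.bV) (hv : v ∉ s.bV) (huv : u ≠ v) :
    Ev (bInit M) s.toA 1 (.done {s with
      blue := some 0, one := some u, two := some v, aux := some (u, v),
      bV := insert u (insert v s.bV)}.toA) := by
  refine Ev.call ?_ ?_ ?_
  · rintro _ rfl
    exact mkRule_K (by simp)
  · intro wf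
    have h5 := (wf.edge_mem (eLeft .center (.block 0)) (by simp)).2
    simp only [eLeft, toA_V, block_mem_V] at h5
    refine ⟨_, rfl, asg [.center, .block 0], .intro (by simp) (by simp) ?_ (by simp)
      (by simp [Edge.map_std])⟩
    simp [l_center, hg, hq, num, l_block, hb, ho.one, ho.two, ho.pl, h5]
  · rintro _ rfl g wf hm
    have hc := (wf.edge_mem (eLeft .center (.block 0)) (by simp)).2
    simp only [eLeft, toA_V, block_mem_V] at hc
    have hu0 : u ≠ 0 := fun h => hu (h ▸ hc)
    have hv0 : v ≠ 0 := fun h => hv (h ▸ hc)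
    obtain ⟨-, h5, h6⟩ := hm.elim (by simp)
    simp at h5
    simp [Edge.map_std] at h6
    obtain ⟨⟨-, h7, h8⟩, -⟩ := h5
    obtain ⟨g0, -⟩ := root_num h8 h7
    simp only [g0, eLeft_center_mem] at h6
    refine ⟨asg [.center, .block 0, .block u, .block v],
      AGraph.Result.intro (by simp) (by simp [g0, h6]) [2, 3] ?_ (by simpa using huv)
        (by simp [hu, hv]) ?_ ?_ ?_ ?_⟩
    · simp
      omega
    · ext (_ | k | k | k) <;> simp
    · simp only [toA_E, E, List.map, List.sum_cons, List.sum_nil, Edge.map_std, g0, h6, ha, auxE]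
      simp only [asg, List.getD_cons_zero, List.getD_cons_succ]
      abel
    · rintro (_ | k | k | k) hk
      · exact ⟨fun _ => rfl, by simp⟩
      · exact ⟨fun _ => rfl, by simp⟩
      · simp at hk
        simp [l_block, hk, hb, ho.one, ho.two, ho.pl]
      · exact ⟨fun _ => rfl, by simp⟩
    · simp [l_center, l_block, num, hq, hg, huv, hu0.symm, hv0.symm]

/-- The target of a proper dashed edge must be an unmarked node that is not a root; the assumptions
on `pl`, `one` and `two` ensure this. -/
theorem ev_undirect (hb : s.blue = some i) (hp : s.pl = none) (hi : i ∈ s.dm)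
    (h1 : s.one ≠ some (s.T i)) (h2 : s.two ≠ some (s.T i)) :
    Ev (tryDo undirect) s.toA 1 (.done {s with dm := s.dm.erase i}.toA) := by
  refine Ev.tryDo (Ev.call ?_ ?_ ?_)
  · rintro _ (rfl | rfl) <;> exact mkRule_K (by simp)
  · intro wf
    have h5 := wf.edge_mem (eDash (.block i) (.block (s.T i))) (by simp [hi])
    simp only [eDash, toA_V, block_mem_V] at h5
    by_cases hT : i = s.T i
    · refine ⟨_, .inr rfl, asg [.block i], .intro (by simp) (by simp) ?_ (by simp) ?_⟩
      · simp [l_block, hb, h5]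
      · simpa [Edge.map_std, hi] using hT
    · refine ⟨_, .inl rfl, asg [.block i, .block (s.T i)],
        .intro (by simp) (by simpa using hT) ?_ (by simp) ?_⟩
      · simp [l_block, hb, h5, hT, hp, h1, h2]
      · simp [Edge.map_std, hi]
  · rintro _ (rfl | rfl) g wf hm
    · obtain ⟨-, h5, h6⟩ := hm.elim (by simp)
      simp at h5
      simp [Edge.map_std] at h6
      obtain ⟨⟨-, h7, h8⟩, -, h10, h11⟩ := h5
      obtain ⟨j, g0, h9⟩ := root_blue h8 h7
      obtain rfl : i = j := by simpa [hb] using h9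
      simp only [g0, eDash_block_mem] at h6
      obtain ⟨g1, -⟩ := h6
      refine AGraph.Result.intro_same (by simp) (by simp) rfl ?_ ?_ ?_
      · simp only [toA_E, E, List.map, List.sum_cons, List.sum_nil, Edge.map_std, g0, g1,
          dashes_erase hi]
        abel
      · exact fun v hv => ⟨fun _ => rfl, Iff.rfl⟩
      · have h12 : Node.block (s.T i) ∉ s.P := g1 ▸ h11
        rw [block_mem_P] at h12
        push Not at h12
        have h13 : i ≠ s.T i := by simpa [hb] using h12.1
        simp [g0, g1, l_block, hb, h12, h13]
    · obtain ⟨-, h5, h6⟩ := hm.elim (by simp)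
      simp at h5
      simp [Edge.map_std] at h6
      obtain ⟨-, h7, h8⟩ := h5
      obtain ⟨j, g0, h9⟩ := root_blue h8 h7
      obtain rfl : i = j := by simpa [hb] using h9
      simp [g0] at h6
      refine AGraph.Result.intro_same (by simp) (by simp) rfl ?_ ?_ ?_
      · simp only [toA_E, E, List.map, List.sum_cons, List.sum_nil, Edge.map_std, g0,
          dashes_erase hi, ← h6.1]
        abel
      · exact fun v hv => ⟨fun _ => rfl, Iff.rfl⟩
      · simp [g0, l_block, hb]

/-- The inequalities keep apart the six nodes `i`, `i + 1`, `u`, `u + 1`, `v`, `v + 1` that the rule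
involves. -/
theorem ev_copy (hb : s.blue = some i) (h1 : s.one = some u) (h2 : s.two = some v)
    (hp : s.pl = none) (hi : i ∈ s.lk) (hiu : i + 1 < u) (hu : u + 1 < v)
    (hub : u + 1 ∉ s.bV) (hvb : v + 1 ∉ s.bV) (hul : u ∉ s.lk) (hvl : v ∉ s.lk) :
    Ev copy s.toA 1 (.done {s with
      blue := some (i + 1), one := some (u + 1), two := some (v + 1),
      bV := insert (u + 1) (insert (v + 1) s.bV), lk := insert u (insert v s.lk)}.toA) := by
  have e1 : u ≠ i := by omega
  have e2 : v ≠ i := by omega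
  have e3 : v ≠ u := by omega
  have e4 : u ≠ i + 1 := by omega
  have e5 : v ≠ i + 1 := by omega
  refine Ev.call ?_ ?_ ?_
  · rintro _ rfl
    exact mkRule_K (by simp)
  · intro wf
    have h5 := wf.edge_mem (eRight (.block i) (.block (i + 1))) (by simp [hi])
    have h6 := wf.root_mem (.block u) (by simp [h1])
    have h7 := wf.root_mem (.block v) (by simp [h2])
    simp only [eRight, toA_V, block_mem_V] at h5 h6 h7
    refine ⟨_, rfl, asg [.block i, .block (i + 1), .block u, .block v],
      .intro (by simp) ?_ ?_ (by simp) (by simp [Edge.map_std, hi])⟩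
    · simp
      omega
    · simp [l_block, hb, h1, h2, hp, h5, h6, h7, e1, e2, e3, e4, e5, e1.symm, e2.symm, e3.symm]
  · rintro _ rfl g wf hm
    have w1 := wf.root_mem (.block v) (by simp [h2])
    simp only [toA_V, block_mem_V] at w1
    have e6 : v ≠ u + 1 := by omega
    obtain ⟨-, h5, h6⟩ := hm.elim (by simp)
    simp at h5
    simp [Edge.map_std] at h6
    obtain ⟨⟨-, h7, h8⟩, -, ⟨-, h10, h11⟩, ⟨-, h12, h13⟩⟩ := h5
    obtain ⟨j, g0, h9⟩ := root_blue h8 h7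
    obtain rfl : i = j := by simpa [hb] using h9
    simp only [g0, eRight_block_mem] at h6
    obtain ⟨g1, -⟩ := h6
    obtain ⟨j, g2, h9⟩ := root_one h11 h10
    obtain rfl : u = j := by simpa [h1] using h9
    obtain ⟨j, g3, h9⟩ := root_two h13 h12
    obtain rfl : v = j := by simpa [h2] using h9
    refine ⟨asg [.block i, .block (i + 1), .block u, .block v, .block (u + 1), .block (v + 1)],
      AGraph.Result.intro (by simp) (by simp [g0, g1, g2, g3]) [4, 5] ?_ (by simp; omega)
        (by simp [hub, hvb]) ?_ ?_ ?_ ?_⟩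
    · simp
      omega
    · ext (_ | k | k | k) <;> simp
    · have hu' : u ∉ insert v s.lk := by simp [hul, e3.symm]
      simp only [toA_E, E, List.map, link, List.cons_append, List.nil_append, List.sum_cons,
        List.sum_nil, Edge.map_std, g0, g1, links_insert hu', links_insert hvl]
      simp only [asg, List.getD_cons_zero, List.getD_cons_succ]
      abel
    · rintro (_ | k | k | k) hk
      · exact ⟨fun _ => rfl, by simp⟩
      · exact ⟨fun _ => rfl, by simp⟩
      · simp at hk
        simp [l_block, hk, hb, h1, h2, hp]
      · exact ⟨fun _ => rfl, by simp⟩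
    · have e7 : u ≠ v := by omega
      have e8 : u + 1 ≠ v := by omega
      have e9 : v + 1 ≠ i := by omega
      have e10 : v + 1 ≠ u := by omega
      have e11 : u + 1 ≠ i := by omega
      simp [l_block, hp, e1, e2, e3, e7, e8, e9, e10, e11, e1.symm, e2.symm, e4.symm,
        e5.symm]

/-- This ends the copying: until `glue`, the old list is not linked to its copies, so its last node
has no right neighbour. -/
theorem ev_copy_fail (hb : s.blue = some i) (hi : i ∉ s.lk) : Ev copy s.toA 1 .fail := by
  refine Ev.call_fail ?_ ?_
  · rintro _ rfl
    exact mkRule_K (by simp)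
  · rintro _ rfl g wf hm
    obtain ⟨-, h5, h6⟩ := hm.elim (by simp)
    simp at h5
    simp [Edge.map_std] at h6
    obtain ⟨⟨-, h7, h8⟩, -⟩ := h5
    obtain ⟨j, g0, h9⟩ := root_blue h8 h7
    obtain rfl : i = j := by simpa [hb] using h9
    simp only [g0, eRight_block_mem] at h6
    exact hi h6.2

/-- Since `dm` is empty, `T` describes no edge and may be exchanged for the function wanted after
the restart. Only its value at the last node matters now, because that node receives the loop. -/
theorem ev_glue (hq : s.q = M.q₀) (hg : s.grey = false) (hb : s.blue = some i)
    (h1 : s.one = some u) (h2 : s.two = some (v + 1)) (hp : s.pl = none)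
    (ha : s.aux = some (i + 1, u + 1)) (hiu : i + 1 < u) (huv : u + 1 < v) (hv : v ∈ s.lk)
    (hil : i ∉ s.lk) (hul : u ∉ s.lk) (hdm : s.dm = ∅) {T : ℕ → ℕ} (hT : T (v + 1) = v + 1) :
    Ev (glue M) s.toA 1 (.done {s with
      blue := none, one := none, pl := some v, aux := none, lk := insert i (insert u s.lk),
      dm := {v + 1}, T := T}.toA) := by
  have e1 : u ≠ i := by omega
  have e2 : u + 1 ≠ i := by omega
  have e3 : v ≠ i := by omega
  have e4 : v + 1 ≠ i := by omega
  have e5 : u ≠ i + 1 := by omega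
  have e6 : v + 1 ≠ i + 1 := by omega
  have e7 : v + 1 ≠ u := by omega
  have e8 : v + 1 ≠ u + 1 := by omega
  have e9 : v ≠ u := by omega
  have e10 : v ≠ i + 1 := by omega
  have e11 : v ≠ u + 1 := by omega
  refine Ev.call ?_ ?_ ?_
  · rintro _ rfl
    exact mkRule_K (by simp)
  · intro wf
    have h3 := (wf.edge_mem ⟨.center, .block (i + 1), num 1 .blue⟩ (by simp [ha])).2
    have h4 := (wf.edge_mem ⟨.center, .block (u + 1), num 2 .blue⟩ (by simp [ha])).2
    have h5 := wf.edge_mem (eLeft (.block (v + 1)) (.block v)) (by simp [hv])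
    have h6 := wf.root_mem (.block u) (by simp [h1])
    have h7 := wf.root_mem (.block i) (by simp [hb])
    simp only [eLeft, toA_V, block_mem_V] at h3 h4 h5 h6 h7
    refine ⟨_, rfl, asg [.center, .block i, .block (i + 1), .block u, .block (u + 1), .block v,
      .block (v + 1)], .intro (by simp) ?_ ?_ ?_ ?_⟩
    · simp
      omega
    · simp [l_block, l_center, hq, hg, num, hb, h1, h2, hp, h3, h4, h5, h6, h7, e1.symm, e2.symm,
        e3.symm, e4.symm, e5, e7.symm, e7, e9, e9.symm]
      omega
    · simp [Edge.map, eLeft, num, emp]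
    · simp only [List.forall_mem_cons, Edge.map_std]
      simp [ha, hv]
  · rintro _ rfl g wf hm
    obtain ⟨-, h5, h6⟩ := hm.elim (by simp)
    simp only [List.forall_mem_cons, Edge.map_std] at h6
    simp at h5
    obtain ⟨⟨-, h7, h8⟩, ⟨-, h10, h11⟩, -, ⟨-, h12, h13⟩, -, -, -, h14, h15⟩ := h5
    obtain ⟨g0, -⟩ := root_num h8 h7
    obtain ⟨j, g1, h9⟩ := root_blue h11 h10
    obtain rfl : i = j := by simpa [hb] using h9
    obtain ⟨j, g3, h9⟩ := root_one h13 h12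
    obtain rfl : u = j := by simpa [h1] using h9
    obtain ⟨j, g6, h9⟩ := root_two h15 h14
    obtain rfl : v + 1 = j := by simpa [h2] using h9
    simp [g0, g6, ha] at h6
    obtain ⟨g2, g4, g5, -⟩ := h6
    refine AGraph.Result.intro_same (by simp) (by simp) rfl ?_ ?_ ?_
    · have hi' : i ∉ insert u s.lk := by simp [hil, e1.symm]
      have hd : dashes {v + 1} T = {eDash (.block (v + 1)) (.block (v + 1))} := by
        simp [dashes, hT]
      have hd' : dashes s.dm s.T = 0 := by simp [dashes, hdm]
      simp only [toA_E, E, List.map, link, List.cons_append, List.nil_append, List.sum_cons,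
        List.sum_nil, Edge.map_std, g0, g1, g2, g3, g4, g5, g6, links_insert hi',
        links_insert hul, hd, hd', auxE, ha]
      abel
    · rintro (_ | k | k | k) hk
      · exact ⟨fun _ => rfl, by simp⟩
      · exact ⟨fun _ => rfl, by simp⟩
      · simp [g0, g1, g2, g3, g4, g5, g6] at hk
        simp [l_block, hk, hb, h1, h2, hp]
      · exact ⟨fun _ => rfl, by simp⟩
    · have e12 : v ≠ v + 1 := by omega
      simp [g0, g1, g2, g3, g4, g5, g6, l_center, l_block, hq, hg, num, h2, e3, e4, e7, e9, e10,
        e11]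

theorem ev_direct (hp : s.pl = some (i + 1)) (hb : s.blue = none) (h1 : s.one = none)
    (h2 : s.two = some v) (hi : i ∈ s.lk) (hd : i + 1 ∉ s.dm) (hT : s.T (i + 1) = v)
    (hv : i + 1 < v) :
    Ev direct s.toA 1 (.done {s with pl := some i, dm := insert (i + 1) s.dm}.toA) := by
  have e1 : v ≠ i := by omega
  have e2 : v ≠ i + 1 := by omega
  refine Ev.call ?_ ?_ ?_
  · rintro _ rfl
    exact mkRule_K (by simp)
  · intro wf
    have h5 := wf.edge_mem (eRight (.block i) (.block (i + 1))) (by simp [hi])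
    have h6 := wf.root_mem (.block v) (by simp [h2])
    simp only [eRight, toA_V, block_mem_V] at h5 h6
    refine ⟨_, rfl, asg [.block (i + 1), .block i, .block v],
      .intro (by simp) ?_ ?_ (by simp) (by simp [Edge.map_std, hi])⟩
    · simp
      omega
    · simp [l_block, hb, h1, h2, hp, h5, h6, e1, e2]
  · rintro _ rfl g wf hm
    obtain ⟨-, h5, h6⟩ := hm.elim (by simp)
    simp at h5
    simp [Edge.map_std] at h6
    obtain ⟨⟨-, h7, h8⟩, -, ⟨-, h10, h11⟩⟩ := h5
    obtain ⟨j, g0, h9⟩ := root_plain h8 h7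
    obtain rfl : i + 1 = j := by simpa [hp] using h9
    simp only [g0, eLeft_block_mem] at h6
    obtain ⟨j, hj, g1, -⟩ := h6
    obtain rfl : i = j := by omega
    obtain ⟨j, g2, h9⟩ := root_two h11 h10
    obtain rfl : v = j := by simpa [h2] using h9
    refine AGraph.Result.intro_same (by simp) (by simp) rfl ?_ ?_ ?_
    · simp only [toA_E, E, List.map, List.sum_cons, List.sum_nil, Edge.map_std, g0, g1, g2,
        dashes_insert hd, hT]
      abel
    · rintro (_ | k | k | k) hk
      · exact ⟨fun _ => rfl, by simp⟩
      · exact ⟨fun _ => rfl, by simp⟩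
      · simp [g0, g1, g2] at hk
        simp [l_block, hk, hp]
      · exact ⟨fun _ => rfl, by simp⟩
    · simp [g0, g1, g2, l_block, hb, h1, h2, e1, e2]

theorem ev_direct_fail (hp : s.pl = some 0) : Ev direct s.toA 1 .fail := by
  refine Ev.call_fail ?_ ?_
  · rintro _ rfl
    exact mkRule_K (by simp)
  · rintro _ rfl g wf hm
    obtain ⟨-, h5, h6⟩ := hm.elim (by simp)
    simp at h5
    simp [Edge.map_std] at h6
    obtain ⟨⟨-, h7, h8⟩, -⟩ := h5
    obtain ⟨j, g0, h9⟩ := root_plain h8 h7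
    obtain rfl : 0 = j := by simpa [hp] using h9
    simp only [g0, eLeft_block_mem] at h6
    obtain ⟨j, hj, -⟩ := h6
    omega

theorem ev_unroot (hp : s.pl = some 0) (hb : s.blue = none) (h1 : s.one = none)
    (h2 : s.two = some v) (hd : 0 ∉ s.dm) (hT : s.T 0 = 0) (hv : v ≠ 0) :
    Ev unroot s.toA 1 (.done {s with pl := none, two := none, dm := insert 0 s.dm}.toA) := by
  refine Ev.call ?_ ?_ ?_
  · rintro _ rfl
    exact mkRule_K (by simp)
  · intro wf
    have h5 := wf.root_mem (.block 0) (by simp [hp])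
    have h6 := wf.root_mem (.block v) (by simp [h2])
    simp only [toA_V, block_mem_V] at h5 h6
    refine ⟨_, rfl, asg [.block 0, .block v],
      .intro (by simp) (by simpa using hv.symm) ?_ (by simp) (by simp)⟩
    simp [l_block, hb, h1, h2, hp, h5, h6, hv]
  · rintro _ rfl g wf hm
    obtain ⟨-, h5, -⟩ := hm.elim (by simp)
    simp at h5
    obtain ⟨⟨-, h7, h8⟩, ⟨-, h10, h11⟩⟩ := h5
    obtain ⟨j, g0, h9⟩ := root_plain h8 h7
    obtain rfl : 0 = j := by simpa [hp] using h9
    obtain ⟨j, g1, h9⟩ := root_two h11 h10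
    obtain rfl : v = j := by simpa [h2] using h9
    refine AGraph.Result.intro_same (by simp) (by simp) rfl ?_ ?_ ?_
    · simp only [toA_E, E, List.map, List.sum_cons, List.sum_nil, Edge.map_std, g0,
        dashes_insert hd, hT]
      abel
    · rintro (_ | k | k | k) hk
      · exact ⟨fun _ => rfl, by simp⟩
      · exact ⟨fun _ => rfl, by simp⟩
      · simp [g0, g1] at hk
        simp [l_block, hk, hb, h1, h2, hp]
      · exact ⟨fun _ => rfl, by simp⟩
    · simp [g0, g1, l_block, hb, h1]

end St

/-! ### Ternary numbers -/

/-- The number with the ternary digits `d 0, …, d (n - 1)`, the leftmost one most significant. -/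
def ternary (d : ℕ → Fin 3) : ℕ → ℕ
  | 0 => 0
  | n + 1 => 3 * ternary d n + (d n).val

theorem ternary_congr {d d' : ℕ → Fin 3} {n : ℕ} (h : ∀ i < n, d i = d' i) :
    ternary d n = ternary d' n := by
  induction n with
  | zero => rfl
  | succ n ih => rw [ternary, ternary, ih fun i hi => h i (by omega), h n (by omega)]

theorem ternary_update (d : ℕ → Fin 3) (n : ℕ) (x : Fin 3) :
    ternary (Function.update d n x) (n + 1) = 3 * ternary d n + x.val := by
  rw [ternary, Function.update_self,
    ternary_congr fun i hi => Function.update_of_ne (Nat.ne_of_lt hi) _ _]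

theorem ternary_lt (d : ℕ → Fin 3) (n : ℕ) : ternary d n < 3 ^ n := by
  induction n with
  | zero => simp [ternary]
  | succ n ih => rw [ternary, pow_succ]; omega

/-- Division by three with remainder recovers the digits. Counting can thus be described by numbers
alone, and the digits of the cache are identified afterwards. -/
theorem ternary_inj {d d' : ℕ → Fin 3} {n : ℕ} (h : ternary d n = ternary d' n) :
    ∀ i < n, d i = d' i := by
  induction n with
  | zero => omega
  | succ n ih =>
    simp only [ternary] at h
    have h1 : ternary d n = ternary d' n := by omega
    have h2 : d n = d' n := by omega
    intro i hi
    rcases Nat.lt_succ_iff_lt_or_eq.1 hi with hi | rfl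
    · exact ih h1 i hi
    · exact h2

theorem ternary_eq_zero {d : ℕ → Fin 3} {n : ℕ} (h : ternary d n = 0) : ∀ i < n, d i = 0 := by
  refine ternary_inj (d' := fun _ => 0) (h.trans ?_)
  clear h
  induction n with
  | zero => rfl
  | succ n ih => simp [ternary, ← ih]

/-- The recursion is Horner's scheme for the sum. -/
theorem content_eq_ternary (tape : ℕ → Fin 3) (c j : ℕ) :
    content tape c j = ternary (fun i => tape (j * c + i)) c := by
  have key : ∀ (f : ℕ → Fin 3) (n : ℕ),
      ∑ i ∈ Finset.range n, (f i).val * 3 ^ (n - 1 - i) = ternary f n := by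
    intro f n
    induction n with
    | zero => rfl
    | succ n ih =>
      rw [Finset.sum_range_succ, ternary, ← ih, Finset.mul_sum]
      congr 1
      · refine Finset.sum_congr rfl fun i hi => ?_
        have hi := Finset.mem_range.1 hi
        rw [show n + 1 - 1 - i = (n - 1 - i) + 1 by omega, pow_succ]
        ring
      · simp
  exact key _ c

theorem fin3_sub_one {x : Fin 3} (h : x ≠ 0) : (x - 1).val + 1 = x.val := by
  fin_cases x <;> simp_all

theorem fin3_add_one {x : Fin 3} (h : x ≠ 2) : (x + 1).val = x.val + 1 := by
  fin_cases x <;> simp_all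

theorem Ev.of_eq {P : Com} {A : AGraph Node} {n m : ℕ} {s s' : St}
    (h : Ev P A n (.done s.toA)) (hs : s = s') (hn : n ≤ m) : Ev P A m (.done s'.toA) :=
  hs ▸ h.mono hn

namespace St

variable {M : OfflineTM} {s : St}

/-! ### The counter -/

/-- Subtraction with borrow: a zero becomes two and the borrow passes to the left, where the
remaining number is still positive; the first nonzero digit is lowered and the red root vanishes. A
digit costs at most three calls. -/
theorem ev_loop_decrement (p : ℕ) : ∀ s : St, s.red = some p → 0 < ternary s.dig (p + 1) →
    ∃ d, ternary d (p + 1) + 1 = ternary s.dig (p + 1) ∧ (∀ i, p < i → d i = s.dig i) ∧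
      Ev (.loop decrement) s.toA (3 * (p + 1)) (.done {s with red := none, dig := d}.toA) := by
  induction p with
  | zero =>
    intro s hred hpos
    have hd : s.dig 0 ≠ 0 := by
      intro h
      simp [ternary, h] at hpos
    refine ⟨Function.update s.dig 0 (s.dig 0 - 1), ?_, fun i hi =>
      Function.update_of_ne (by omega) _ _, ?_⟩
    · have := fin3_sub_one hd
      rw [ternary_update, ternary.eq_2 s.dig 0]
      omega
    · exact (Ev.loop_brk (Ev.tte (ev_dec hred hd) (Ev.seq (ev_finish hred) .brk))).mono (by omega)
  | succ p ih =>
    intro s hred hpos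
    by_cases hd : s.dig (p + 1) = 0
    · have hpos' : 0 < ternary s.dig (p + 1) := by
        rw [ternary, hd] at hpos
        simpa using hpos
      have e : ternary (Function.update s.dig (p + 1) 2) (p + 1) = ternary s.dig (p + 1) :=
        ternary_congr fun i hi => Function.update_of_ne (by omega) _ _
      obtain ⟨d, h1, h2, h3⟩ := ih
        {s with red := some p, dig := Function.update s.dig (p + 1) 2} rfl (by rwa [e])
      refine ⟨d, ?_, fun i hi => ?_, ?_⟩
      · have h4 : d (p + 1) = 2 := (h2 (p + 1) (by omega)).trans (Function.update_self ..)
        have h5 : ternary d (p + 1) + 1 = ternary s.dig (p + 1) := h1.trans e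
        rw [ternary.eq_2 d, ternary.eq_2 s.dig, h4, hd]
        simp only [Fin.val_two, Fin.val_zero]
        omega
      · rw [h2 i (by omega)]
        exact Function.update_of_ne (by omega) _ _
      · refine (Ev.loop (Ev.tte_fail (ev_dec_fail hred hd) (Ev.seq (ev_underflow hred hd)
          (Ev.tryElse (ev_cacheNext hred)))) h3).mono (by omega)
    · refine ⟨Function.update s.dig (p + 1) (s.dig (p + 1) - 1), ?_, fun i hi =>
        Function.update_of_ne (by omega) _ _, ?_⟩
      · have := fin3_sub_one hd
        rw [ternary_update, ternary.eq_2 s.dig (p + 1)]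
        omega
      · exact (Ev.loop_brk (Ev.tte (ev_dec hred hd) (Ev.seq (ev_finish hred) .brk))).mono
          (by omega)

/-- The borrow runs off the left end, so the red root survives at index `0`. Its survival is the
signal that the counter was zero. -/
theorem ev_loop_decrement_zero (p : ℕ) : ∀ s : St, s.red = some p → (∀ i ≤ p, s.dig i = 0) →
    Ev (.loop decrement) s.toA (3 * (p + 1))
      (.done {s with red := some 0, dig := fun i => if i ≤ p then 2 else s.dig i}.toA) := by
  induction p with
  | zero =>
    intro s hred h0
    refine (Ev.loop_brk (Ev.tte_fail (ev_dec_fail hred (h0 0 le_rfl)) (Ev.seq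
      (ev_underflow hred (h0 0 le_rfl)) (Ev.tryElse_brk (ev_cacheNext_fail hred))))).of_eq ?_
      (by omega)
    simp only [hred, St.mk.injEq, true_and, and_true]
    funext i
    by_cases hi : i = 0 <;> simp [hi]
  | succ p ih =>
    intro s hred h0
    refine (Ev.loop (Ev.tte_fail (ev_dec_fail hred (h0 _ le_rfl)) (Ev.seq
      (ev_underflow hred (h0 _ le_rfl)) (Ev.tryElse (ev_cacheNext hred)))) (ih _ rfl ?_)).of_eq ?_
      (by omega)
    · intro i hi
      exact (Function.update_of_ne (by omega) _ _).trans (h0 i (by omega))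
    · simp only [St.mk.injEq, true_and, and_true]
      funext i
      by_cases hi : i = p + 1
      · simp [hi]
      · by_cases hi' : i ≤ p
        · simp [hi']
          omega
        · simp [hi, hi']
          omega

/-- Running to the right, the loop undoes an underflow and leaves the red root on the last digit;
`n` counts the digits to the right of the root. -/
theorem ev_loop_reset (n : ℕ) : ∀ (s : St) (p : ℕ), s.red = some p → p + n + 1 = s.c →
    (∀ i, p ≤ i → i < s.c → s.dig i = 2) →
    Ev (.loop reset) s.toA (2 * (n + 1)) (.done
      {s with red := some (s.c - 1), dig := fun i => if p ≤ i ∧ i < s.c then 0 else s.dig i}.toA) := by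
  induction n with
  | zero =>
    intro s p hred hp h2
    refine (Ev.loop_brk (Ev.seq (ev_overflow hred (h2 p le_rfl (by omega)))
      (Ev.tryElse_brk (ev_cachePrev_fail hred (by simp; omega))))).of_eq ?_ (by omega)
    simp only [hred, St.mk.injEq, true_and, and_true]
    refine ⟨?_, by simp; omega⟩
    funext i
    by_cases hi : i = p
    · simp [hi]
      omega
    · simp [hi]
      omega
  | succ n ih =>
    intro s p hred hp h2
    refine (Ev.loop (Ev.seq (ev_overflow hred (h2 p le_rfl (by omega)))
      (Ev.tryElse (ev_cachePrev hred (by simp; omega)))) (ih _ (p + 1) rfl (by simp; omega) ?_)).of_eq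
      ?_ (by omega)
    · intro i h3 h4
      exact (Function.update_of_ne (by omega) _ _).trans (h2 i (by omega) h4)
    · simp only [St.mk.injEq, true_and, and_true]
      funext i
      by_cases hi : i = p
      · simp [hi]
        omega
      · have e : p + 1 ≤ i ∧ i < s.c ↔ p ≤ i ∧ i < s.c := by omega
        simp only [e, Function.update_of_ne hi]

/-- Addition with carry. The bound says that not all digits are two, so the carry is absorbed before
it runs off the left end. -/
theorem ev_loop_increment (p : ℕ) : ∀ s : St, s.red = some p →
    ternary s.dig (p + 1) + 1 < 3 ^ (p + 1) →
    ∃ d, ternary d (p + 1) = ternary s.dig (p + 1) + 1 ∧ (∀ i, p < i → d i = s.dig i) ∧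
      Ev (.loop increment) s.toA (3 * (p + 1)) (.done {s with red := none, dig := d}.toA) := by
  induction p with
  | zero =>
    intro s hred hpos
    have hd : s.dig 0 ≠ 2 := by
      intro h
      simp [ternary, h] at hpos
    refine ⟨Function.update s.dig 0 (s.dig 0 + 1), ?_, fun i hi =>
      Function.update_of_ne (by omega) _ _, ?_⟩
    · have := fin3_add_one hd
      rw [ternary_update, ternary.eq_2 s.dig 0]
      omega
    · exact (Ev.loop_brk (Ev.tte (ev_inc hred hd) (Ev.seq (ev_finish hred) .brk))).mono (by omega)
  | succ p ih =>
    intro s hred hpos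
    by_cases hd : s.dig (p + 1) = 2
    · have hpos' : ternary s.dig (p + 1) + 1 < 3 ^ (p + 1) := by
        rw [ternary, hd, pow_succ] at hpos
        simp at hpos
        omega
      have e : ternary (Function.update s.dig (p + 1) 0) (p + 1) = ternary s.dig (p + 1) :=
        ternary_congr fun i hi => Function.update_of_ne (by omega) _ _
      obtain ⟨d, h1, h2, h3⟩ := ih
        {s with red := some p, dig := Function.update s.dig (p + 1) 0} rfl (by rwa [e])
      refine ⟨d, ?_, fun i hi => ?_, ?_⟩
      · have h4 : d (p + 1) = 0 := (h2 (p + 1) (by omega)).trans (Function.update_self ..)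
        have h5 : ternary d (p + 1) = ternary s.dig (p + 1) + 1 := h1.trans (by rw [← e])
        rw [ternary.eq_2 d, ternary.eq_2 s.dig, h4, hd]
        simp only [Fin.val_two, Fin.val_zero]
        omega
      · rw [h2 i (by omega)]
        exact Function.update_of_ne (by omega) _ _
      · refine (Ev.loop (Ev.tte_fail (ev_inc_fail hred hd) (Ev.seq (ev_overflow hred hd)
          (Ev.tryElse (ev_cacheNext hred)))) h3).mono (by omega)
    · refine ⟨Function.update s.dig (p + 1) (s.dig (p + 1) + 1), ?_, fun i hi =>
        Function.update_of_ne (by omega) _ _, ?_⟩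
      · have := fin3_add_one hd
        rw [ternary_update, ternary.eq_2 s.dig (p + 1)]
        omega
      · exact (Ev.loop_brk (Ev.tte (ev_inc hred hd) (Ev.seq (ev_finish hred) .brk))).mono
          (by omega)

end St

namespace St

variable {M : OfflineTM} {s : St}

theorem ev_cacheDec (hq : s.q ∈ M.Q) (hg : s.grey = false) (hred : s.red = none) (hc : 0 < s.c)
    (hpos : 0 < ternary s.dig s.c) :
    ∃ d, ternary d s.c + 1 = ternary s.dig s.c ∧ (∀ i, s.c ≤ i → d i = s.dig i) ∧
      Ev (cacheDec M) s.toA (3 * s.c + 2) (.done {s with dig := d}.toA) := by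
  have e : s.c - 1 + 1 = s.c := by omega
  obtain ⟨d, h1, h2, h3⟩ := ev_loop_decrement (s.c - 1) {s with red := some (s.c - 1)} rfl
    (by rwa [e])
  rw [e] at h1
  refine ⟨d, h1, fun i hi => h2 i (by omega), ?_⟩
  refine (Ev.seq (ev_cacheInit hq hg hred)
    (Ev.seq h3 (Ev.ifThen_fail (ev_unfinished_fail rfl)))).of_eq ?_ (by omega)
  rw [← hred]

/-- The digits return to zero and only the red root remains as a trace. The calls are `3 * c` for
the borrow, `2 * c` for its reversal, and two for `cacheInit` and `unfinished`. -/
theorem ev_cacheDec_zero (hq : s.q ∈ M.Q) (hg : s.grey = false) (hred : s.red = none)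
    (hc : 0 < s.c) (h0 : ternary s.dig s.c = 0) :
    Ev (cacheDec M) s.toA (5 * s.c + 2) (.done {s with red := some (s.c - 1)}.toA) := by
  have h0 := ternary_eq_zero h0
  refine (Ev.seq (ev_cacheInit hq hg hred) (Ev.seq
    (ev_loop_decrement_zero (s.c - 1) _ rfl fun i hi => h0 i (by omega))
    (Ev.ite (ev_unfinished rfl) (ev_loop_reset (s.c - 1) _ 0 rfl (by simp; omega) ?_)))).of_eq ?_
    (by omega)
  · intro i _ hi
    simp at hi ⊢
    omega
  · simp only [St.mk.injEq, true_and, and_true]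
    funext i
    by_cases hi : i < s.c
    · simp [hi, h0]
    · simp [hi]
      omega

theorem ev_cacheInc (hq : s.q ∈ M.Q) (hg : s.grey = false) (hred : s.red = none) (hc : 0 < s.c)
    (hlt : ternary s.dig s.c + 1 < 3 ^ s.c) :
    ∃ d, ternary d s.c = ternary s.dig s.c + 1 ∧ (∀ i, s.c ≤ i → d i = s.dig i) ∧
      Ev (cacheInc M) s.toA (3 * s.c + 2) (.done {s with dig := d}.toA) := by
  have e : s.c - 1 + 1 = s.c := by omega
  obtain ⟨d, h1, h2, h3⟩ := ev_loop_increment (s.c - 1) {s with red := some (s.c - 1)} rfl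
    (by rwa [e])
  rw [e] at h1
  refine ⟨d, h1, fun i hi => h2 i (by omega), ?_⟩
  refine (Ev.seq (ev_cacheInit hq hg hred)
    (Ev.seq h3 (Ev.ifThen_fail (ev_unfinished_fail rfl)))).of_eq ?_ (by omega)
  rw [← hred]

/-! ### Saving and loading the cache -/

/-- The value of the cache plus the index of the blue root is invariant. After `v` rounds the cache
is zero, and one more round detects this by the remaining red root and breaks. A round takes at most
`5 * c + 5` calls. -/
theorem ev_loop_encoding (v : ℕ) : ∀ (s : St) (i : ℕ), s.q ∈ M.Q → s.grey = false →
    s.red = none → 0 < s.c → s.blue = some i → s.OnlyBlue → ternary s.dig s.c = v →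
    (∀ j, i ≤ j → j < i + v → j ∈ s.lk) →
    Ev (.loop (encoding M)) s.toA ((v + 1) * (5 * s.c + 5)) (.done
      {s with blue := some (i + v), dig := fun j => if j < s.c then 0 else s.dig j}.toA) := by
  induction v with
  | zero =>
    intro s i hq hg hred hc hb ho h0 _
    refine (Ev.loop_brk (Ev.seq (ev_cacheDec_zero hq hg hred hc h0)
      (Ev.seq_brk (Ev.tte (ev_finish rfl) .brk)))).of_eq ?_ (by omega)
    simp only [hb, hred, St.mk.injEq, true_and, and_true]
    refine ⟨?_, by simp⟩
    funext j
    by_cases hj : j < s.c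
    · simp [hj, ternary_eq_zero h0 j hj]
    · simp [hj]
  | succ v ih =>
    intro s i hq hg hred hc hb ho hv hlk
    obtain ⟨d, h1, h2, h3⟩ := ev_cacheDec hq hg hred hc (by omega)
    refine (Ev.loop (Ev.seq h3 (Ev.seq (Ev.tryThen_fail (ev_finish_fail hred))
      (Ev.tryDo (ev_nextValue hb ⟨ho.1, ho.2, ho.3⟩ (hlk i le_rfl (by omega))))))
      (ih _ (i + 1) hq hg hred hc rfl ⟨ho.1, ho.2, ho.3⟩ (by simp; omega)
        fun j h4 h5 => hlk j (by omega) (by omega))).of_eq ?_ ?_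
    · simp only [St.mk.injEq, true_and, and_true]
      refine ⟨?_, by simp; omega⟩
      funext j
      by_cases hj : j < s.c
      · simp [hj]
      · simp [hj, h2 j (by omega)]
    · simp only
      rw [add_mul (v + 1) 1]
      omega

/-- The inverse of saving, with the same invariant: each move of the blue root to the left is paid
for by an increment, and a last round fails to move it from block `0` and breaks. -/
theorem ev_loop_decoding (i : ℕ) : ∀ (s : St), s.q ∈ M.Q → s.grey = false →
    s.red = none → 0 < s.c → s.blue = some i → s.OnlyBlue → ternary s.dig s.c + i < 3 ^ s.c →
    (∀ j < i, j ∈ s.lk) →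
    ∃ d, ternary d s.c = ternary s.dig s.c + i ∧
      Ev (.loop (decoding M)) s.toA ((i + 1) * (3 * s.c + 4))
        (.done {s with blue := some 0, dig := d}.toA) := by
  induction i with
  | zero =>
    intro s hq hg hred hc hb ho hlt _
    refine ⟨s.dig, rfl, (Ev.loop_brk
      (Ev.seq_brk (Ev.tryElse_brk (ev_prevValue_fail hb)))).of_eq ?_ (by omega)⟩
    rw [← hb]
  | succ i ih =>
    intro s hq hg hred hc hb ho hlt hlk
    obtain ⟨d, h1, h2, h3⟩ := ev_cacheInc (M := M) (s := {s with blue := some i}) hq hg hred hc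
      (by simp; omega)
    obtain ⟨d', h4, h5⟩ := ih {s with blue := some i, dig := d} hq hg hred hc rfl
      ⟨ho.1, ho.2, ho.3⟩ (by simp at h1 ⊢; omega) fun j hj => hlk j (by omega)
    refine ⟨d', by simp at h1 h4; omega, (Ev.loop (Ev.seq (Ev.tryElse
      (ev_prevValue hb ⟨ho.1, ho.2, ho.3⟩ (hlk i (by omega)))) h3) h5).mono ?_⟩
    simp only
    rw [add_mul (i + 1) 1]
    omega

/-- The properties of configuration graphs that persist while blocks are saved and loaded. -/
structure Std (M : OfflineTM) (s : St) : Prop where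
  q : s.q ∈ M.Q
  grey : s.grey = false
  red : s.red = none
  blue : s.blue = none
  only : s.OnlyBlue
  aux : s.aux = none
  bV : s.bV = Finset.range (3 ^ s.c)
  lk : s.lk = Finset.range (3 ^ s.c - 1)
  dm : s.dm = Finset.range (3 ^ s.c)
  act : s.act < 3 ^ s.c
  c : 1 < s.c

/-- The value of the cache is below `3 ^ c`, which bounds the number of rounds and ensures that the
block node with this index exists. The cache ends at zero, ready for loading. -/
theorem ev_encode (h : s.Std M) : Ev (encode M) s.toA (3 ^ s.c * (5 * s.c + 5) + 2) (.done
    {s with dig := fun j => if j < s.c then 0 else s.dig j,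
            T := Function.update s.T s.act (ternary s.dig s.c)}.toA) := by
  have hc := h.c
  have hv := ternary_lt s.dig s.c
  refine (Ev.seq (ev_encodeInit h.q h.grey h.blue h.only) (Ev.seq
    (ev_loop_encoding (ternary s.dig s.c) _ 0 h.q h.grey h.red (by simp; omega) rfl
      ⟨h.only.1, h.only.2, h.only.3⟩ rfl ?_)
    (ev_update h.q h.grey rfl ⟨h.only.1, h.only.2, h.only.3⟩ ?_))).of_eq ?_ ?_
  · intro j _ hj
    simp only [h.lk, Finset.mem_range]
    omega
  · simp only [h.dm, Finset.mem_range]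
    exact h.act
  · simp [h.blue]
  · have := Nat.mul_le_mul_right (5 * s.c + 5) (Nat.succ_le_of_lt hv)
    simp only [Nat.succ_eq_add_one] at this ⊢
    omega

/-- The blue root ends on block `0`, so the concluding `update` produces exactly the dashed edge
prescribed for an active block. -/
theorem ev_decode (h : s.Std M) (hd : ∀ i < s.c, s.dig i = 0) (hT : s.T s.act < 3 ^ s.c) :
    ∃ d, ternary d s.c = s.T s.act ∧ Ev (decode M) s.toA (3 ^ s.c * (3 * s.c + 4) + 2) (.done
      {s with dig := d, T := Function.update s.T s.act 0}.toA) := by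
  have hc := h.c
  have h0 : ternary s.dig s.c = 0 := by
    rw [ternary_congr (d' := fun _ => 0) hd]
    generalize s.c = n
    induction n with
    | zero => rfl
    | succ n ih => simp [ternary, ih]
  obtain ⟨d, h1, h2⟩ := ev_loop_decoding (M := M) (s.T s.act) {s with blue := some (s.T s.act)}
    h.q h.grey h.red (by simp; omega) rfl ⟨h.only.1, h.only.2, h.only.3⟩ (by simpa [h0] using hT)
    (fun j hj => by simp only [h.lk, Finset.mem_range]; omega)
  refine ⟨d, by simpa [h0] using h1, (Ev.seq (ev_decodeInit h.q h.grey h.blue h.only ?_)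
    (Ev.seq h2 (ev_update h.q h.grey rfl ⟨h.only.1, h.only.2, h.only.3⟩ ?_))).of_eq ?_ ?_⟩
  · simp only [h.dm, Finset.mem_range]
    exact h.act
  · simp only [h.dm, Finset.mem_range]
    exact h.act
  · simp [h.blue]
  · have := Nat.mul_le_mul_right (3 * s.c + 4) (Nat.succ_le_of_lt hT)
    simp only [Nat.succ_eq_add_one] at this ⊢
    omega

theorem ev_loop_headLeft (n : ℕ) : ∀ s : St, s.q ∈ M.Q → s.grey = false → s.pa = .empty →
    s.red = none → s.hd = n →
    Ev (.loop (headLeft M)) s.toA (n + 1) (.done {s with hd := 0}.toA) := by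
  induction n with
  | zero =>
    intro s hq hg hpa hred hh
    refine (Ev.loop_fail (ev_headLeft_fail hh)).of_eq ?_ (by omega)
    rw [← hh]
  | succ n ih =>
    intro s hq hg hpa hred hh
    refine (Ev.loop (ev_headLeft hq hg hh hpa hred) (ih _ hq hg rfl hred rfl)).of_eq ?_ (by omega)
    simp [hpa]

theorem ev_loop_headRight (n : ℕ) : ∀ s : St, s.q ∈ M.Q → s.grey = false → s.pa = .empty →
    s.red = none → s.hd + n + 1 = s.c →
    Ev (.loop (headRight M)) s.toA (n + 1) (.done {s with hd := s.c - 1}.toA) := by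
  induction n with
  | zero =>
    intro s hq hg hpa hred hh
    refine (Ev.loop_fail (ev_headRight_fail (by omega))).of_eq ?_ (by omega)
    rw [show s.c - 1 = s.hd by omega]
  | succ n ih =>
    intro s hq hg hpa hred hh
    refine (Ev.loop (ev_headRight hq hg (by omega) hpa hred)
      (ih _ hq hg rfl hred (by simp; omega))).of_eq ?_ (by omega)
    simp [hpa]

end St

namespace St

variable {M : OfflineTM} {s : St}

/-! ### Restarting -/

theorem ev_loop_rewindCache (n : ℕ) : ∀ s : St, s.q = M.q₀ → s.grey = false → s.pa = .empty →
    s.red = none → s.hd = n →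
    Ev (.loop (rewindCache M)) s.toA (n + 1) (.done {s with hd := 0}.toA) := by
  induction n with
  | zero =>
    intro s hq hg hpa hred hh
    refine (Ev.loop_fail (ev_rewindCache_fail hh)).of_eq ?_ (by omega)
    rw [← hh]
  | succ n ih =>
    intro s hq hg hpa hred hh
    refine (Ev.loop (ev_rewindCache hq hg hh hpa hred) (ih _ hq hg rfl hred rfl)).of_eq ?_
      (by omega)
    simp [hpa]

theorem ev_rewindTapes (hq : s.q = M.q₀) (hg : s.grey = false) (hpa : s.pa = .empty)
    (hred : s.red = none) (hb : s.blue = none) (ho : s.OnlyBlue) (ha : s.act ≠ 0) :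
    Ev (rewindTapes M) s.toA (s.hd + 3) (.done {s with inp := 0, act := 0, hd := 0}.toA) :=
  (Ev.seq (ev_rewindInput hq hg) (Ev.seq
    (Ev.tryDo (ev_rewindBlockset hq hg hb ⟨ho.1, ho.2, ho.3⟩ ha))
    (ev_loop_rewindCache s.hd _ hq hg hpa hred rfl))).mono (by omega)

theorem ev_loop_erase (n : ℕ) : ∀ (s : St) (p : ℕ), s.red = some p → p + n + 1 = s.c →
    s.dig p = 2 → ∃ d, (∀ i, p < i → i < s.c → d i = 2) ∧ (∀ i ≤ p, d i = s.dig i) ∧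
      Ev (.loop erase) s.toA (n + 1) (.done {s with red := some (s.c - 1), dig := d}.toA) := by
  induction n with
  | zero =>
    intro s p hred hp hd
    refine ⟨s.dig, fun i h1 h2 => by omega, fun i _ => rfl,
      (Ev.loop_fail (ev_erase_fail hred (by omega))).of_eq ?_ (by omega)⟩
    rw [show s.c - 1 = p by omega, ← hred]
  | succ n ih =>
    intro s p hred hp hd
    obtain ⟨d, h1, h2, h3⟩ := ih
      {s with red := some (p + 1), dig := Function.update s.dig (p + 1) 2}
      (p + 1) rfl (by simp only; omega) (Function.update_self ..)
    refine ⟨d, fun i h4 h5 => ?_, fun i hi => ?_,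
      (Ev.loop (ev_erase hred hd (by omega)) h3).mono (by omega)⟩
    · by_cases hi : i = p + 1
      · rw [hi]
        exact (h2 _ le_rfl).trans (Function.update_self ..)
      · exact h1 i (by omega) h5
    · exact (h2 i (by omega)).trans (Function.update_of_ne (by omega) _ _)

theorem ev_resetCache (hq : s.q = M.q₀) (hg : s.grey = false) (hpa : s.pa = .empty)
    (hred : s.red = none) (hh : s.hd = 0) (hc : 0 < s.c) :
    ∃ d : ℕ → Fin 3, (∀ i < s.c + 1, d i = 2) ∧
      Ev (resetCache M) s.toA (s.c + 2) (.done {s with dig := d, c := s.c + 1}.toA) := by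
  obtain ⟨d, h1, h2, h3⟩ := ev_loop_erase (s.c - 1)
    {s with red := some s.hd, dig := Function.update s.dig s.hd 2} 0 (by rw [hh])
    (by simp only; omega) ((congrFun (congrArg (fun x => Function.update s.dig x 2) hh) 0).trans
      (Function.update_self ..))
  have h4 : ∀ i < s.c, d i = 2 := fun i hi => by
    rcases Nat.eq_zero_or_pos i with rfl | h
    · exact (h2 0 le_rfl).trans ((congrFun (congrArg (fun x => Function.update s.dig x 2) hh) 0).trans
        (Function.update_self ..))
    · exact h1 i h hi
  refine ⟨Function.update d s.c 2, fun i hi => ?_, ?_⟩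
  · rcases Nat.lt_succ_iff_lt_or_eq.1 hi with h | rfl
    · rw [Function.update_of_ne (by omega), h4 i h]
    · rw [Function.update_self]
  · refine (Ev.seq (ev_cInit hq hg hpa hred) (Ev.seq h3 (ev_endCache (p := s.c - 1) hq hg rfl
      (h4 _ (by omega)) (by simp only; omega)))).of_eq ?_ (by omega)
    simp [hred]

/-- The graph in which `i + 1` of the `b` block nodes have been copied. -/
def copyState (s : St) (b i : ℕ) : St :=
  {s with
    blue := some i, one := some (b + i), two := some (2 * b + i), aux := some (b, 2 * b)
    bV := Finset.range b ∪ Finset.Ico b (b + i + 1) ∪ Finset.Ico (2 * b) (2 * b + i + 1)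
    lk := Finset.range (b - 1) ∪ Finset.Ico b (b + i) ∪ Finset.Ico (2 * b) (2 * b + i)
    dm := Finset.Ico (i + 1) b}

/-- Each round copies the node reached by the blue root and deletes its dashed edge, whose target is
an old node by `hT` and hence none of the labelled roots. -/
theorem ev_loop_copy {b : ℕ} (hp : s.pl = none) (hT : ∀ j < b, s.T j < b) (n : ℕ) :
    ∀ i, i + n + 1 = b → Ev (.loop (copy ;; tryDo undirect)) (s.copyState b i).toA (2 * n + 1)
      (.done (s.copyState b (b - 1)).toA) := by
  induction n with
  | zero =>
    intro i hi
    refine (Ev.loop_fail (Ev.seq_fail (ev_copy_fail rfl ?_))).of_eq ?_ (by omega)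
    · simp only [copyState, Finset.mem_union, Finset.mem_range, Finset.mem_Ico]
      omega
    · rw [show i = b - 1 by omega]
  | succ n ih =>
    intro i hi
    refine Ev.mono (Ev.loop (Ev.seq (ev_copy (s := s.copyState b i) rfl rfl rfl hp ?_ ?_ ?_ ?_ ?_ ?_ ?_)
      (Ev.of_eq (ev_undirect (i := i + 1) rfl hp ?_ ?_ ?_) ?_ le_rfl)) (ih (i + 1) (by omega)))
      (by omega)
    · simp only [copyState, Finset.mem_union, Finset.mem_range, Finset.mem_Ico]
      omega
    · omega
    · omega
    · simp only [copyState, Finset.mem_union, Finset.mem_range, Finset.mem_Ico]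
      omega
    · simp only [copyState, Finset.mem_union, Finset.mem_range, Finset.mem_Ico]
      omega
    · simp only [copyState, Finset.mem_union, Finset.mem_range, Finset.mem_Ico]
      omega
    · simp only [copyState, Finset.mem_union, Finset.mem_range, Finset.mem_Ico]
      omega
    · simp only [copyState, Finset.mem_Ico]
      omega
    · have := hT (i + 1) (by omega)
      simp only [copyState, ne_eq, Option.some.injEq]
      omega
    · have := hT (i + 1) (by omega)
      simp only [copyState, ne_eq, Option.some.injEq]
      omega
    · simp only [copyState, St.mk.injEq, Option.some.injEq, true_and, and_true]
      refine ⟨?_, ?_, ?_, by omega, by omega⟩ <;> ext j <;>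
        simp only [Finset.mem_union, Finset.mem_range, Finset.mem_Ico, Finset.mem_insert,
          Finset.mem_erase] <;> omega

theorem ev_loop_direct {v : ℕ} (i : ℕ) : ∀ s : St, s.pl = some i → s.blue = none → s.one = none →
    s.two = some v → s.lk = Finset.range v → s.dm = Finset.Ico (i + 1) (v + 1) →
    (∀ j, 0 < j → s.T j = v) → i < v →
    Ev (.loop direct) s.toA (i + 1)
      (.done {s with pl := some 0, dm := Finset.Ico 1 (v + 1)}.toA) := by
  induction i with
  | zero =>
    intro s hp _ _ _ _ hdm _ _
    refine (Ev.loop_fail (ev_direct_fail hp)).of_eq ?_ (by omega)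
    rw [← hp, ← hdm]
  | succ i ih =>
    intro s hp hb h1 h2 hlk hdm hT hi
    refine (Ev.loop (ev_direct hp hb h1 h2 ?_ ?_ (hT _ (by omega)) hi)
      (ih _ rfl hb h1 h2 hlk ?_ hT (by omega))).mono (by omega)
    · rw [hlk, Finset.mem_range]
      omega
    · rw [hdm, Finset.mem_Ico]
      omega
    · ext j
      simp only [hdm, Finset.mem_insert, Finset.mem_Ico]
      omega

/-- Starting the copies at `b` and `2 * b` makes the three lists adjacent ranges of indices. For `b
= 3 ^ c`, the target `3 * b - 1` is the value of a block of `c + 1` blanks; block `0` will be active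
and points to itself. -/
theorem ev_resetBlockset {b : ℕ} (hq : s.q = M.q₀) (hg : s.grey = false) (hbl : s.blue = none)
    (ho : s.OnlyBlue) (ha : s.aux = none) (hb : 2 < b) (hbV : s.bV = Finset.range b)
    (hlk : s.lk = Finset.range (b - 1)) (hdm : s.dm = Finset.range b) (hT : ∀ j < b, s.T j < b) :
    Ev (resetBlockset M) s.toA (5 * b + 3) (.done {s with
      bV := Finset.range (3 * b), lk := Finset.range (3 * b - 1), dm := Finset.range (3 * b),
      T := fun j => if j = 0 then 0 else 3 * b - 1}.toA) := by
  have hT0 := hT 0 (by omega)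
  -- The index of the last node of the second copy, in the form that `ev_glue` expects: its left
  -- neighbour has index `3 * b - 2`.
  have e : 2 * b + (b - 1) = 3 * b - 2 + 1 := by omega
  have e' : 2 * b + (b - 1) = 3 * b - 1 := by omega
  refine (Ev.seq (ev_bInit (u := b) (v := 2 * b) hq hg hbl ho ha ?_ ?_ (by omega)) (Ev.seq
    (Ev.of_eq (s' := s.copyState b 0) (ev_undirect (i := 0) rfl ho.pl ?_ ?_ ?_) ?_ le_rfl) (Ev.seq
    (ev_loop_copy ho.pl hT (b - 1) 0 (by omega)) (Ev.seq
    (ev_glue (s := s.copyState b (b - 1)) (T := fun j => if j = 0 then 0 else 3 * b - 1) (v := 3 * b - 2) (u := b + (b - 1))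
      hq hg rfl rfl (congrArg some e) ho.pl ?_ ?_ ?_ ?_ ?_ ?_ ?_ ?_)
    (Ev.seq (ev_loop_direct (v := 3 * b - 1) (3 * b - 2) _ rfl rfl rfl (congrArg some e') ?_ ?_ ?_ ?_)
    (ev_unroot (v := 3 * b - 1) rfl rfl rfl (congrArg some e') ?_ rfl ?_)))))).of_eq ?_ ?_
  all_goals try simp only [copyState, Finset.mem_union, Finset.mem_range, Finset.mem_Ico, hbV, hlk, hdm,
      ne_eq, Option.some.injEq, St.mk.injEq, true_and, and_true]
  all_goals try omega
  · refine ⟨?_, ?_, ?_, by omega, by omega⟩ <;> ext j <;>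
      simp only [Finset.mem_union, Finset.mem_range, Finset.mem_Ico, Finset.mem_insert,
        Finset.mem_erase] <;> omega
  · rw [show b - 1 + 1 = b by omega, show b + (b - 1) + 1 = 2 * b by omega]
  · rw [show b - 1 + 1 = b by omega, Finset.Ico_self]
  · rw [if_neg (by omega)]
    omega
  · ext j
    simp only [Finset.mem_union, Finset.mem_range, Finset.mem_Ico, Finset.mem_insert]
    omega
  · ext j
    simp only [Finset.mem_Ico, Finset.mem_singleton]
    omega
  · intro j hj
    rw [if_neg (by omega)]
  · refine ⟨?_, ?_, ?_, hbl.symm, ho.one.symm, ho.two.symm, ho.pl.symm, ha.symm⟩ <;> ext j <;>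
      simp only [Finset.mem_union, Finset.mem_range, Finset.mem_Ico, Finset.mem_insert] <;> omega

theorem ev_restart (hs : s.Std M) (hq : s.q = M.q₀) (hpa : s.pa = .empty) (hh : s.hd < s.c)
    (ha : s.act ≠ 0) (hT : ∀ j < 3 ^ s.c, s.T j < 3 ^ s.c) :
    ∃ d : ℕ → Fin 3, (∀ i < s.c + 1, d i = 2) ∧
      Ev (restart M) s.toA (2 * s.c + 5 * 3 ^ s.c + 8) (.done {s with
        inp := 0, c := s.c + 1, dig := d, hd := 0, act := 0,
        bV := Finset.range (3 ^ (s.c + 1)), lk := Finset.range (3 ^ (s.c + 1) - 1),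
        dm := Finset.range (3 ^ (s.c + 1)),
        T := fun j => if j = 0 then 0 else 3 ^ (s.c + 1) - 1}.toA) := by
  have hc := hs.c
  have hb : 3 ^ 2 ≤ 3 ^ s.c := Nat.pow_le_pow_right (by omega) hc
  obtain ⟨d, h1, h2⟩ := ev_resetCache (M := M) (s := {s with inp := 0, act := 0, hd := 0})
    hq hs.grey hpa hs.red rfl (by simp only; omega)
  refine ⟨d, h1, (Ev.seq (ev_rewindTapes hq hs.grey hpa hs.red hs.blue hs.only ha) (Ev.seq h2
    (ev_resetBlockset (b := 3 ^ s.c) hq hs.grey hs.blue ⟨hs.only.1, hs.only.2, hs.only.3⟩ hs.aux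
      (by omega) hs.bV hs.lk hs.dm hT))).of_eq ?_ ?_⟩
  · rw [pow_succ, mul_comm _ 3]
  · simp only
    omega

end St

namespace St

variable {M : OfflineTM} {s : St}

/-- Digits beyond the cache and targets outside `dm` occur in no node or edge. -/
theorem same {d : ℕ → Fin 3} {T : ℕ → ℕ} (hd : ∀ i < s.c, s.dig i = d i)
    (hT : ∀ j ∈ s.dm, s.T j = T j) : s.toA.Same {s with dig := d, T := T}.toA where
  V_eq := rfl
  P_eq := rfl
  l_eq := by
    intro v hv
    cases v with
    | cache i => simp only [toA_l, l_cache, hd i (cache_mem_V.1 hv)]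
    | _ => rfl
  E_eq := by
    simp only [toA_E, E]
    rw [dashes_congr hT]

/-! ### Moving to another block -/

/-- Saving changes `T` only at the old active block, so the value loaded is the one stored for its
neighbour. The head must end on the last cache node, as it enters the new block from the right. -/
theorem ev_prevBlock {i : ℕ} (h : s.Std M) (hpa : s.pa = .empty) (hh : s.hd = 0)
    (ha : s.act = i + 1) (hT : s.T i < 3 ^ s.c) :
    ∃ d, ternary d s.c = s.T i ∧ Ev (prevBlock M) s.toA (3 ^ s.c * (8 * s.c + 9) + s.c + 5)
      (.done {s with
        dig := d, hd := s.c - 1, act := i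
        T := Function.update (Function.update s.T (i + 1) (ternary s.dig s.c)) i 0}.toA) := by
  have hc := h.c
  have hact := h.act
  have e : Function.update s.T s.act (ternary s.dig s.c) i = s.T i :=
    Function.update_of_ne (by omega) _ _
  obtain ⟨d, h1, h2⟩ := ev_decode (M := M) (s := {s with
      dig := fun j => if j < s.c then 0 else s.dig j
      T := Function.update s.T s.act (ternary s.dig s.c), hd := s.c - 1, act := i})
    ⟨h.q, h.grey, h.red, h.blue, ⟨h.only.1, h.only.2, h.only.3⟩, h.aux, h.bV, h.lk, h.dm,
      by simp only; omega, h.c⟩ (fun i hi => if_pos hi) (by simpa only [e] using hT)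
  refine ⟨d, h1.trans e, (Ev.seq (ev_encode h) (Ev.seq (ev_prev h.q h.grey ha ?_ h.blue h.only.1
    h.only.2 h.only.3) (Ev.seq (ev_loop_headRight (s.c - 1) _ h.q h.grey hpa h.red ?_)
    h2))).of_eq ?_ ?_⟩
  · simp only [h.lk, Finset.mem_range]
    omega
  · simp only
    omega
  · simp only [ha]
  · simp only
    have : 3 ^ s.c * (8 * s.c + 9) = 3 ^ s.c * (5 * s.c + 5) + 3 ^ s.c * (3 * s.c + 4) := by ring
    omega

theorem ev_nextBlock (h : s.Std M) (hpa : s.pa = .empty) (hh : s.hd + 1 = s.c)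
    (ha : s.act + 1 < 3 ^ s.c) (hT : s.T (s.act + 1) < 3 ^ s.c) :
    ∃ d, ternary d s.c = s.T (s.act + 1) ∧
      Ev (nextBlock M) s.toA (3 ^ s.c * (8 * s.c + 9) + s.c + 5)
      (.done {s with
        dig := d, hd := 0, act := s.act + 1
        T := Function.update (Function.update s.T s.act (ternary s.dig s.c)) (s.act + 1) 0}.toA) := by
  have hc := h.c
  have e : Function.update s.T s.act (ternary s.dig s.c) (s.act + 1) = s.T (s.act + 1) :=
    Function.update_of_ne (by omega) _ _
  obtain ⟨d, h1, h2⟩ := ev_decode (M := M) (s := {s with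
      dig := fun j => if j < s.c then 0 else s.dig j
      T := Function.update s.T s.act (ternary s.dig s.c), hd := 0, act := s.act + 1})
    ⟨h.q, h.grey, h.red, h.blue, ⟨h.only.1, h.only.2, h.only.3⟩, h.aux, h.bV, h.lk, h.dm,
      ha, h.c⟩ (fun i hi => if_pos hi) (by simpa only [e] using hT)
  refine ⟨d, h1.trans e, (Ev.seq (ev_encode h) (Ev.tte (ev_next h.q h.grey ?_ h.blue h.only.1
    h.only.2 h.only.3) (Ev.seq (ev_loop_headLeft s.hd _ h.q h.grey hpa h.red rfl) h2))).mono ?_⟩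
  · simp only [h.lk, Finset.mem_range]
    omega
  · simp only
    have : 3 ^ s.c * (8 * s.c + 9) = 3 ^ s.c * (5 * s.c + 5) + 3 ^ s.c * (3 * s.c + 4) := by ring
    omega

/-- The last block node has no right neighbour, so the else branch merely marks the central node;
the restart itself is triggered later by `flag`. -/
theorem ev_nextBlock_last (h : s.Std M) (ha : s.act + 1 = 3 ^ s.c) :
    Ev (nextBlock M) s.toA (3 ^ s.c * (5 * s.c + 5) + 4) (.done {s with
      grey := true, dig := fun j => if j < s.c then 0 else s.dig j,
      T := Function.update s.T s.act (ternary s.dig s.c)}.toA) := by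
  refine (Ev.seq (ev_encode h) (Ev.tte_fail (ev_next_fail ?_) (ev_setFlag h.q h.grey))).mono
    (by omega)
  simp only [h.lk, Finset.mem_range]
  omega

/-! ### Configurations -/

/-- The graph of the configuration `S` with `3 ^ c` blocks of `c` squares. -/
def conf (w : List (Fin 2)) (c : ℕ) (S : M.Conf) : St where
  w := w
  q := S.state
  grey := false
  inp := S.inPos
  c := c
  dig i := S.tape (S.pos / c * c + i)
  red := none
  hd := S.pos % c
  pa := .empty
  bV := Finset.range (3 ^ c)
  lk := Finset.range (3 ^ c - 1)
  dm := Finset.range (3 ^ c)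
  T j := if j = S.pos / c then 0 else content S.tape c j
  act := S.pos / c
  blue := none
  one := none
  two := none
  pl := none
  aux := none

variable {w : List (Fin 2)} {c : ℕ} {S S' : M.Conf}

theorem ternary_two (n : ℕ) : ternary (fun _ => 2) n = 3 ^ n - 1 := by
  induction n with
  | zero => rfl
  | succ n ih =>
    have : 0 < 3 ^ n := by positivity
    rw [ternary, ih, pow_succ, Fin.val_two]
    omega

theorem std_conf (hc : 1 < c) (h : S.pos < 3 ^ c * c) : (conf w c S).Std M :=
  ⟨S.state.2, rfl, rfl, rfl, ⟨rfl, rfl, rfl⟩, rfl, rfl, rfl, rfl,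
    Nat.div_lt_of_lt_mul (by rwa [mul_comm]), hc⟩

theorem conf_T_lt (j : ℕ) : (conf w c S).T j < 3 ^ c := by
  simp only [conf]
  split_ifs
  · positivity
  · exact content_lt ..

/-- A transition of the machine is split in two. Here `S'` keeps the position of the working head
(`hp`), and the move is only noted in `pa`. -/
theorem ev_transitions_conf {b : Fin 2} {y : Fin 3} {D₁ D₂ : Dir} (hc : 1 < c)
    (hw : w[S.inPos]? = some b) (hδ : M.δ S.state b (S.tape S.pos) = some (S'.state, y, D₁, D₂))
    (hD : D₁.move S.inPos = some S'.inPos) (hi : S'.inPos < w.length)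
    (ht : S'.tape = Function.update S.tape S.pos y) (hp : S'.pos = S.pos) :
    Ev (transitions M) (conf w c S).toA 1 (.done {conf w c S' with pa := D₂.atom}.toA) := by
  have e : S.pos / c * c + S.pos % c = S.pos := Nat.div_add_mod' ..
  refine (ev_transitions (s := conf w c S) (q := S.state) (p := S'.state) (y := y) (D₂ := D₂)
    rfl rfl rfl rfl hw ?_ hD hi).of_eq ?_ le_rfl
  · simpa only [conf, e] using hδ
  · simp only [conf, St.mk.injEq, true_and, and_true, ht, hp]
    constructor
    · funext j
      by_cases hj : j = S.pos % c
      · rw [hj, e, Function.update_self, Function.update_self]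
      · rw [Function.update_of_ne hj, Function.update_of_ne (by omega)]
    · funext j
      split_ifs with hj
      · rfl
      -- The written square belongs to the active block, so the values of all other blocks are
      -- unchanged.
      · rw [content_eq_ternary, content_eq_ternary]
        refine ternary_congr fun i hi => (Function.update_of_ne (fun h => hj ?_) _ _).symm
        rw [← h, add_comm, Nat.add_mul_div_right _ _ (by omega), Nat.div_eq_of_lt hi, zero_add]

/-- After loading, the cache is known only through its value; `ternary_inj` identifies its digits
with the symbols on the tape. -/
theorem same_conf {d : ℕ → Fin 3} {T : ℕ → ℕ} {s : St}
    (hs : s = {conf w c S' with dig := d, T := T})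
    (hd : ternary d c = content S'.tape c (S'.pos / c))
    (hT : ∀ j < 3 ^ c, T j = if j = S'.pos / c then 0 else content S'.tape c j) :
    s.toA.Same (conf w c S').toA := by
  subst hs
  rw [content_eq_ternary] at hd
  exact same (s := {conf w c S' with dig := d, T := T}) (ternary_inj hd)
    fun j hj => hT j (Finset.mem_range.1 hj)

theorem div_mod_eq {p j i : ℕ} (h : p = j * c + i) (hi : i < c) : p / c = j ∧ p % c = i := by
  subst h
  constructor
  · rw [add_comm, Nat.add_mul_div_right _ _ (by omega), Nat.div_eq_of_lt hi, zero_add]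
  · rw [add_comm, Nat.add_mul_mod_self_right, Nat.mod_eq_of_lt hi]

/-- A bound for the number of rule calls in the simulation of a transition. -/
def stepCost (c : ℕ) : ℕ := 3 ^ c * (8 * c + 14) + 2 * c + 30

/-- The first bound is for rounds that complete a transition, where saving and loading add up to `8
* c + 9` per block node; the second is for rounds that restart or fail. -/
theorem stepCost_ge (c : ℕ) : 3 ^ c * (8 * c + 9) + c + 15 ≤ stepCost c ∧
    3 ^ c * (5 * c + 5) + 5 * 3 ^ c + 2 * c + 25 ≤ stepCost c := by
  have h1 : 3 ^ c * (8 * c + 14) = 3 ^ c * (8 * c + 9) + 5 * 3 ^ c := by ring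
  have h2 : 3 ^ c * (8 * c + 9) = 3 ^ c * (5 * c + 5) + 3 ^ c * (3 * c + 4) := by ring
  simp only [stepCost]
  omega

/-- The part of `Simulate` after the first rule call. -/
def moves (M : OfflineTM) : Com :=
  tryDo (moveLeft M) ;; tryDo (moveRight M) ;;
    tryThen (left M) (prevBlock M) ;; tryThen (right M) (nextBlock M) ;;
    tryThen (flag M) (restart M)

-- One round of the main loop: head moves, restart, halting

theorem ev_moves_stay (hg : s.grey = false) (hpa : s.pa = .empty) :
    Ev (moves M) s.toA 5 (.done s.toA) :=
  Ev.seq (Ev.tryDo_fail (ev_moveLeft_fail (.inr (by simp [hpa])))) <|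
    Ev.seq (Ev.tryDo_fail (ev_moveRight_fail (.inr (by simp [hpa])))) <|
    Ev.seq (Ev.tryThen_fail (ev_left_fail (by simp [hpa]))) <|
    Ev.seq (Ev.tryThen_fail (ev_right_fail (by simp [hpa]))) <|
    Ev.tryThen_fail (ev_flag_fail hg)

theorem ev_moves_left {i : ℕ} (h : s.Std M) (hpa : s.pa = .L) (hh : s.hd = i + 1) :
    Ev (moves M) s.toA 5 (.done {s with hd := i, pa := .empty}.toA) :=
  Ev.seq (Ev.tryDo (ev_moveLeft h.q h.grey hh hpa h.red)) <|
    Ev.seq (Ev.tryDo_fail (ev_moveRight_fail (.inr (by simp)))) <|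
    Ev.seq (Ev.tryThen_fail (ev_left_fail (by simp))) <|
    Ev.seq (Ev.tryThen_fail (ev_right_fail (by simp))) <|
    Ev.tryThen_fail (ev_flag_fail h.grey)

theorem ev_moves_right (h : s.Std M) (hpa : s.pa = .R) (hh : s.hd + 1 < s.c) :
    Ev (moves M) s.toA 5 (.done {s with hd := s.hd + 1, pa := .empty}.toA) :=
  Ev.seq (Ev.tryDo_fail (ev_moveLeft_fail (.inr (by simp [hpa])))) <|
    Ev.seq (Ev.tryDo (ev_moveRight h.q h.grey hh hpa h.red)) <|
    Ev.seq (Ev.tryThen_fail (ev_left_fail (by simp))) <|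
    Ev.seq (Ev.tryThen_fail (ev_right_fail (by simp))) <|
    Ev.tryThen_fail (ev_flag_fail h.grey)

theorem ev_moves_prev {i : ℕ} (h : s.Std M) (hpa : s.pa = .L) (hh : s.hd = 0)
    (ha : s.act = i + 1) (hT : s.T i < 3 ^ s.c) :
    ∃ d, ternary d s.c = s.T i ∧ Ev (moves M) s.toA (3 ^ s.c * (8 * s.c + 9) + s.c + 10)
      (.done {s with
        pa := .empty, dig := d, hd := s.c - 1, act := i
        T := Function.update (Function.update s.T (i + 1) (ternary s.dig s.c)) i 0}.toA) := by
  obtain ⟨d, h1, h2⟩ := ev_prevBlock (s := {s with pa := .empty}) ⟨h.q, h.grey, h.red, h.blue,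
    ⟨h.only.1, h.only.2, h.only.3⟩, h.aux, h.bV, h.lk, h.dm, h.act, h.c⟩ rfl hh ha hT
  exact ⟨d, h1, (Ev.seq (Ev.tryDo_fail (ev_moveLeft_fail (.inl hh))) <|
    Ev.seq (Ev.tryDo_fail (ev_moveRight_fail (.inr (by simp [hpa])))) <|
    Ev.seq (Ev.tte (ev_left h.q h.grey hpa h.red) h2) <|
    Ev.seq (Ev.tryThen_fail (ev_right_fail (by simp))) <|
    Ev.tryThen_fail (ev_flag_fail h.grey)).mono (by simp only; omega)⟩

/-- Block `0` has no left neighbour, so `prev` fails, and a failure in the then part of `try` is not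
caught. The whole round fails, and the loop undoes what it has changed. -/
theorem ev_moves_fail (h : s.Std M) (hpa : s.pa = .L) (hh : s.hd = 0) (ha : s.act = 0) :
    Ev (moves M) s.toA (3 ^ s.c * (5 * s.c + 5) + 6) .fail :=
  (Ev.seq (Ev.tryDo_fail (ev_moveLeft_fail (.inl hh))) <|
    Ev.seq (Ev.tryDo_fail (ev_moveRight_fail (.inr (by simp [hpa])))) <|
    Ev.seq_fail (Ev.tte (ev_left h.q h.grey hpa h.red) <|
    Ev.seq (ev_encode (s := {s with pa := .empty}) ⟨h.q, h.grey, h.red, h.blue,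
      ⟨h.only.1, h.only.2, h.only.3⟩, h.aux, h.bV, h.lk, h.dm, h.act, h.c⟩) <|
    Ev.seq_fail (ev_prev_fail ha))).mono (by simp only; omega)

theorem ev_moves_next (h : s.Std M) (hpa : s.pa = .R) (hh : s.hd + 1 = s.c)
    (ha : s.act + 1 < 3 ^ s.c) (hT : s.T (s.act + 1) < 3 ^ s.c) :
    ∃ d, ternary d s.c = s.T (s.act + 1) ∧
      Ev (moves M) s.toA (3 ^ s.c * (8 * s.c + 9) + s.c + 10) (.done {s with
        pa := .empty, dig := d, hd := 0, act := s.act + 1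
        T := Function.update (Function.update s.T s.act (ternary s.dig s.c)) (s.act + 1) 0}.toA) := by
  obtain ⟨d, h1, h2⟩ := ev_nextBlock (s := {s with pa := .empty}) ⟨h.q, h.grey, h.red, h.blue,
    ⟨h.only.1, h.only.2, h.only.3⟩, h.aux, h.bV, h.lk, h.dm, h.act, h.c⟩ rfl hh ha hT
  exact ⟨d, h1, (Ev.seq (Ev.tryDo_fail (ev_moveLeft_fail (.inr (by simp [hpa])))) <|
    Ev.seq (Ev.tryDo_fail (ev_moveRight_fail (.inl (by omega)))) <|
    Ev.seq (Ev.tryThen_fail (ev_left_fail (by simp [hpa]))) <|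
    Ev.seq (Ev.tte (ev_right h.q h.grey hpa h.red) h2) <|
    Ev.tryThen_fail (ev_flag_fail h.grey)).mono (by simp only; omega)⟩

/-- Of the stored values only their bound is used: dashed edges must lead to existing block nodes in
order to be deleted during the copying. -/
theorem ev_moves_restart (h : s.Std M) (hpa : s.pa = .R) (hh : s.hd + 1 = s.c)
    (ha : s.act + 1 = 3 ^ s.c) (hT : ∀ j < 3 ^ s.c, s.T j < 3 ^ s.c) :
    ∃ d : ℕ → Fin 3, (∀ i < s.c + 1, d i = 2) ∧
      Ev (moves M) s.toA (3 ^ s.c * (5 * s.c + 5) + 5 * 3 ^ s.c + 2 * s.c + 17) (.done {s with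
        q := M.q₀, pa := .empty, inp := 0, c := s.c + 1, dig := d, hd := 0, act := 0
        bV := Finset.range (3 ^ (s.c + 1)), lk := Finset.range (3 ^ (s.c + 1) - 1),
        dm := Finset.range (3 ^ (s.c + 1)),
        T := fun j => if j = 0 then 0 else 3 ^ (s.c + 1) - 1}.toA) := by
  have hc := h.c
  have hb : 3 ^ 2 ≤ 3 ^ s.c := Nat.pow_le_pow_right (by omega) hc
  have h' : Std M {s with pa := .empty} := ⟨h.q, h.grey, h.red, h.blue,
    ⟨h.only.1, h.only.2, h.only.3⟩, h.aux, h.bV, h.lk, h.dm, h.act, h.c⟩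
  obtain ⟨d, h1, h2⟩ := ev_restart (M := M) (s := {s with
      q := M.q₀, grey := false, pa := .empty, dig := fun j => if j < s.c then 0 else s.dig j,
      T := Function.update s.T s.act (ternary s.dig s.c)})
    ⟨M.q₀.2, rfl, h.red, h.blue, ⟨h.only.1, h.only.2, h.only.3⟩, h.aux, h.bV, h.lk, h.dm,
      h.act, h.c⟩ rfl rfl (by simp only; omega) (by simp only; omega) (fun j hj => by
        simp only [Function.update_apply]
        split_ifs
        · exact ternary_lt ..
        · exact hT j hj)
  refine ⟨d, h1, (Ev.seq (Ev.tryDo_fail (ev_moveLeft_fail (.inr (by simp [hpa])))) <|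
    Ev.seq (Ev.tryDo_fail (ev_moveRight_fail (.inl (by omega)))) <|
    Ev.seq (Ev.tryThen_fail (ev_left_fail (by simp [hpa]))) <|
    Ev.seq (Ev.tte (ev_right h.q h.grey hpa h.red) (ev_nextBlock_last h' ha)) <|
    Ev.tte (ev_flag h.q rfl) h2).of_eq ?_ ?_⟩
  · simp only [h.grey]
  · simp only
    omega

/-- Within a block only the head edge moves. At a block boundary the old block is saved and the new
one loaded, and comparing `T` before and after shows that just these two entries change. -/
theorem ev_simulate (hc : 1 < c) (hS : S.pos < 3 ^ c * c) (h : M.Trans w S S')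
    (hS' : S'.pos < 3 ^ c * c) :
    Ev (simulate M) (conf w c S).toA (stepCost c) (.done (conf w c S').toA) := by
  obtain ⟨b, y, D₁, D₂, hw, hδ, hD, hi, hp, ht⟩ := h
  have hcost := (stepCost_ge c).1
  -- The intermediate configuration: everything is as in `S'`, but the working head has not moved
  -- yet.
  set S₁ : M.Conf := ⟨S'.state, S'.inPos, S'.tape, S.pos⟩ with hS₁
  have h1 := ev_transitions_conf (S := S) (S' := S₁) hc hw hδ hD hi ht rfl
  obtain ⟨q₁, q₂, q₃, q₄, q₅, q₆, q₇, q₈, q₉, q₁₀⟩ := std_conf (M := M) (w := w) (S := S₁) hc hS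
  have hstd : Std M {conf w c S₁ with pa := D₂.atom} :=
    ⟨q₁, q₂, q₃, q₄, ⟨q₅.1, q₅.2, q₅.3⟩, q₆, q₇, q₈, q₉, q₁₀, hc⟩
  have e : S.pos = S.pos / c * c + S.pos % c := (Nat.div_add_mod' ..).symm
  have hlt : S.pos % c < c := Nat.mod_lt _ (by omega)
  cases D₂ with
  | S =>
    have hp : S.pos = S'.pos := by simpa [Dir.move] using hp
    refine (Ev.seq h1 (ev_moves_stay rfl rfl)).of_eq ?_ (by omega)
    simp only [conf, hS₁, Dir.atom, hp]
  | L =>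
    have hp : S.pos = S'.pos + 1 := by
      revert hp
      generalize S.pos = p
      rcases p with _ | p
      · simp [Dir.move]
      · simp [Dir.move]
    -- Offset `0` means that the head leaves its block to the left; the position is positive, so
    -- there is a block to the left.
    rcases hm : S.pos % c with _ | i
    · obtain ⟨j, hj⟩ : ∃ j, S.pos / c = j + 1 := Nat.exists_eq_succ_of_ne_zero fun h => by
        rw [h] at e
        omega
      rw [hj, add_mul] at e
      obtain ⟨h2, h3⟩ := div_mod_eq (c := c) (p := S'.pos) (j := j) (i := c - 1) (by omega)
        (by omega)
      obtain ⟨d, h4, h5⟩ := ev_moves_prev hstd rfl hm hj (conf_T_lt (w := w) j)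
      refine ((Ev.seq h1 h5).congr_done (same_conf (d := d) (T := Function.update (Function.update
        (conf w c S₁).T (j + 1) (ternary (conf w c S₁).dig c)) j 0) ?_ ?_ ?_)).mono ?_
      · simp only [conf, hS₁, h2, h3]
      · refine h4.trans ?_
        simp only [conf, hS₁, hj, h2]
        rw [if_neg (by omega)]
      -- Block `j` has become active and points to block `0`, block `j + 1` now stores its content,
      -- and all others keep their targets.
      · intro i _
        rw [h2]
        by_cases h6 : i = j
        · simp [h6]
        · rw [Function.update_of_ne h6, if_neg h6]
          by_cases h7 : i = j + 1
          · rw [h7, Function.update_self, content_eq_ternary]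
            simp only [conf, hS₁, hj]
          · rw [Function.update_of_ne h7]
            simp only [conf, hS₁, hj, if_neg h7]
      · simp only [conf]
        omega
    · obtain ⟨h2, h3⟩ := div_mod_eq (c := c) (p := S'.pos) (j := S.pos / c) (i := i)
        (by omega) (by omega)
      refine (Ev.seq h1 (ev_moves_left hstd rfl hm)).of_eq ?_ (by omega)
      simp only [conf, hS₁, h2, h3]
  | R =>
    have hp : S'.pos = S.pos + 1 := by simpa [Dir.move, eq_comm] using hp
    by_cases hm : S.pos % c + 1 = c
    · have e' : S'.pos = (S.pos / c + 1) * c + 0 := by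
        rw [add_mul]
        omega
      obtain ⟨h2, h3⟩ := div_mod_eq (c := c) e' (by omega)
      have hj : S.pos / c + 1 < 3 ^ c := by
        rw [← h2]
        exact Nat.div_lt_of_lt_mul (by rwa [mul_comm])
      obtain ⟨d, h4, h5⟩ := ev_moves_next hstd rfl hm hj (conf_T_lt (w := w) _)
      refine ((Ev.seq h1 h5).congr_done (same_conf (d := d) (T := Function.update (Function.update
        (conf w c S₁).T (S.pos / c) (ternary (conf w c S₁).dig c)) (S.pos / c + 1) 0)
        ?_ ?_ ?_)).mono ?_
      · simp only [conf, hS₁, h2, h3]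
      · refine h4.trans ?_
        simp only [conf, hS₁, h2]
        rw [if_neg (by omega)]
      · intro i _
        rw [h2]
        by_cases h6 : i = S.pos / c + 1
        · simp [h6]
        · rw [Function.update_of_ne h6, if_neg h6]
          by_cases h7 : i = S.pos / c
          · rw [h7, Function.update_self, content_eq_ternary]
            rfl
          · rw [Function.update_of_ne h7]
            simp only [conf, hS₁, if_neg h7]
      · simp only [conf]
        omega
    · obtain ⟨h2, h3⟩ := div_mod_eq (c := c) (p := S'.pos) (j := S.pos / c) (i := S.pos % c + 1)
        (by omega) (by omega)
      refine (Ev.seq h1 (ev_moves_right hstd rfl (Nat.lt_of_le_of_ne hlt hm))).of_eq ?_ (by omega)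
      simp only [conf, hS₁, h2, h3]

/-- One transition can leave the represented squares only by a move to the right from the last of
them. The restart discards the computation and yields the initial configuration with blocks of `c +
1` squares. -/
theorem ev_simulate_restart (hc : 1 < c) (hS : S.pos < 3 ^ c * c) (h : M.Trans w S S')
    (hS' : 3 ^ c * c ≤ S'.pos) :
    Ev (simulate M) (conf w c S).toA (stepCost c) (.done (conf w (c + 1) M.init).toA) := by
  obtain ⟨b, y, D₁, D₂, hw, hδ, hD, hi, hp, ht⟩ := h
  have hcost := (stepCost_ge c).2
  set S₁ : M.Conf := ⟨S'.state, S'.inPos, S'.tape, S.pos⟩ with hS₁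
  have h1 := ev_transitions_conf (S := S) (S' := S₁) hc hw hδ hD hi ht rfl
  obtain ⟨q₁, q₂, q₃, q₄, q₅, q₆, q₇, q₈, q₉, q₁₀⟩ := std_conf (M := M) (w := w) (S := S₁) hc hS
  have hstd : Std M {conf w c S₁ with pa := D₂.atom} :=
    ⟨q₁, q₂, q₃, q₄, ⟨q₅.1, q₅.2, q₅.3⟩, q₆, q₇, q₈, q₉, q₁₀, hc⟩
  have e : S.pos = S.pos / c * c + S.pos % c := (Nat.div_add_mod' ..).symm
  have hp' : D₂ = .R ∧ S.pos + 1 = 3 ^ c * c := by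
    rcases D₂ with _ | _ | _
    · revert hp
      rcases hq : S.pos with _ | p
      · simp [Dir.move]
      · simp only [Dir.move, Option.some.injEq]
        omega
    · simp only [Dir.move, Option.some.injEq] at hp
      exact ⟨rfl, by omega⟩
    · simp only [Dir.move, Option.some.injEq] at hp
      omega
  obtain ⟨rfl, hp'⟩ := hp'
  obtain ⟨b', hb'⟩ : ∃ b', 3 ^ c = b' + 1 :=
    Nat.exists_eq_succ_of_ne_zero (pow_ne_zero _ (by omega))
  -- The last square has offset `c - 1` in the block with index `3 ^ c - 1`.
  obtain ⟨h2, h3⟩ := div_mod_eq (c := c) (p := S.pos) (j := b') (i := c - 1)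
    (by rw [hb', add_mul] at hp'; omega) (by omega)
  obtain ⟨d, h4, h5⟩ := ev_moves_restart hstd rfl (by simp only [conf, hS₁, h3]; omega)
    (by simp only [conf, hS₁, h2, hb']) (fun j _ => conf_T_lt (w := w) j)
  refine ((Ev.seq h1 h5).congr_done (same_conf (d := d)
    (T := fun j => if j = 0 then 0 else 3 ^ (c + 1) - 1) ?_ ?_ ?_)).mono ?_
  · simp only [conf, hS₁, OfflineTM.init, Nat.zero_div, Nat.zero_mod]
  · rw [content_eq_ternary]
    exact ternary_congr h4
  · intro j _
    simp only [OfflineTM.init, Nat.zero_div]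
    rw [content_eq_ternary, ternary_two]
  · simp only [conf]
    omega

/-- If no table entry applies or the input head would leave its tape, the first call fails.
Otherwise the working head would move to the left from square `0`, which makes `prev` fail later in
the round. -/
theorem ev_simulate_fail (hc : 1 < c) (hS : S.pos < 3 ^ c * c) (h : ¬ ∃ S', M.Trans w S S') :
    Ev (simulate M) (conf w c S).toA (stepCost c) .fail := by
  have hcost := (stepCost_ge c).2
  by_cases hne : ∃ b p y D₁ D₂ i, w[S.inPos]? = some b ∧
      M.δ S.state b (S.tape S.pos) = some (p, y, D₁, D₂) ∧ D₁.move S.inPos = some i ∧ i < w.length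
  · obtain ⟨b, p, y, D₁, D₂, i, hw, hδ, hD, hi⟩ := hne
    have hp : D₂.move S.pos = none := by
      by_contra hne
      obtain ⟨j, hj⟩ := Option.ne_none_iff_exists'.1 hne
      exact h ⟨⟨p, i, Function.update S.tape S.pos y, j⟩, b, y, D₁, D₂, hw, hδ, hD, hi, hj, rfl⟩
    set S₁ : M.Conf := ⟨p, i, Function.update S.tape S.pos y, S.pos⟩ with hS₁
    have h1 := ev_transitions_conf (S := S) (S' := S₁) hc hw hδ hD hi rfl rfl
    obtain ⟨q₁, q₂, q₃, q₄, q₅, q₆, q₇, q₈, q₉, q₁₀⟩ := std_conf (M := M) (w := w) (S := S₁) hc hS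
    have hstd : Std M {conf w c S₁ with pa := D₂.atom} :=
      ⟨q₁, q₂, q₃, q₄, ⟨q₅.1, q₅.2, q₅.3⟩, q₆, q₇, q₈, q₉, q₁₀, hc⟩
    have h0 : D₂ = .L ∧ S.pos = 0 := by
      rcases D₂ with _ | _ | _ <;> simp_all only [Dir.move, reduceCtorEq, true_and]
      generalize S.pos = p at hp
      cases p <;> simp_all
    obtain ⟨rfl, h0⟩ := h0
    refine (Ev.seq h1 (ev_moves_fail hstd rfl ?_ ?_)).mono ?_
    · simp [conf, hS₁, h0]
    · simp [conf, hS₁, h0]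
    · simp only [conf]
      omega
  · refine (Ev.seq_fail (ev_transitions_fail (s := conf w c S) (q := S.state) rfl rfl ?_)).mono
      (by omega)
    intro a p y D₁ D₂ i hw hδ hD
    by_contra hi
    refine hne ⟨a, p, y, D₁, D₂, i, hw, ?_, hD, not_le.1 hi⟩
    simpa only [conf, Nat.div_add_mod'] using hδ

end St

/-! ### Input graphs and configuration graphs -/

theorem chain_eq_links (f : ℕ → Node) (n : ℕ) :
    (chain f n : Multiset (Edge Node)) = links f (Finset.range (n - 1)) := by
  simp only [chain]
  generalize n - 1 = m
  induction m with
  | zero => rfl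
  | succ m ih =>
    rw [List.range_succ, List.flatMap_append, ← Multiset.coe_add, ih, Finset.range_add_one,
      links_insert Finset.notMem_range_self, add_assoc]
    rfl

theorem dashes_eq_list (n : ℕ) (T : ℕ → ℕ) :
    ((List.range n).map fun j => eDash (Node.block j) (Node.block (T j)) :
      Multiset (Edge Node)) = dashes (Finset.range n) T :=
  rfl

/-- A graph without the requirement that roots and ends of edges are nodes. -/
def Graph.toA {N : Type} (G : Graph N) : AGraph N := ⟨G.V, G.P, G.l, G.E⟩

theorem Graph.iso_iff_rep {N : Type} {G : Graph N} {H : HostGraph} : G.Iso H ↔ G.toA.Rep H :=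
  ⟨fun h => ⟨⟨G.root_mem, G.edge_mem⟩, h⟩, fun h => h.2⟩

theorem AGraph.Same.symm {N : Type} {A B : AGraph N} (h : A.Same B) : B.Same A :=
  ⟨h.1.symm, h.2.symm, fun v hv => (h.3 v (h.1 ▸ hv)).symm, h.4.symm⟩

variable {M : OfflineTM} {w : List (Fin 2)}

theorem encGraph_same {k : ℕ} {S : M.Conf} (h : Fits w k S) :
    (encGraph w k S h).toA.Same (St.conf w (k + 2) S).toA where
  V_eq := rfl
  P_eq := rfl
  l_eq := by
    rintro (_ | i | i | i) _ <;> rfl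
  E_eq := by
    simp only [Graph.toA, encGraph, ← Multiset.coe_add, chain_eq_links, St.toA_E, St.E, St.conf,
      dashes_eq_list (3 ^ (k + 2))
        fun j => if j = S.pos / (k + 2) then 0 else content S.tape (k + 2) j]
    simp only [← Multiset.cons_coe, ← Multiset.singleton_add, Multiset.coe_nil, St.auxE,
      show k + 2 - 1 = k + 1 from rfl]
    abel

theorem encodes_iff {k : ℕ} {S : M.Conf} (h : Fits w k S) {G : HostGraph} :
    Encodes w k S G ↔ (St.conf w (k + 2) S).toA.Rep G := by
  constructor
  · rintro ⟨_, hG⟩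
    exact (Graph.iso_iff_rep.1 hG).congr (encGraph_same h)
  · exact fun hG => ⟨h, Graph.iso_iff_rep.2 (hG.congr (encGraph_same h).symm)⟩

theorem fits_init {k : ℕ} (hw : w ≠ []) : Fits w k M.init :=
  ⟨List.length_pos_of_ne_nil hw, by simp [OfflineTM.init], fun _ _ => rfl⟩

attribute [local simp] rt nd asg

theorem ev_setup (hw : w ≠ []) : Ev (setup M) (inputGraph M w hw).toA 1
    (.done (St.conf w 2 M.init).toA) := by
  refine Ev.call ?_ ?_ ?_
  · rintro _ rfl
    exact mkRule_K (by simp)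
  · intro wf
    refine ⟨_, rfl, asg [.center], .intro (by simp) (by simp) ?_ (by simp) (by simp)⟩
    simp [Graph.toA, inputGraph]
  · rintro _ rfl g wf hm
    obtain ⟨-, h5, -⟩ := hm.elim (by simp)
    have g0 : g 0 = .center := by
      simp [Graph.toA, inputGraph] at h5
      exact h5.2.2
    refine ⟨asg [.center, .block 0, .block 1, .block 2, .block 3, .block 4, .block 5, .block 6,
      .block 7, .block 8, .cache 0, .cache 1],
      AGraph.Result.intro (by simp) (by simp [g0]) [1, 2, 3, 4, 5, 6, 7, 8, 9, 10, 11] ?_ ?_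
        ?_ ?_ ?_ ?_ ?_⟩
    · simp
      omega
    · simp
    · simp [Graph.toA, inputGraph]
    · ext (_ | k | k | k)
      · simp [Graph.toA, inputGraph]
      · simp [Graph.toA, inputGraph, St.conf]
      · simp [Graph.toA, inputGraph, St.conf]
        omega
      · simp [Graph.toA, inputGraph, St.conf]
        omega
    · have h1 : dashes (Finset.range (3 ^ 2)) (St.conf w 2 M.init).T =
          dashes (Finset.range 9) fun j => if j = 0 then 0 else 8 :=
        dashes_congr fun j _ => by
          simp only [St.conf, OfflineTM.init, content_eq_ternary, St.ternary_two, Nat.zero_div]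
          rfl
      simp only [Graph.toA, inputGraph, ← Multiset.coe_add, chain_eq_links, St.toA_E, St.E]
      simp only [← Multiset.cons_coe, ← Multiset.singleton_add, Multiset.coe_nil]
      rw [show (St.conf w 2 M.init).dm = Finset.range (3 ^ 2) from rfl, h1]
      simp only [St.conf, St.auxE, OfflineTM.init, Nat.reducePow, Nat.reduceSub,
        ← dashes_eq_list, ← chain_eq_links .block 9, ← chain_eq_links .cache 2]
      simp only [show ∀ u v : ℕ, link u v = [eRight u v, eLeft v u] from fun _ _ => rfl,
        List.cons_append, List.nil_append, List.map, List.sum_cons, List.sum_nil, Edge.map_std]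
      simp only [asg, List.getD_cons_zero, List.getD_cons_succ, chain, link, List.range,
        List.range.loop, List.flatMap_cons, List.flatMap_nil, Nat.reduceSub, Nat.reduceAdd,
        List.map, List.cons_append, List.nil_append, List.append_nil, reduceIte,
        OfNat.ofNat_ne_zero, one_ne_zero, Nat.zero_div, Nat.zero_mod]
      simp only [← Multiset.cons_coe, ← Multiset.singleton_add, Multiset.coe_nil]
      abel
    · rintro (_ | k | k | k) hk
      · simp at hk
      · exact ⟨fun _ => rfl, by simp [Graph.toA, inputGraph, St.conf]⟩
      · simp [Graph.toA, inputGraph, St.conf]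
      · simp [Graph.toA, inputGraph, St.conf]
    · simp [St.l_center, St.l_block, St.l_cache, St.conf, OfflineTM.init, num]

end SGP2

namespace SGP2

variable {M : OfflineTM} {w : List (Fin 2)} {k : ℕ} {S S' : M.Conf}

/-! ### Runs of the machine -/

theorem Fits.trans (h : Fits w k S) (hS : M.Trans w S S') (hp : S'.pos < 3 ^ (k + 2) * (k + 2)) :
    Fits w k S' := by
  obtain ⟨a, b, D₁, D₂, -, -, -, h1, -, h2⟩ := hS
  refine ⟨h1, hp, fun i hi => ?_⟩
  rw [h2, Function.update_of_ne (by have := h.pos_lt; omega), h.blank i hi]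

/-- Three times as many blocks, each longer by one square. This growth lets the next configuration
fit after one enlargement and makes the sum of the costs geometric. -/
theorem three_mul_size_le (k : ℕ) :
    3 * (3 ^ (k + 2) * (k + 2)) ≤ 3 ^ (k + 1 + 2) * (k + 1 + 2) := by
  have : 3 ^ (k + 1 + 2) * (k + 1 + 2) = 3 * (3 ^ (k + 2) * (k + 2)) + 3 ^ (k + 1 + 2) := by ring
  rw [this]
  exact Nat.le_add_right ..

theorem Fits.succ (h : Fits w k S) : Fits w (k + 1) S := by
  have := three_mul_size_le k
  exact ⟨h.inPos_lt, h.pos_lt.trans_le (by omega), fun i hi => h.blank i (by omega)⟩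

theorem trans_pos_le (h : M.Trans w S S') : S'.pos ≤ S.pos + 1 := by
  obtain ⟨a, b, D₁, D₂, -, -, -, -, h, -⟩ := h
  rcases D₂ with _ | _ | _
  · revert h
    rcases S.pos with _ | p
    · simp [Dir.move]
    · simp only [Dir.move, Option.some.injEq]
      omega
  · simp only [Dir.move, Option.some.injEq] at h
    omega
  · simp only [Dir.move, Option.some.injEq] at h
    omega

theorem Fits.succ_trans (h : Fits w k S) (hS : M.Trans w S S') : Fits w (k + 1) S' := by
  refine h.succ.trans hS ?_
  have := three_mul_size_le k
  have := h.pos_lt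
  have := trans_pos_le hS
  omega

/-- `r 0, …, r m` is a run of the machine on the input `w`. -/
def IsRun (w : List (Fin 2)) (m : ℕ) (r : ℕ → M.Conf) : Prop :=
  r 0 = M.init ∧ ∀ i < m, M.Trans w (r i) (r (i + 1))

theorem IsRun.extend {m : ℕ} {r : ℕ → M.Conf} (h : IsRun w m r) (hS : M.Trans w (r m) S') :
    IsRun w (m + 1) (Function.update r (m + 1) S') := by
  refine ⟨(Function.update_of_ne (by omega) _ _).trans h.1, fun i hi => ?_⟩
  rw [Function.update_of_ne (by omega)]
  rcases Nat.lt_succ_iff_lt_or_eq.1 hi with hi | rfl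
  · rw [Function.update_of_ne (by omega)]
    exact h.2 i hi
  · rw [Function.update_self]
    exact hS

/-- As a sequence, the run gives access to all earlier configurations, which a restart has to
repeat. -/
theorem exists_isRun {m : ℕ} (h : M.Reach w m S) : ∃ r, IsRun w m r ∧ r m = S := by
  induction h with
  | init => exact ⟨fun _ => M.init, ⟨rfl, by omega⟩, rfl⟩
  | @step m S S' _ hS ih =>
    obtain ⟨r, hr, rfl⟩ := ih
    exact ⟨_, hr.extend hS, Function.update_self ..⟩

/-! ### Simulation of runs -/

theorem Ev.exists_derives {P : Com} {A B : AGraph Node} {n : ℕ} (h : Ev P A n (.done B))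
    {G : HostGraph} (hG : A.Rep G) : ∃ m H, Derives (.run P G) m (.done H) ∧ B.Rep H := by
  obtain ⟨m, δ, h1, -, h2⟩ := (h G hG).exists_derives
  cases δ with
  | done H => exact ⟨m, H, h1, h2⟩
  | run P H => exact h2.elim
  | fail => exact h2.elim

theorem Ev.exists_derives_loop {P : Com} {A B : AGraph Node} {n : ℕ} (h : Ev P A n (.done B))
    {G : HostGraph} (hG : A.Rep G) :
    ∃ m H, Derives (.run (.loop P) G) m (.run (.loop P) H) ∧ B.Rep H := by
  obtain ⟨m, H, h1, h2⟩ := h.exists_derives hG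
  exact ⟨m, H, .single (.alap₁ h1), h2⟩

theorem Derives.of_call {R : Set Rule} {G H : HostGraph} {m : ℕ}
    (h : Derives (.run (.call R) G) m (.done H)) : SetApplies R G H := by
  cases h with
  | head hs h =>
    cases hs with
    | call₁ h1 =>
      cases h with
      | refl => exact h1
      | head hs _ => exact absurd ⟨_, _, hs⟩ (terminal_done _)
    | call₂ h1 =>
      cases h with
      | head hs _ => exact absurd ⟨_, _, hs⟩ terminal_fail

theorem derives_setup {hw : w ≠ []} {G : HostGraph} (hG : (inputGraph M w hw).Iso G) :
    ∃ G₀ m, Encodes w 0 M.init G₀ ∧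
      Derives (.run (sim M) G) m (.run (.loop (simulate M)) G₀) := by
  obtain ⟨m, H, h1, h2⟩ := (ev_setup hw).exists_derives (Graph.iso_iff_rep.1 hG)
  exact ⟨H, 1, (encodes_iff (fits_init hw)).2 h2, .single (.seq₂ (.call₁ h1.of_call))⟩

section Run

variable {m : ℕ} {r : ℕ → M.Conf}

/-- If a run fits, then it is simulated without a restart. -/
theorem exists_derives_run (hr : IsRun w m r) {n : ℕ} (hn : n ≤ m) (hf : ∀ i ≤ n, Fits w k (r i))
    {G : HostGraph} (hG : Encodes w k M.init G) : ∃ a H, Encodes w k (r n) H ∧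
      Derives (.run (.loop (simulate M)) G) a (.run (.loop (simulate M)) H) := by
  induction n with
  | zero => exact ⟨0, G, hr.1.symm ▸ hG, .refl _⟩
  | succ n ih =>
    obtain ⟨a, H, h1, h2⟩ := ih (by omega) fun i hi => hf i (by omega)
    obtain ⟨b, H', h3, h4⟩ := (St.ev_simulate (by omega) (hf n (by omega)).pos_lt
      (hr.2 n hn) (hf (n + 1) le_rfl).pos_lt).exists_derives_loop
      ((encodes_iff (hf n (by omega))).1 h1)
    exact ⟨_, H', (encodes_iff (hf _ le_rfl)).2 h4, h2.trans h3⟩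

/-- Before a transition, restart if its result does not fit. -/
theorem exists_derives_fits (hw : w ≠ []) (hr : IsRun w m r) {n : ℕ} (hn : n < m) {G : HostGraph}
    (hf : ∀ i ≤ n, Fits w k (r i)) (hG : Encodes w k (r n) G) :
    ∃ k a H, (∀ i ≤ n + 1, Fits w k (r i)) ∧ Encodes w k (r n) H ∧
      Derives (.run (.loop (simulate M)) G) a (.run (.loop (simulate M)) H) := by
  by_cases hp : (r (n + 1)).pos < 3 ^ (k + 2) * (k + 2)
  · refine ⟨k, 0, G, fun i hi => ?_, hG, .refl _⟩
    rcases Nat.lt_succ_iff_lt_or_eq.1 (Nat.lt_succ_of_le hi) with hi | rfl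
    · exact hf i (by omega)
    · exact (hf n le_rfl).trans (hr.2 n hn) hp
  · have h4 : ∀ i ≤ n + 1, Fits w (k + 1) (r i) := fun i hi => by
      rcases Nat.lt_succ_iff_lt_or_eq.1 (Nat.lt_succ_of_le hi) with hi | rfl
      · exact (hf i (by omega)).succ
      · exact (hf n le_rfl).succ_trans (hr.2 n hn)
    obtain ⟨b, H₁, h5, h6⟩ := (St.ev_simulate_restart (by omega) (hf n le_rfl).pos_lt (hr.2 n hn)
      (not_lt.1 hp)).exists_derives_loop ((encodes_iff (hf n le_rfl)).1 hG)
    obtain ⟨c, H₂, h7, h8⟩ := exists_derives_run hr hn.le (fun i hi => h4 i (by omega))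
      ((encodes_iff (k := k + 1) (fits_init hw)).2 h6)
    exact ⟨k + 1, _, H₂, h4, h7, h5.trans h8⟩

/-- The invariant is that `k` fits one configuration more than has been reached. After each
simulated transition, `exists_derives_fits` restores it, if necessary by a restart and a repetition
of the run. -/
theorem exists_derives_restart (hw : w ≠ []) (hr : IsRun w m r) {G : HostGraph}
    (hG : Encodes w 0 M.init G) {n : ℕ} (hn : n < m) : ∃ k a H, (∀ i ≤ n + 1, Fits w k (r i)) ∧
      Encodes w k (r n) H ∧
      Derives (.run (.loop (simulate M)) G) a (.run (.loop (simulate M)) H) := by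
  induction n with
  | zero =>
    refine exists_derives_fits hw hr hn (fun i hi => ?_) (hr.1.symm ▸ hG)
    rw [Nat.le_zero.1 hi, hr.1]
    exact fits_init hw
  | succ n ih =>
    obtain ⟨k, a, H, h1, h2, h3⟩ := ih (by omega)
    obtain ⟨b, H₁, h4, h5⟩ := (St.ev_simulate (by omega) (h1 n (by omega)).pos_lt
      (hr.2 n (by omega)) (h1 (n + 1) le_rfl).pos_lt).exists_derives_loop
      ((encodes_iff (h1 n (by omega))).1 h2)
    obtain ⟨k', c, H₂, h6, h7, h8⟩ := exists_derives_fits hw hr hn h1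
      ((encodes_iff (h1 _ le_rfl)).2 h5)
    exact ⟨k', _, H₂, h6, h7, (h3.trans h4).trans h8⟩

end Run

theorem simulates (M : OfflineTM) : Simulates M (simulate M) := by
  intro w hw G₀ hG m S S' hS hS'
  obtain ⟨r, hr, rfl⟩ := exists_isRun hS
  -- Extending the run by `S'` forces a `k` that fits both configurations.
  obtain ⟨k, a, G, h1, h2, h3⟩ := exists_derives_restart hw (hr.extend hS') hG m.lt_succ_self
  have h4 := h1 m (by omega)
  have h5 := h1 (m + 1) le_rfl
  rw [Function.update_of_ne (by omega)] at h2 h4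
  rw [Function.update_self] at h5
  obtain ⟨b, G', h6, h7⟩ := (St.ev_simulate (by omega) h4.pos_lt hS' h5.pos_lt).exists_derives
    ((encodes_iff h4).1 h2)
  exact ⟨k, G, G', a, b, h2, (encodes_iff h5).2 h7, h3, h6⟩

/-! ### The running time -/

section Time

variable {m : ℕ} {r : ℕ → M.Conf}

theorem pos_le_of_isRun (hr : IsRun w m r) {i : ℕ} (hi : i ≤ m) : (r i).pos ≤ i := by
  induction i with
  | zero => simp [hr.1, OfflineTM.init]
  | succ i ih => exact (trans_pos_le (hr.2 i hi)).trans (Nat.succ_le_succ (ih (by omega)))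

/-- Take the first configuration that does not fit. It is not the initial one, and its predecessor
fits, so among the conditions of `Fits` only the one on the position of the head can be violated. -/
theorem le_pos_of_not_fits (hw : w ≠ []) (hr : IsRun w m r) (h : ¬ ∀ i ≤ m, Fits w k (r i)) :
    ∃ j < m, (∀ i ≤ j, Fits w k (r i)) ∧ 3 ^ (k + 2) * (k + 2) ≤ (r (j + 1)).pos := by
  classical
  have hex : ∃ i, i ≤ m ∧ ¬ Fits w k (r i) := by simpa only [not_forall, exists_prop] using h
  obtain ⟨h1, h2⟩ := Nat.find_spec hex
  have h3 : ∀ i < Nat.find hex, Fits w k (r i) := fun i hi => by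
    have := Nat.find_min hex hi
    by_contra hne
    exact this ⟨by omega, hne⟩
  generalize Nat.find hex = n at h1 h2 h3
  rcases n with _ | j
  · exact absurd (hr.1.symm ▸ fits_init hw) h2
  · refine ⟨j, h1, fun i hi => h3 i (by omega), ?_⟩
    by_contra hp
    exact h2 ((h3 j (by omega)).trans (hr.2 j h1) (not_le.1 hp))

/-- The last phase, with enough space for the whole run: `n` transitions remain, and a failing round
ends the loop. -/
theorem ev_loop_halt (hr : IsRun w m r) (hh : ¬ ∃ S', M.Trans w (r m) S')
    (hf : ∀ i ≤ m, Fits w k (r i)) (n : ℕ) : ∀ i, i + n = m →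
    Ev (.loop (simulate M)) (St.conf w (k + 2) (r i)).toA ((n + 1) * St.stepCost (k + 2))
      (.done (St.conf w (k + 2) (r m)).toA) := by
  induction n with
  | zero =>
    rintro i rfl
    exact (Ev.loop_fail (St.ev_simulate_fail (by omega) (hf _ le_rfl).pos_lt hh)).mono (by omega)
  | succ n ih =>
    intro i hi
    refine (Ev.loop (St.ev_simulate (by omega) (hf i (by omega)).pos_lt (hr.2 i (by omega))
      (hf (i + 1) (by omega)).pos_lt) (ih (i + 1) (by omega))).mono (le_of_eq (by ring))

/-- A phase with too little space: the transition from `r j` triggers the restart, after which the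
bound `N` for the next size takes over. -/
theorem ev_loop_restart (hr : IsRun w m r) {j : ℕ} (hj : j < m) (hf : ∀ i ≤ j, Fits w k (r i))
    (hp : 3 ^ (k + 2) * (k + 2) ≤ (r (j + 1)).pos) {N : ℕ} {B : AGraph Node}
    (h : Ev (.loop (simulate M)) (St.conf w (k + 1 + 2) M.init).toA N (.done B)) (n : ℕ) :
    ∀ i, i + n = j →
    Ev (.loop (simulate M)) (St.conf w (k + 2) (r i)).toA ((n + 1) * St.stepCost (k + 2) + N)
      (.done B) := by
  induction n with
  | zero =>
    rintro i rfl
    exact (Ev.loop (St.ev_simulate_restart (by omega) (hf _ le_rfl).pos_lt (hr.2 _ hj) hp)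
      h).mono (by omega)
  | succ n ih =>
    intro i hi
    refine (Ev.loop (St.ev_simulate (by omega) (hf i (by omega)).pos_lt (hr.2 i (by omega))
      (hf (i + 1) (by omega)).pos_lt) (ih (i + 1) (by omega))).mono (le_of_eq (by ring))

/-- By minimality of `K`, every smaller size ends in a restart from the beginning of the run. Here
`n` enlargements are still to come, and each phase has at most `m + 1` rounds. -/
theorem ev_loop_simulate (hw : w ≠ []) (hr : IsRun w m r) (hh : ¬ ∃ S', M.Trans w (r m) S')
    {K : ℕ} (hf : ∀ i ≤ m, Fits w K (r i)) (hK : ∀ k < K, ¬ ∀ i ≤ m, Fits w k (r i)) (n : ℕ) :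
    ∀ k, k + n = K → Ev (.loop (simulate M)) (St.conf w (k + 2) M.init).toA
      ((m + 1) * ∑ i ∈ Finset.range (n + 1), St.stepCost (k + i + 2))
      (.done (St.conf w (K + 2) (r m)).toA) := by
  induction n with
  | zero =>
    rintro k rfl
    simpa [hr.1] using ev_loop_halt hr hh hf m 0 (by omega)
  | succ n ih =>
    intro k hk
    obtain ⟨j, h1, h2, h3⟩ := le_pos_of_not_fits hw hr (hK k (by omega))
    have h4 := ev_loop_restart hr h1 h2 h3 (ih (k + 1) (by omega)) j 0 (by omega)
    rw [hr.1] at h4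
    refine h4.mono ?_
    -- The sum for the remaining phases is the sum for `k` without its first term, after a shift of
    -- the index.
    have e : ∑ i ∈ Finset.range (n + 1), St.stepCost (k + 1 + i + 2) =
        ∑ i ∈ Finset.range (n + 1), St.stepCost (k + (i + 1) + 2) :=
      Finset.sum_congr rfl fun i _ => by rw [add_assoc k 1, add_comm 1]
    rw [e, Finset.sum_range_succ' _ (n + 1), mul_add, add_zero]
    have := Nat.mul_le_mul_right (St.stepCost (k + 2)) (show j + 1 ≤ m + 1 by omega)
    omega

-- Numerical bounds for sizes and costs

theorem stepCost_le (k : ℕ) : St.stepCost (k + 2) ≤ 17 * (3 ^ (k + 2) * (k + 2)) := by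
  -- The factor `17` is dictated by `k = 0`, where a round may cost `304` calls for `18` squares.
  have h1 : 3 ^ 2 ≤ 3 ^ (k + 2) := Nat.pow_le_pow_right (by omega) (by omega)
  have h2 : St.stepCost (k + 2) = 3 ^ (k + 2) * (8 * k + 30) + 2 * k + 34 := by
    simp only [St.stepCost]
    ring
  rw [h2]
  nlinarith

/-- Sizes at least triple, so twice the bound for the last term suffices: `34 / 3 + 17 ≤ 34`. -/
theorem sum_stepCost_le (K : ℕ) : ∑ i ∈ Finset.range (K + 1), St.stepCost (i + 2) ≤
    34 * (3 ^ (K + 2) * (K + 2)) := by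
  induction K with
  | zero => simpa using (stepCost_le 0).trans (by norm_num)
  | succ K ih =>
    rw [Finset.sum_range_succ]
    have := stepCost_le (K + 1)
    have := three_mul_size_le K
    omega

/-- The preceding size was exceeded by the head, hence is at most `m`, and an enlargement multiplies
the size by at most `6`. Without any enlargement the size is `18`. -/
theorem size_le (hw : w ≠ []) (hr : IsRun w m r) {K : ℕ}
    (hK : ∀ k < K, ¬ ∀ i ≤ m, Fits w k (r i)) : 3 ^ (K + 2) * (K + 2) ≤ 18 * max 1 m := by
  rcases K with _ | k
  · simp
  · obtain ⟨j, h1, -, h2⟩ := le_pos_of_not_fits hw hr (hK k (by omega))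
    have h3 := pos_le_of_isRun hr (i := j + 1) h1
    have h4 : 3 ^ (k + 1 + 2) * (k + 1 + 2) ≤ 6 * (3 ^ (k + 2) * (k + 2)) := by
      calc 3 ^ (k + 1 + 2) * (k + 1 + 2) = 3 ^ (k + 2) * (3 * (k + 1 + 2)) := by ring
        _ ≤ 3 ^ (k + 2) * (6 * (k + 2)) := Nat.mul_le_mul_left _ (by omega)
        _ = _ := by ring
    have := le_max_right 1 m
    omega

theorem exists_ev_loop (hw : w ≠ []) (h : M.HaltsIn w m S) : ∃ k, Fits w k S ∧
    Ev (.loop (simulate M)) (St.conf w 2 M.init).toA (1224 * max 1 m ^ 2)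
      (.done (St.conf w (k + 2) S).toA) := by
  classical
  obtain ⟨r, hr, rfl⟩ := exists_isRun h.1
  have hex : ∃ k, ∀ i ≤ m, Fits w k (r i) := by
    by_contra! hne
    -- The parameter `k = m` always suffices: the head never gets beyond square `m`, and already `3
    -- ^ m` exceeds `m`.
    obtain ⟨j, h1, -, h2⟩ := le_pos_of_not_fits hw hr (k := m)
      (by simpa only [not_forall, exists_prop] using hne m)
    have h3 := pos_le_of_isRun hr (i := j + 1) h1
    have h4 : m < 3 ^ m := Nat.lt_pow_self (by omega)
    have h5 : 3 ^ m ≤ 3 ^ (m + 2) * (m + 2) := by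
      rw [pow_add, mul_assoc]
      exact Nat.le_mul_of_pos_right _ (by positivity)
    omega
  have hK : ∀ k < Nat.find hex, ¬ ∀ i ≤ m, Fits w k (r i) := fun k hk => Nat.find_min hex hk
  refine ⟨Nat.find hex, Nat.find_spec hex m le_rfl,
    (ev_loop_simulate hw hr h.2 (Nat.find_spec hex) hK (Nat.find hex) 0 (by omega)).mono ?_⟩
  simp only [zero_add]
  have h1 := sum_stepCost_le (Nat.find hex)
  have h2 := size_le hw hr hK
  have h3 : m + 1 ≤ 2 * max 1 m := by omega
  -- The factors bound the rounds of a phase, the sum of the costs and the final size; `1224 = 2 *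
  -- 34 * 18`.
  calc _ ≤ (2 * max 1 m) * (34 * (18 * max 1 m)) :=
        Nat.mul_le_mul h3 (h1.trans (Nat.mul_le_mul_left _ h2))
    _ = _ := by ring

theorem good_sim {hw : w ≠ []} (h : M.HaltsIn w m S) {G : HostGraph}
    (hG : (inputGraph M w hw).Iso G) : ∃ k, Fits w k S ∧
      Good (Out.done (St.conf w (k + 2) S).toA).Rep (1225 * max 1 m ^ 2) (.run (sim M) G) := by
  obtain ⟨k, h1, h2⟩ := exists_ev_loop hw h
  -- The square is at least one, so raising the constant to `1225` pays for the call of `setup`.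
  have : 1 ≤ max 1 m ^ 2 := Nat.one_le_pow _ _ (by omega)
  exact ⟨k, h1, ((Ev.seq (ev_setup hw) h2).mono (by omega)) G (Graph.iso_iff_rep.1 hG)⟩

end Time

/-- A maximum over terminating derivations exists only if there is an input graph with natural
numbers as names; the center is named `0` and square `i` is named `i + 1`. -/
theorem exists_inputGraph_iso (w : List (Fin 2)) (hw : w ≠ []) :
    ∃ G : HostGraph, (inputGraph M w hw).Iso G := by
  classical
  set f : Node → ℕ := fun v => match v with
    | .input i => i + 1
    | _ => 0 with hf
  set l : ℕ → Label := fun n => match n with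
    | 0 => num M.q₀
    | i + 1 => num (w.getD i 0).val with hl
  refine ⟨⟨(inputGraph M w hw).V.image f, {0}, l, (inputGraph M w hw).E.map (Edge.map f), ?_, ?_⟩,
    f, ?_, ?_, ?_, ?_, rfl⟩
  · simp [inputGraph, hf]
  · intro e he
    obtain ⟨e', he', rfl⟩ := Multiset.mem_map.1 he
    obtain ⟨h1, h2⟩ := (inputGraph M w hw).edge_mem e' he'
    exact ⟨Finset.mem_image_of_mem _ h1, Finset.mem_image_of_mem _ h2⟩
  · rintro (_ | i | i | i) hi (_ | j | j | j) hj <;> simp_all [inputGraph]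
  · simp
  · rintro (_ | i | i | i) hi <;> simp_all [inputGraph]
  · rintro (_ | i | i | i) hi <;> simp_all [inputGraph]

end SGP2

-- The main theorem

theorem mainTheorem3 (M : SGP2.OfflineTM) (t : ℕ → ℕ) (ht : M.HasTimeComplexity t) :
    -- `Sim(M)` first creates the graph of the initial configuration
    (∀ (w : List (Fin 2)) (hw : w ≠ []) (G : SGP2.HostGraph),
      (SGP2.inputGraph M w hw).Iso G →
        ∃ (G₀ : SGP2.HostGraph) (m : ℕ), SGP2.Encodes w 0 M.init G₀ ∧
          SGP2.Derives (.run (SGP2.sim M) G) m (.run (.loop (SGP2.simulate M)) G₀)) ∧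
    -- its main loop simulates `M`
    SGP2.Simulates M (SGP2.simulate M) ∧
    -- every terminating derivation ends in a graph that represents the final configuration
    (∀ (w : List (Fin 2)) (hw : w ≠ []) (G : SGP2.HostGraph),
      (SGP2.inputGraph M w hw).Iso G →
        ∀ (m : ℕ) (γ : SGP2.Config), SGP2.Derives (.run (SGP2.sim M) G) m γ → SGP2.Terminal γ →
          ∃ (m' : ℕ) (S : M.Conf) (k : ℕ) (G' : SGP2.HostGraph),
            M.HaltsIn w m' S ∧ SGP2.Encodes w k S G' ∧ γ = .done G') ∧
    -- the time complexity of `Sim(M)` is `O(t(n)²)`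
    (∃ T : ℕ → ℕ, SGP2.HasTimeComplexity (SGP2.sim M) (SGP2.inputs M) T ∧
      ∃ C : ℕ, ∀ n : ℕ, 1 ≤ n → T n ≤ C * (max 1 (t n)) ^ 2) := by
  have hhalt : ∀ (w : List (Fin 2)), w ≠ [] →
      ∃ m S, M.HaltsIn w m S ∧ m ≤ t w.length := fun w hw => by
    obtain ⟨h1, h2⟩ := ht w.length (List.length_pos_of_ne_nil hw)
    obtain ⟨m, S, h⟩ := h1 w rfl
    exact ⟨m, S, h, h2.2 ⟨w, S, rfl, h⟩⟩
  refine ⟨fun w hw G hG => SGP2.derives_setup hG, SGP2.simulates M, fun w hw G hG m γ hd hγ => ?_, ?_⟩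
  · obtain ⟨m', S, hS, -⟩ := hhalt w hw
    obtain ⟨k, hf, hg⟩ := SGP2.good_sim hS hG
    have h := (hg.derives_terminal hd hγ).2
    cases γ with
    | done H => exact ⟨m', S, k, H, hS, (SGP2.encodes_iff hf).2 h, rfl⟩
    | run P H => exact h.elim
    | fail => exact h.elim
  · have hgood : ∀ n, 1 ≤ n → ∀ G ∈ SGP2.inputs M n,
        ∃ Q, SGP2.Good Q (1225 * max 1 (t n) ^ 2) (.run (SGP2.sim M) G) := by
      rintro n - G ⟨w, hw, rfl, hG⟩
      obtain ⟨m', S, hS, hm⟩ := hhalt w hw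
      obtain ⟨k, -, hg⟩ := SGP2.good_sim hS hG
      exact ⟨_, hg.mono (Nat.mul_le_mul_left _ (Nat.pow_le_pow_left (max_le_max le_rfl hm) 2))⟩
    let X : ℕ → Set ℕ := fun n => {m | ∃ G ∈ SGP2.inputs M n, ∃ γ, SGP2.Terminal γ ∧
      SGP2.Derives (.run (SGP2.sim M) G) m γ}
    have hX : ∀ n, 1 ≤ n → ∀ m ∈ X n, m ≤ 1225 * max 1 (t n) ^ 2 := by
      rintro n hn m ⟨G, hG, γ, hγ, hd⟩
      obtain ⟨Q, hg⟩ := hgood n hn G hG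
      exact (hg.derives_terminal hd hγ).1
    have hne : ∀ n, 1 ≤ n → (X n).Nonempty := by
      intro n hn
      have hw : List.replicate n (0 : Fin 2) ≠ [] := by
        rw [Ne, List.replicate_eq_nil_iff]
        omega
      obtain ⟨G, hG⟩ := SGP2.exists_inputGraph_iso (M := M) _ hw
      have hG' : G ∈ SGP2.inputs M n := ⟨_, hw, List.length_replicate, hG⟩
      obtain ⟨Q, hg⟩ := hgood n hn G hG'
      obtain ⟨m, γ, h1, h2, -⟩ := hg.exists_derives
      exact ⟨m, G, hG', γ, h2, h1⟩
    -- The supremum is a maximum, since the set of call counts is nonempty and bounded.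
    refine ⟨fun n => sSup (X n), fun n hn => ⟨fun G hG => ?_, ?_⟩, 1225, fun n hn => ?_⟩
    · obtain ⟨Q, hg⟩ := hgood n hn G hG
      exact hg.not_infinite
    · exact ⟨Nat.sSup_mem (hne n hn) ⟨_, hX n hn⟩, fun m hm => le_csSup ⟨_, hX n hn⟩ hm⟩
    · exact csSup_le (hne n hn) (hX n hn)
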